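/- **Setting.** Let $\mathcal X\subseteq\mathbb R^d$. For each $m\in\mathbb N$ consider a circuit on $m$ qubits with $L=L(m)$ layers and parameters $\Theta=(\theta_{[\ell k]})_{\ell\le L,\,k\le m}\in\mathbb R^{|\Theta|}$, $|\Theta|=Lm$, $$U(\Theta,x)=V_L(x)W_L(\Theta)\cdots V_1(x)W_1(\Theta),\qquad W_\ell(\Theta)=\bigotimes_{k=1}^m e^{-i\theta_{[\ell k]}\mathcal G_{[\ell k]}},$$ where each $\mathcal G_{[\ell k]}$ is a Hermitian $2\times2$ matrix with spectrum $\{-1,+1\}$ and $V_\ell(x)$ is a tensor product of one- and two-qubit unitary gates acting on disjoint qubits (the gates may depend on $x$; the set of interacting pairs depends only on $\ell$). Let $\mathcal O_k$ act as $O_k$ on qubit $k$ and trivially elsewhere, where $O_k$ is Hermitian and traceless with spectrum in $[-1,1]$. With normalization constants $N(m)>0$, $N_K(m)>0$ set $$f_k(\Theta,x)=\langle 0^m|U^\dagger\mathcal O_kU|0^m\rangle,\qquad f(\Theta,x)=\frac1{N(m)}\sum_{k=1}^m f_k(\Theta,x),\qquad \hat K_\Theta(x,x')=\frac1{N_K(m)}\nabla_\Theta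 f(\Theta,x)\cdot\nabla_\Theta f(\Theta,x').$$ Let $\mathcal I_{\ell,k}$ consist of $k$ and of the qubit, if any, with which $k$ interacts in layer $\ell$; let $\mathcal J^L_k=\mathcal I_{L,k}$, $\mathcal J^\ell_k=\bigcup_{k'\in\mathcal J^{\ell+1}_k}\mathcal I_{\ell,k'}$ for $\ell<L$, $\mathcal N_k=\{[\ell k']:k'\in\mathcal J^\ell_k\}$ and $\mathcal M_i=\{k: i\in\mathcal N_k\}$; write $|\mathcal M|=\max_i|\mathcal M_i|$ and $|\mathcal N|=\max_k|\mathcal N_k|$. At initialization the components of $\Theta_0$ are independent and uniform on $[0,\pi]$. Under this distribution assume: 1. $\mathbb E[f_k(\Theta_0,x)]=0$ for all $m$, $k$, $x$, and $\mathbb E[f(\Theta_0,x)f(\Theta_0,x')]\to\mathcal K(x,x')$ as $m\to\infty$, uniformly in $x,x'\in\mathcal X$, for some function $\mathcal K$ with $\mathcal K(x,x)>0$ for all $x$; 2. $\mathbb E[\hat K_{\Theta_0}(x,x')]\to\bar K(x,x')$ as $m\to\infty$, uniformly in $x,x'\in\mathcal X$, for some function $\bar K$. Let $(x^{(j)},y^{(j)})_{j=1}^n$,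 with $n\ge1$, be a training set in $\mathcal X\times\mathbb R$, let $\lambda_{\min}$ and $\lambda_{\max}$ be the smallest and the largest eigenvalue of the matrix $(\bar K(x^{(j)},x^{(j')}))_{j,j'}$, and assume $\lambda_{\min}>0$. Let $\mathcal L(\Theta)=\frac1n\sum_j\frac12(f(\Theta,x^{(j)})-y^{(j)})^2$ and let $f^{\mathrm{lin}}(\Theta,x)=f(\Theta_0,x)+\nabla_\Theta f(\Theta_0,x)\cdot(\Theta-\Theta_0)$ be the linearized model. Assume moreover that $\displaystyle\lim_{m\to\infty}\frac{Lm|\mathcal M|^4|\mathcal N|^2}{N^3(m)}=0$ and $0<\eta_0<\dfrac{2}{\lambda_{\min}+\lambda_{\max}}$, and let $\eta=\frac{n}{N_K(m)}\eta_0$. For $\delta>0$ and $T\in\mathbb N$, train by $\Theta_{t+1}=\Theta_t-\eta\,g^{(t)}(\Theta_t)$, $0\le t<T$, with a random gradient estimator such that for all $t\le T$, all histories $(\Theta_k,\xi_k)_{k<t}$, all $\Theta\in\mathbb R^{|\Theta|}$ and all $i$, with $c_0=\frac1{864\pi^2}$, $$\mathbb E\big[g^{(t)}_i(\Theta)\,\big|\,g^{(k)}(\Theta_k)=\xi_k\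 \forall k<t\big]=\partial_{\theta_i}\mathcal L(\Theta),$$ $$\mathrm{Var}\big[g^{(t)}_i(\Theta)\,\big|\,g^{(k)}(\Theta_k)=\xi_k\ \forall k<t\big]\le c_0\eta_0^2\,\frac{\lambda_{\min}^4}{n^2}\,\frac{N_K^2(m)N^2(m)}{|\mathcal M|^2|\Theta|^3}\,\frac{\delta}{(t+1)^2}\,\mathcal L(\Theta).$$ **Theorem (trainability of the model).** For every $\delta>0$ there are constants $R_0,R_1,R_2>0$, which depend only on $\delta$ and on upper bounds for $\max_j|y^{(j)}|$ and $\max_j\mathcal K(x^{(j)},x^{(j)})$, such that in every setting as above there is $\bar m\in\mathbb N$, independent of $T$ and of the estimator, such that for all $m\ge\bar m$, with probability at least $1-\delta$ over the initialization and the stochastic training, the following hold for all $t\le T$: $$\mathcal L(\Theta_t)\le\frac{R_0^2}{2}\log(2n)\Big(1-\frac{\eta_0\lambda_{\min}}3\Big)^{2t},$$ $$\|\Theta_t-\Theta_0\|_\infty\le R_1\eta_0\lambda_{\min}\sqrt{\log(2n)}\,\frac{N(m)}{|\mathcal M||\Theta|}+\frac{R_2}{\lambda_{\min}}n\sqrt{\log(2n)}\,\frac{|\mathcal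 M|}{N_K(m)N(m)},$$ $$\sup_{x\in\mathcal X}|f(\Theta_t,x)-f^{\mathrm{lin}}(\Theta_t,x)|\le2R_1^2\eta_0^2\lambda_{\min}^2\log(2n)\frac{|\mathcal N|N(m)}{Lm}+\frac{2R_2^2}{\lambda_{\min}^2}n^2\log(2n)\frac{Lm|\mathcal M|^4|\mathcal N|}{N_K^2(m)N^3(m)}.$$ Moreover, the right-hand side of the second bound tends to $0$ as $m\to\infty$. -/

import Mathlib

open MeasureTheory ProbabilityTheory Filter Topology

noncomputable section

namespace QNN

/-- Computational basis labels of `m` qubits; the Hilbert space is `Basis m → ℂ`. -/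
abbrev Basis (m : ℕ) := Fin m → Fin 2

/-- Operators on the Hilbert space of `m` qubits, in the computational basis. -/
abbrev Op (m : ℕ) := Matrix (Basis m) (Basis m) ℂ

/-- Parameter vectors `Θ`: one real parameter `θ_[ℓ k]` for each layer `ℓ` and each qubit `k`.
The norm `‖Θ‖` of this type is the sup norm. -/
abbrev Params (L m : ℕ) := Fin L × Fin m → ℝ

/-- The tensor product `A₁ ⊗ ⋯ ⊗ A_m` of one-qubit operators. -/
def tensor {m : ℕ} (A : Fin m → Matrix (Fin 2) (Fin 2) ℂ) : Op m :=
  Matrix.of fun s s' => ∏ k, A k (s k) (s' k)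

/-- The state `|0^m⟩`. -/
def ket0 (m : ℕ) : Basis m → ℂ := Pi.single (fun _ => 0) 1

/-- A layered parameterized circuit on `m` qubits with `L` layers and inputs in `X`, together with
the one-qubit observables measured at the end.  In layer `ℓ` a parameterized gate
`exp (-i θ G)` acts on each qubit, and then fixed one- and two-qubit gates (which may depend on the
input) act on disjoint qubits: `partner ℓ` is the involution that sends a qubit to the qubit with
which it interacts, or to itself if it interacts with no other one. -/
structure Circuit (X : Type*) (m L : ℕ) where
  /-- The generators of the parameterized gates. -/
  G : Fin L → Fin m → Matrix (Fin 2) (Fin 2) ℂ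
  G_herm : ∀ ℓ k, (G ℓ k).IsHermitian
  G_spec : ∀ ℓ k, spectrum ℝ (G ℓ k) = {-1, 1}
  /-- The interaction pattern of each layer. -/
  partner : Fin L → Fin m → Fin m
  partner_invol : ∀ ℓ, Function.Involutive (partner ℓ)
  /-- The gate on qubit `k`; only used if `partner ℓ k = k`. -/
  gate₁ : Fin L → X → Fin m → Matrix (Fin 2) (Fin 2) ℂ
  gate₁_unitary : ∀ ℓ x k, gate₁ ℓ x k ∈ Matrix.unitaryGroup (Fin 2) ℂ
  /-- The gate on the pair of qubits `(k, partner ℓ k)`; only used if `k < partner ℓ k`. -/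
  gate₂ : Fin L → X → Fin m → Matrix (Fin 2 × Fin 2) (Fin 2 × Fin 2) ℂ
  gate₂_unitary : ∀ ℓ x k, gate₂ ℓ x k ∈ Matrix.unitaryGroup (Fin 2 × Fin 2) ℂ
  /-- The one-qubit observables. -/
  O : Fin m → Matrix (Fin 2) (Fin 2) ℂ
  O_herm : ∀ k, (O k).IsHermitian
  O_trace : ∀ k, (O k).trace = 0
  O_spec : ∀ k, spectrum ℝ (O k) ⊆ Set.Icc (-1) 1

/-- The partial derivative `∂_i g (Θ)`. -/
def pderiv {ι : Type*} [DecidableEq ι] (g : (ι → ℝ) → ℝ) (i : ι) (Θ : ι → ℝ) : ℝ :=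
  deriv (fun s => g (Function.update Θ i s)) (Θ i)

/-- The uniform distribution on `[0, π]^ι`, i.e. independent parameters uniform in `[0, π]`. -/
def uniformInit (ι : Type*) [Fintype ι] : Measure (ι → ℝ) :=
  Measure.pi fun _ => ProbabilityTheory.cond volume (Set.Icc 0 Real.pi)

namespace Circuit

variable {X : Type*} {m L : ℕ} (C : Circuit X m L)

/-- The parameterized part `W_ℓ(Θ)` of layer `ℓ`. -/
def paramLayer (ℓ : Fin L) (Θ : Params L m) : Op m :=
  tensor fun k => NormedSpace.exp ((-(Complex.I * (Θ (ℓ, k) : ℂ))) • C.G ℓ k)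

/-- The input-dependent part `V_ℓ(x)` of layer `ℓ`: the tensor product of its one- and two-qubit
gates, each pair of interacting qubits being counted at its smaller element. -/
def fixedLayer (ℓ : Fin L) (x : X) : Op m :=
  Matrix.of fun s s' => ∏ k : Fin m,
    if C.partner ℓ k = k then C.gate₁ ℓ x k (s k) (s' k)
    else if k < C.partner ℓ k then
      C.gate₂ ℓ x k (s k, s (C.partner ℓ k)) (s' k, s' (C.partner ℓ k))
    else 1

/-- `U(Θ, x) = V_L(x) W_L(Θ) ⋯ V_1(x) W_1(Θ)`. -/
def unitary (Θ : Params L m) (x : X) : Op m :=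
  (List.ofFn fun ℓ : Fin L => C.fixedLayer ℓ x * C.paramLayer ℓ Θ).reverse.prod

/-- The observable `𝒪_k`: `O_k` on qubit `k` and the identity on the other qubits. -/
def localObs (k : Fin m) : Op m := tensor (Pi.mulSingle k (C.O k))

/-- `f_k(Θ, x) = ⟨0^m| U†(Θ, x) 𝒪_k U(Θ, x) |0^m⟩`. -/
def localModel (k : Fin m) (Θ : Params L m) (x : X) : ℝ :=
  (star (ket0 m) ⬝ᵥ
    (((C.unitary Θ x).conjTranspose * C.localObs k * C.unitary Θ x).mulVec (ket0 m))).re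

/-- The model function `f(Θ, x)`, with normalization constant `N`. -/
def model (N : ℝ) (Θ : Params L m) (x : X) : ℝ :=
  (1 / N) * ∑ k, C.localModel k Θ x

/-- The linearization of the model function around `Θ₀`, evaluated at `Θ`. -/
def linModel (N : ℝ) (Θ₀ Θ : Params L m) (x : X) : ℝ :=
  C.model N Θ₀ x + ∑ i, pderiv (fun Θ' => C.model N Θ' x) i Θ₀ * (Θ i - Θ₀ i)

/-- The mean squared error on the training set `(x i, y i)`. -/
def loss (N : ℝ) {n : ℕ} (x : Fin n → X) (y : Fin n → ℝ) (Θ : Params L m) : ℝ :=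
  (1 / (n : ℝ)) * ∑ j, (1 / 2 : ℝ) * (C.model N Θ (x j) - y j) ^ 2

/-- The empirical neural tangent kernel, with normalization constant `NK`. -/
def empNTK (N NK : ℝ) (Θ : Params L m) (x x' : X) : ℝ :=
  (1 / NK) * ∑ i, pderiv (fun Θ' => C.model N Θ' x) i Θ * pderiv (fun Θ' => C.model N Θ' x') i Θ

/-- The analytic neural tangent kernel: the expectation of the empirical one at initialization. -/
def ntk (N NK : ℝ) (x x' : X) : ℝ :=
  ∫ Θ, C.empNTK N NK Θ x x' ∂(uniformInit (Fin L × Fin m))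

/-- The covariance `E[f(Θ, x) f(Θ, x')]` at initialization. -/
def cov (N : ℝ) (x x' : X) : ℝ :=
  ∫ Θ, C.model N Θ x * C.model N Θ x' ∂(uniformInit (Fin L × Fin m))

/-- `ℐ_{ℓ,k}`: the qubit `k` and the qubit with which it interacts in layer `ℓ`. -/
def interacting (ℓ : Fin L) (k : Fin m) : Finset (Fin m) := {k, C.partner ℓ k}

/-- `𝒥^ℓ_k`, by descending recursion on the layer, starting from `{k}` after the last layer:
the last layer gives `ℐ_{L,k}`, and layer `ℓ` gives the union of `ℐ_{ℓ,k'}` over `k' ∈ 𝒥^{ℓ+1}_k`. -/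
def pastQubits (k : Fin m) (ℓ : Fin L) : Finset (Fin m) :=
  Fin.reverseInduction (motive := fun _ : Fin (L + 1) => Finset (Fin m)) {k}
    (fun ℓ' S => S.biUnion (C.interacting ℓ')) ℓ.castSucc

/-- `𝒩_k`: the (extended) past light cone of the observable `k`. -/
def pastCone (k : Fin m) : Finset (Fin L × Fin m) :=
  Finset.univ.filter fun i => i.2 ∈ C.pastQubits k i.1

/-- `ℳ_i`: the (extended) future light cone of the parameter `i`. -/
def futureCone (i : Fin L × Fin m) : Finset (Fin m) :=
  Finset.univ.filter fun k => i ∈ C.pastCone k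

/-- `|ℳ|`: the maximal cardinality of a future light cone. -/
def maxM : ℕ := Finset.univ.sup fun i => (C.futureCone i).card

/-- `|𝒩|`: the maximal cardinality of a past light cone. -/
def maxN : ℕ := Finset.univ.sup fun k => (C.pastCone k).card

end Circuit

/-- A stochastic gradient estimator on parameter vectors indexed by `ι`: at each time `t`, for each
history `(Θ_k, ξ_k)_{k < t}` of queried points and observed estimates and each parameter vector
`Θ`, the law of `g^{(t)}(Θ)` conditional on `g^{(k)}(Θ_k) = ξ_k` for all `k < t`. -/
structure GradEstimator (ι : Type*) where
  law : (t : ℕ) → Kernel ((Fin t → (ι → ℝ) × (ι → ℝ)) × (ι → ℝ)) (ι → ℝ)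
  isMarkov : ∀ t, IsMarkovKernel (law t)

/-- Up to time `T` the estimator is unbiased for the gradient of `loss`, conditionally on any
history. -/
def GradEstimator.Unbiased {ι : Type*} [DecidableEq ι] (g : GradEstimator ι)
    (loss : (ι → ℝ) → ℝ) (T : ℕ) : Prop :=
  ∀ t ≤ T, ∀ (h : Fin t → (ι → ℝ) × (ι → ℝ)) (Θ : ι → ℝ) (i : ι),
    Integrable (fun v : ι → ℝ => v i) (g.law t (h, Θ)) ∧
      ∫ v, v i ∂(g.law t (h, Θ)) = pderiv loss i Θ

/-- Up to time `T`, the variance of each component of `g^{(t)}(Θ)`, conditionally on any history,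
is at most `b t Θ`. -/
def GradEstimator.VarianceLE {ι : Type*} (g : GradEstimator ι)
    (b : ℕ → (ι → ℝ) → ℝ) (T : ℕ) : Prop :=
  ∀ t ≤ T, ∀ (h : Fin t → (ι → ℝ) × (ι → ℝ)) (Θ : ι → ℝ) (i : ι),
    evariance (fun v : ι → ℝ => v i) (g.law t (h, Θ)) ≤ ENNReal.ofReal (b t Θ)

/-- `Θ_0, …, Θ_T` is a run of the stochastic gradient descent `Θ_{t+1} = Θ_t - η g^{(t)}(Θ_t)` with
uniform random initialization; `ξ t` is the value of `g^{(t)}(Θ_t)` that is observed at time `t`. -/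
structure IsSGDRun {ι : Type*} [Fintype ι] {Ω : Type*} [MeasurableSpace Ω] (P : Measure Ω)
    (g : GradEstimator ι) (η : ℝ) (T : ℕ) (Θ ξ : ℕ → Ω → ι → ℝ) : Prop where
  init : HasLaw (Θ 0) (uniformInit ι) P
  estimate : ∀ t < T, HasCondDistrib (ξ t)
    (fun ω => ((fun k : Fin t => (Θ k ω, ξ k ω)), Θ t ω)) (g.law t) P
  step : ∀ t < T, ∀ᵐ ω ∂P, Θ (t + 1) ω = Θ t ω - η • ξ t ω

end QNN

end

/-! Training stays where the model is almost affine in its parameters, so that a gradient step acts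
on the vector of training residuals almost as multiplication by `1 - η₀ K`, with `K` the limiting
kernel matrix.

Each `f_k` is bounded by 1, is a trigonometric polynomial of frequency 2 in every angle, and depends
only on the angles in its past light cone (`localModel_update_of_notMem`, by evolving the observable
backwards through the circuit). The parameter-shift rule `IsTrig.pderiv_eq` writes a partial
derivative as a difference of two values, so bounds on `f_k` pass to its derivatives: `|∂_i f| ≤
2|ℳ|/N`, and `∂_i f` has Lipschitz constant `4|ℳ||𝒩|/N` in the sup norm. These two constants control
the linearization error, the drift of the empirical kernel during training and, through the
Efron–Stein inequality, its fluctuation at initialization.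

The core is the deterministic bootstrap `descent`. As long as the parameters are close to their
initial value, the empirical kernel is close to `K` and the residuals contract geometrically; the
steps are proportional to the residuals, so their sum is a geometric series and the parameters
remain close. Probability enters through three bad events, each of probability at most `δ/3`: large
initial residuals (Markov for the square), an initial kernel far from its mean (`efronStein` and
Chebyshev), and a gradient error larger than a fixed multiple of the residual norm (Chebyshev
conditionally on the history, summable over time because of the factor `1/(t+1)²`). This is
assembled in `training`.

For the error terms to vanish, `N_K` must stay away from zero and `N²` must be `O(Lm|ℳ|²)`. Neither
is assumed: both follow from the Poincaré inequality `IsTrig.poincare`, which for the mean-zero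
model gives `4 E[f²] ≤ N_K E[K̂] ≤ Lm(2|ℳ|/N)²`, while `E[f²]` has a positive limit and `E[K̂]`
converges. `tendsto_error_terms` then derives every limit from the single growth condition on the
light cones. -/

noncomputable section

namespace QNN

/-! ### Layers of disjoint gates: locality and unitarity -/

section Layers

variable {m : ℕ}

/-- The factor that qubit `k` contributes to the entries of a layer with interaction pattern `p`. -/
def blockEntry (p : Fin m → Fin m) (g₁ : Fin m → Matrix (Fin 2) (Fin 2) ℂ)
    (g₂ : Fin m → Matrix (Fin 2 × Fin 2) (Fin 2 × Fin 2) ℂ) (k : Fin m) (s s' : Basis m) : ℂ :=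
  if p k = k then g₁ k (s k) (s' k)
  else if k < p k then g₂ k (s k, s (p k)) (s' k, s' (p k))
  else 1

/-- The product of those gates of a layer that act on the qubits in `A`. -/
def layerOn (p : Fin m → Fin m) (g₁ : Fin m → Matrix (Fin 2) (Fin 2) ℂ)
    (g₂ : Fin m → Matrix (Fin 2 × Fin 2) (Fin 2 × Fin 2) ℂ) (A : Finset (Fin m)) : Op m :=
  Matrix.of fun s s' => (∏ k ∈ A, blockEntry p g₁ g₂ k s s') *
    ∏ k ∈ Aᶜ, if s k = s' k then 1 else 0

/-- The operator `M` is of the form `M' ⊗ 1` with `M'` acting on the qubits in `S`. -/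
def SupportedOn (S : Finset (Fin m)) (M : Op m) : Prop :=
  (∀ s s' k, k ∉ S → s k ≠ s' k → M s s' = 0) ∧
  (∀ s s' t t' : Basis m, (∀ k ∈ S, s k = t k ∧ s' k = t' k) →
    (∀ k ∉ S, s k = s' k ∧ t k = t' k) → M s s' = M t t')

/-- The operator `M` commutes with everything supported outside of `S`. -/
def LocalTo (S : Finset (Fin m)) (M : Op m) : Prop :=
  ∀ T B, Disjoint S T → SupportedOn T B → Commute M B

theorem SupportedOn.conjTranspose {S : Finset (Fin m)} {M : Op m} (h : SupportedOn S M) :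
    SupportedOn S M.conjTranspose := by
  refine ⟨fun s s' k hk hne => ?_, fun s s' t t' h1 h2 => ?_⟩
  · rw [Matrix.conjTranspose_apply, h.1 s' s k hk hne.symm, star_zero]
  · rw [Matrix.conjTranspose_apply, Matrix.conjTranspose_apply,
      h.2 s' s t' t (fun k hk => (h1 k hk).symm) (fun k hk => ⟨(h2 k hk).1.symm, (h2 k hk).2.symm⟩)]

/-- Only one intermediate label contributes: `M` fixes it to `s` off `S`, and `B` fixes it to `s'`
on `S`. -/
theorem SupportedOn.mul_apply {S T : Finset (Fin m)} {M B : Op m} (hM : SupportedOn S M)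
    (hB : SupportedOn T B) (hST : Disjoint S T) (s s' : Basis m) :
    (M * B) s s' = M s (S.piecewise s' s) * B (S.piecewise s' s) s' := by
  rw [Matrix.mul_apply]
  refine Finset.sum_eq_single _ (fun t _ ht => ?_) (fun h => absurd (Finset.mem_univ _) h)
  obtain ⟨k, hk⟩ := Function.ne_iff.mp ht
  by_cases hkS : k ∈ S
  · rw [Finset.piecewise_eq_of_mem _ _ _ hkS] at hk
    rw [hB.1 t s' k (Finset.disjoint_left.mp hST hkS) hk, mul_zero]
  · rw [Finset.piecewise_eq_of_notMem _ _ _ hkS] at hk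
    rw [hM.1 s t k hkS (Ne.symm hk), zero_mul]

/-- In either order the product of entries has a single term, and the two factors depend only on the
labels in `S` and in `T`, so the orders agree. Commutation is the notion carried through the circuit
because it is trivially stable under products. -/
theorem SupportedOn.localTo {S : Finset (Fin m)} {M : Op m} (hM : SupportedOn S M) :
    LocalTo S M := by
  intro T B hST hB
  ext s s'
  rw [hM.mul_apply hB hST, hB.mul_apply hM hST.symm]
  by_cases hss : ∃ k, k ∉ S ∧ k ∉ T ∧ s k ≠ s' k
  · obtain ⟨k, hkS, hkT, hk⟩ := hss
    rw [hB.1 _ s' k hkT (by rwa [Finset.piecewise_eq_of_notMem _ _ _ hkS]),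
      hM.1 _ s' k hkS (by rwa [Finset.piecewise_eq_of_notMem _ _ _ hkT]), mul_zero, mul_zero]
  · push Not at hss
    rw [mul_comm]
    congr 1
    · refine hB.2 _ _ _ _ (fun k hk => ?_) (fun k hk => ?_)
      · have := Finset.disjoint_right.mp hST hk
        simp [Finset.piecewise, hk, this]
      · by_cases hkS : k ∈ S <;> simp [Finset.piecewise, hk, hkS]
        exact hss k hkS hk
    · refine hM.2 _ _ _ _ (fun k hk => ?_) (fun k hk => ?_)
      · have := Finset.disjoint_left.mp hST hk
        simp [Finset.piecewise, hk, this]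
      · by_cases hkT : k ∈ T <;> simp [Finset.piecewise, hk, hkT]
        exact hss k hk hkT

theorem LocalTo.mul {S : Finset (Fin m)} {M M' : Op m} (h : LocalTo S M) (h' : LocalTo S M') :
    LocalTo S (M * M') :=
  fun T B hT hB => (h T B hT hB).mul_left (h' T B hT hB)

theorem LocalTo.mono {S S' : Finset (Fin m)} {M : Op m} (h : LocalTo S M) (hS : S ⊆ S') :
    LocalTo S' M :=
  fun T B hT hB => h T B (Finset.disjoint_of_subset_left hS hT) hB

variable {p : Fin m → Fin m} {g₁ h₁ : Fin m → Matrix (Fin 2) (Fin 2) ℂ}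
  {g₂ h₂ : Fin m → Matrix (Fin 2 × Fin 2) (Fin 2 × Fin 2) ℂ} {A B : Finset (Fin m)}

theorem blockEntry_congr {k : Fin m} {s s' t t' : Basis m} (h : s k = t k) (h' : s' k = t' k)
    (hp : s (p k) = t (p k)) (hp' : s' (p k) = t' (p k)) :
    blockEntry p g₁ g₂ k s s' = blockEntry p g₁ g₂ k t t' := by
  simp only [blockEntry, h, h', hp, hp']

theorem layerOn_supportedOn (hA : ∀ k ∈ A, p k ∈ A) : SupportedOn A (layerOn p g₁ g₂ A) := by
  refine ⟨fun s s' k hk hne => ?_, fun s s' t t' h1 h2 => ?_⟩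
  · rw [layerOn, Matrix.of_apply, Finset.prod_eq_zero (Finset.mem_compl.mpr hk) (if_neg hne),
      mul_zero]
  · rw [layerOn, Matrix.of_apply, Matrix.of_apply]
    congr 1
    · exact Finset.prod_congr rfl fun k hk => blockEntry_congr (h1 k hk).1 (h1 k hk).2
        (h1 _ (hA k hk)).1 (h1 _ (hA k hk)).2
    · refine Finset.prod_congr rfl fun k hk => ?_
      rw [if_pos (h2 k (Finset.mem_compl.mp hk)).1, if_pos (h2 k (Finset.mem_compl.mp hk)).2]

theorem layerOn_congr (hgh : ∀ k ∈ A, g₁ k = h₁ k) :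
    layerOn p g₁ g₂ A = layerOn p h₁ g₂ A := by
  ext s s'
  simp only [layerOn, Matrix.of_apply]
  congr 1
  exact Finset.prod_congr rfl fun k hk => by simp only [blockEntry, hgh k hk]

/-- Invariance under `p` keeps both ends of each two-qubit gate in the same factor. -/
theorem layerOn_union (hA : ∀ k ∈ A, p k ∈ A) (hB : ∀ k ∈ B, p k ∈ B) (hAB : Disjoint A B) :
    layerOn p g₁ g₂ (A ∪ B) = layerOn p g₁ g₂ A * layerOn p g₁ g₂ B := by
  ext s s'
  rw [(layerOn_supportedOn hA).mul_apply (layerOn_supportedOn hB) hAB]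
  simp only [layerOn, Matrix.of_apply]
  have e1 : ∏ k ∈ A, blockEntry p g₁ g₂ k s (A.piecewise s' s)
      = ∏ k ∈ A, blockEntry p g₁ g₂ k s s' :=
    Finset.prod_congr rfl fun k hk => blockEntry_congr rfl
      (Finset.piecewise_eq_of_mem _ _ _ hk) rfl (Finset.piecewise_eq_of_mem _ _ _ (hA k hk))
  have e2 : ∏ k ∈ B, blockEntry p g₁ g₂ k (A.piecewise s' s) s'
      = ∏ k ∈ B, blockEntry p g₁ g₂ k s s' :=
    Finset.prod_congr rfl fun k hk => blockEntry_congr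
      (Finset.piecewise_eq_of_notMem _ _ _ (Finset.disjoint_right.mp hAB hk)) rfl
      (Finset.piecewise_eq_of_notMem _ _ _ (Finset.disjoint_right.mp hAB (hB k hk))) rfl
  have e3 : ∏ k ∈ Aᶜ, (if s k = A.piecewise s' s k then (1 : ℂ) else 0) = 1 :=
    Finset.prod_eq_one fun k hk => if_pos
      (Finset.piecewise_eq_of_notMem _ _ _ (Finset.mem_compl.mp hk)).symm
  have e4 : ∏ k ∈ Bᶜ, (if A.piecewise s' s k = s' k then (1 : ℂ) else 0)
      = ∏ k ∈ (A ∪ B)ᶜ, if s k = s' k then 1 else 0 := by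
    have : Bᶜ = A ∪ (A ∪ B)ᶜ := by
      ext k
      have := @Finset.disjoint_left _ A B
      simp only [Finset.mem_compl, Finset.mem_union]
      grind
    rw [this, Finset.prod_union
      (Finset.disjoint_left.mpr fun k hk => by simp [hk])]
    rw [Finset.prod_eq_one fun k hk => if_pos (Finset.piecewise_eq_of_mem _ _ _ hk), one_mul]
    refine Finset.prod_congr rfl fun k hk => ?_
    rw [Finset.piecewise_eq_of_notMem _ _ _ (by simp at hk; exact hk.1)]
  rw [e1, e2, e3, e4, Finset.prod_union hAB]
  ring

theorem layerOn_conjTranspose : (layerOn p g₁ g₂ A).conjTranspose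
    = layerOn p (fun k => (g₁ k).conjTranspose) (fun k => (g₂ k).conjTranspose) A := by
  ext s s'
  simp only [layerOn, Matrix.conjTranspose_apply, Matrix.of_apply, star_mul', star_prod]
  congr 1
  · refine Finset.prod_congr rfl fun k _ => ?_
    simp only [blockEntry]
    split_ifs <;> simp [Matrix.conjTranspose_apply]
  · refine Finset.prod_congr rfl fun k _ => ?_
    simp only [eq_comm (a := s' k)]
    split_ifs <;> simp

theorem layerOn_one (hp : Function.Involutive p) (hA : ∀ k ∈ A, p k ∈ A) :
    layerOn p (fun _ => 1) (fun _ => 1) A = 1 := by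
  ext s s'
  rw [layerOn, Matrix.of_apply]
  by_cases hs : s = s'
  · subst hs
    rw [Matrix.one_apply_eq, Finset.prod_eq_one, Finset.prod_eq_one, one_mul]
    · simp
    · intro k _
      simp only [blockEntry, Matrix.one_apply_eq]
      split_ifs <;> rfl
  · rw [Matrix.one_apply_ne hs]
    obtain ⟨j, hj⟩ := Function.ne_iff.mp hs
    by_cases hjA : j ∈ A
    · rw [mul_eq_zero]
      left
      rcases lt_trichotomy j (p j) with h | h | h
      · refine Finset.prod_eq_zero hjA ?_
        rw [blockEntry, if_neg h.ne', if_pos h, Matrix.one_apply_ne (by simp [hj])]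
      · refine Finset.prod_eq_zero hjA ?_
        rw [blockEntry, if_pos h.symm, Matrix.one_apply_ne hj]
      · refine Finset.prod_eq_zero (hA j hjA) ?_
        rw [blockEntry, hp j, if_neg h.ne', if_pos h, Matrix.one_apply_ne (by simp [hj])]
    · rw [Finset.prod_eq_zero (Finset.mem_compl.mpr hjA) (if_neg hj), mul_zero]

theorem layerOn_mul_singleton {k : Fin m} (hk : p k = k) :
    layerOn p g₁ g₂ {k} * layerOn p h₁ h₂ {k}
      = layerOn p (fun j => g₁ j * h₁ j) (fun j => g₂ j * h₂ j) {k} := by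
  ext s s'
  rw [Matrix.mul_apply]
  simp only [layerOn, Matrix.of_apply, Finset.prod_singleton, blockEntry, hk, if_true,
    Matrix.mul_apply]
  rw [Finset.sum_mul]
  symm
  refine Fintype.sum_of_injective (fun b => Function.update s k b)
    (Function.update_injective s k) _ _ (fun t ht => ?_) (fun b => ?_)
  · have : ∃ j, j ≠ k ∧ s j ≠ t j := by
      by_contra! hcon
      refine ht ⟨t k, ?_⟩
      ext j
      by_cases hj : j = k
      · subst hj; simp
      · simp [Function.update_of_ne hj, hcon j hj]
    obtain ⟨j, hj, hne⟩ := this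
    rw [Finset.prod_eq_zero (i := j) (by simp [hj]) (if_neg hne)]
    simp
  · have e1 : ∏ x ∈ ({k} : Finset (Fin m))ᶜ,
        (if s x = Function.update s k b x then (1 : ℂ) else 0) = 1 :=
      Finset.prod_eq_one fun j hj => if_pos (by
        rw [Function.update_of_ne (by simpa using hj)])
    have e2 : ∏ x ∈ ({k} : Finset (Fin m))ᶜ,
        (if Function.update s k b x = s' x then (1 : ℂ) else 0)
        = ∏ x ∈ ({k} : Finset (Fin m))ᶜ, if s x = s' x then 1 else 0 :=
      Finset.prod_congr rfl fun j hj => by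
        rw [Function.update_of_ne (by simpa using hj)]
    rw [e1, e2, Function.update_self]
    ring

/-- The gate of the pair sits at its smaller element and the larger one contributes 1, so the sum
over intermediate labels runs only over the four labels of the pair. -/
theorem layerOn_mul_pair (hp : Function.Involutive p) {k : Fin m} (hk : k < p k) :
    layerOn p g₁ g₂ {k, p k} * layerOn p h₁ h₂ {k, p k}
      = layerOn p (fun j => g₁ j * h₁ j) (fun j => g₂ j * h₂ j) {k, p k} := by
  ext s s'
  rw [Matrix.mul_apply]
  simp only [layerOn, Matrix.of_apply, Finset.prod_pair hk.ne, blockEntry, hk.ne', hk, if_true,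
    if_false, Matrix.mul_apply, hp k, hk.ne, hk.not_gt, mul_one]
  rw [Finset.sum_mul]
  symm
  refine Fintype.sum_of_injective
    (fun b : Fin 2 × Fin 2 => Function.update (Function.update s k b.1) (p k) b.2)
    (fun b c hbc => ?_) _ _ (fun t ht => ?_) (fun b => ?_)
  · have h1 := congrFun hbc k
    have h2 := congrFun hbc (p k)
    simp only [Function.update_of_ne hk.ne, Function.update_self] at h1 h2
    exact Prod.ext h1 h2
  · have : ∃ j, j ≠ k ∧ j ≠ p k ∧ s j ≠ t j := by
      by_contra! hcon
      refine ht ⟨(t k, t (p k)), ?_⟩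
      ext j
      by_cases hj : j = k
      · subst hj; simp [Function.update_of_ne hk.ne]
      · by_cases hj' : j = p k
        · subst hj'; simp
        · simp [Function.update_of_ne hj, Function.update_of_ne hj', hcon j hj hj']
    obtain ⟨j, hj, hj', hne⟩ := this
    rw [Finset.prod_eq_zero (i := j) (by simp [hj, hj']) (if_neg hne)]
    simp
  · have hmem : ∀ j ∈ ({k, p k} : Finset (Fin m))ᶜ,
        Function.update (Function.update s k b.1) (p k) b.2 j = s j := fun j hj => by
      simp only [Finset.mem_compl, Finset.mem_insert, Finset.mem_singleton, not_or] at hj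
      rw [Function.update_of_ne hj.2, Function.update_of_ne hj.1]
    have e1 : ∏ x ∈ ({k, p k} : Finset (Fin m))ᶜ, (if s x =
        Function.update (Function.update s k b.1) (p k) b.2 x then (1 : ℂ) else 0) = 1 :=
      Finset.prod_eq_one fun j hj => if_pos (hmem j hj).symm
    have e2 : ∏ x ∈ ({k, p k} : Finset (Fin m))ᶜ,
        (if Function.update (Function.update s k b.1) (p k) b.2 x = s' x then (1 : ℂ) else 0)
        = ∏ x ∈ ({k, p k} : Finset (Fin m))ᶜ, if s x = s' x then 1 else 0 :=
      Finset.prod_congr rfl fun j hj => by rw [hmem j hj]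
    rw [e1, e2, Function.update_self, Function.update_of_ne hk.ne, Function.update_self]
    ring

/-- Induction on `A`: peel off one orbit `B` of `p`, a fixed point or a pair. There the product of a
layer with its adjoint is computed gate by gate, and `layerOn_union` splits off the rest. -/
theorem layerOn_conjTranspose_mul_self (hp : Function.Involutive p)
    (hg₁ : ∀ k, (g₁ k).conjTranspose * g₁ k = 1) (hg₂ : ∀ k, (g₂ k).conjTranspose * g₂ k = 1)
    (hA : ∀ k ∈ A, p k ∈ A) :
    (layerOn p g₁ g₂ A).conjTranspose * layerOn p g₁ g₂ A = 1 := by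
  induction A using Finset.strongInduction with
  | H A ih =>
    rcases A.eq_empty_or_nonempty with rfl | hne
    · have : layerOn p g₁ g₂ ∅ = 1 := by
        rw [← layerOn_one (A := ∅) hp (by simp)]
        ext s s'
        simp [layerOn]
      simp [this]
    · obtain ⟨k, hk, B, hB, hkB, hBA, hBB⟩ : ∃ k ∈ A, ∃ B : Finset (Fin m),
          (∀ j ∈ B, p j ∈ B) ∧ k ∈ B ∧ B ⊆ A ∧
          (layerOn p g₁ g₂ B).conjTranspose * layerOn p g₁ g₂ B = 1 := by
        have pair : ∀ k ∈ A, k < p k → ∃ k ∈ A, ∃ B : Finset (Fin m),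
            (∀ j ∈ B, p j ∈ B) ∧ k ∈ B ∧ B ⊆ A ∧
            (layerOn p g₁ g₂ B).conjTranspose * layerOn p g₁ g₂ B = 1 := by
          intro k hk h
          have hB : ∀ j ∈ ({k, p k} : Finset (Fin m)), p j ∈ ({k, p k} : Finset (Fin m)) := by
            simp [hp k]
          refine ⟨k, hk, {k, p k}, hB, by simp, ?_, ?_⟩
          · simp [Finset.insert_subset_iff, hk, hA k hk]
          · rw [layerOn_conjTranspose, layerOn_mul_pair hp h]
            simp only [hg₁, hg₂]
            exact layerOn_one hp hB
        obtain ⟨k, hk⟩ := hne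
        rcases lt_trichotomy k (p k) with h | h | h
        · exact pair k hk h
        · refine ⟨k, hk, {k}, by simp [← h], by simp, by simpa using hk, ?_⟩
          rw [layerOn_conjTranspose, layerOn_mul_singleton h.symm]
          simp only [hg₁, hg₂]
          exact layerOn_one hp (by simp [← h])
        · exact pair (p k) (hA k hk) (by rwa [hp k])
      have hC : ∀ j ∈ A \ B, p j ∈ A \ B := fun j hj => by
        rw [Finset.mem_sdiff] at hj ⊢
        exact ⟨hA j hj.1, fun h => hj.2 (by simpa [hp j] using hB _ h)⟩
      have hlt : A \ B ⊂ A := Finset.sdiff_ssubset hBA ⟨k, hkB⟩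
      have := ih (A \ B) hlt hC
      rw [← Finset.union_sdiff_of_subset hBA, layerOn_union hB hC Finset.disjoint_sdiff,
        Matrix.conjTranspose_mul, Matrix.mul_assoc, ← Matrix.mul_assoc _ (layerOn p g₁ g₂ B),
        hBB, Matrix.one_mul, this]

/-- Conjugation of a local operator by a layer only involves the gates that meet its support. -/
theorem layerOn_univ_conj (hp : Function.Involutive p)
    (hg₁ : ∀ k, (g₁ k).conjTranspose * g₁ k = 1) (hg₂ : ∀ k, (g₂ k).conjTranspose * g₂ k = 1)
    (hA : ∀ k ∈ A, p k ∈ A) {H : Op m} (hH : LocalTo A H) :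
    (layerOn p g₁ g₂ Finset.univ).conjTranspose * H * layerOn p g₁ g₂ Finset.univ
      = (layerOn p g₁ g₂ A).conjTranspose * H * layerOn p g₁ g₂ A := by
  have hc : ∀ k ∈ Aᶜ, p k ∈ Aᶜ := fun k hk => by
    rw [Finset.mem_compl] at hk ⊢
    exact fun h => hk (by simpa [hp k] using hA _ h)
  -- The gates outside `A` stand next to `H`, commute with it and cancel against their adjoints.
  have hu : layerOn p g₁ g₂ Finset.univ = layerOn p g₁ g₂ Aᶜ * layerOn p g₁ g₂ A := by
    rw [← layerOn_union hc hA disjoint_compl_left]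
    simp [Finset.union_comm]
  have hcomm := hH Aᶜ _ disjoint_compl_right (layerOn_supportedOn (g₁ := g₁) (g₂ := g₂) hc)
  have hun := layerOn_conjTranspose_mul_self hp hg₁ hg₂ hc
  have : (layerOn p g₁ g₂ Aᶜ).conjTranspose * H * layerOn p g₁ g₂ Aᶜ = H := by
    rw [Matrix.mul_assoc, hcomm.eq, ← Matrix.mul_assoc, hun, Matrix.one_mul]
  rw [hu, Matrix.conjTranspose_mul]
  conv_rhs => rw [← this]
  simp only [Matrix.mul_assoc]

theorem layerOn_univ_conj_localTo (hp : Function.Involutive p)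
    (hg₁ : ∀ k, (g₁ k).conjTranspose * g₁ k = 1) (hg₂ : ∀ k, (g₂ k).conjTranspose * g₂ k = 1)
    (hA : ∀ k ∈ A, p k ∈ A) {H : Op m} (hH : LocalTo A H) :
    LocalTo A ((layerOn p g₁ g₂ Finset.univ).conjTranspose * H *
      layerOn p g₁ g₂ Finset.univ) := by
  rw [layerOn_univ_conj hp hg₁ hg₂ hA hH]
  have h := layerOn_supportedOn (g₁ := g₁) (g₂ := g₂) hA
  exact (h.conjTranspose.localTo.mul hH).mul h.localTo

/-- With the trivial interaction pattern, rotations and observables fall under the results on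
layers. -/
theorem tensor_eq_layerOn (g : Fin m → Matrix (Fin 2) (Fin 2) ℂ) :
    tensor g = layerOn id g (fun _ => 1) Finset.univ := by
  ext s s'
  simp [tensor, layerOn, blockEntry]

theorem tensor_conjTranspose_mul_self {g : Fin m → Matrix (Fin 2) (Fin 2) ℂ}
    (hg : ∀ k, (g k).conjTranspose * g k = 1) : (tensor g).conjTranspose * tensor g = 1 := by
  rw [tensor_eq_layerOn]
  exact layerOn_conjTranspose_mul_self (fun _ => rfl) hg (by simp) (by simp)

theorem tensor_mulSingle (k : Fin m) (M : Matrix (Fin 2) (Fin 2) ℂ) :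
    tensor (Pi.mulSingle k M) = layerOn id (fun _ => M) (fun _ => 1) {k} := by
  ext s s'
  simp only [tensor, layerOn, blockEntry, Matrix.of_apply, id, if_true, Finset.prod_singleton]
  rw [← Finset.mul_prod_erase _ _ (Finset.mem_univ k), Pi.mulSingle_eq_same,
    ← Finset.compl_singleton]
  congr 1
  refine Finset.prod_congr rfl fun j hj => ?_
  rw [Pi.mulSingle_eq_of_ne (by simpa using hj), Matrix.one_apply]

end Layers

/-! ### Hermitian matrices with spectrum of constant modulus -/

section TwoByTwo

variable {ι : Type*} [Fintype ι] [DecidableEq ι]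

/-- Applied to the generators (eigenvalues `±1`) and to the observables, whose vanishing trace
forces eigenvalues `±λ`. -/
theorem sq_eq_smul_one_of_eigenvalues {M : Matrix ι ι ℂ} (hM : M.IsHermitian) {c : ℝ}
    (hc : ∀ i, hM.eigenvalues i ^ 2 = c) : M * M = (c : ℂ) • 1 := by
  have hD : Matrix.diagonal (RCLike.ofReal ∘ hM.eigenvalues : ι → ℂ) *
      Matrix.diagonal (RCLike.ofReal ∘ hM.eigenvalues) = (c : ℂ) • (1 : Matrix ι ι ℂ) := by
    rw [Matrix.diagonal_mul_diagonal, ← Matrix.diagonal_one, ← Matrix.diagonal_smul]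
    congr 1
    ext i
    simp [← hc i, sq]
  conv_lhs => rw [hM.spectral_theorem]
  rw [← map_mul, hD, map_smul, map_one]

theorem exp_neg_I_smul {G : Matrix ι ι ℂ} (hG : G.IsHermitian)
    (hs : ∀ i, hG.eigenvalues i = 1 ∨ hG.eigenvalues i = -1) (θ : ℝ) :
    NormedSpace.exp ((-(Complex.I * (θ : ℂ))) • G)
      = (Real.cos θ : ℂ) • (1 : Matrix ι ι ℂ) + (-(Complex.I * (Real.sin θ : ℂ))) • G := by
  set D := Matrix.diagonal (RCLike.ofReal ∘ hG.eigenvalues : ι → ℂ) with hD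
  have hGD : G = (hG.eigenvectorUnitary : Matrix ι ι ℂ) * D *
      star (hG.eigenvectorUnitary : Matrix ι ι ℂ) := by
    conv_lhs => rw [hG.spectral_theorem, Unitary.conjStarAlgAut_apply]
  have hU : (hG.eigenvectorUnitary : Matrix ι ι ℂ) *
      star (hG.eigenvectorUnitary : Matrix ι ι ℂ) = 1 :=
    Unitary.mul_star_self_of_mem hG.eigenvectorUnitary.2
  have hinv : (hG.eigenvectorUnitary : Matrix ι ι ℂ)⁻¹
      = star (hG.eigenvectorUnitary : Matrix ι ι ℂ) := Matrix.inv_eq_right_inv hU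
  have hexp : NormedSpace.exp ((-(Complex.I * (θ : ℂ))) • D)
      = (Real.cos θ : ℂ) • (1 : Matrix ι ι ℂ) + (-(Complex.I * (Real.sin θ : ℂ))) • D := by
    rw [hD, ← Matrix.diagonal_smul, Matrix.exp_diagonal, ← Matrix.diagonal_smul,
      ← Matrix.diagonal_one, ← Matrix.diagonal_smul, Matrix.diagonal_add]
    congr 1
    ext i
    rw [Pi.coe_exp]
    simp only [Pi.smul_apply, Function.comp_apply, smul_eq_mul, mul_one]
    rw [← Complex.exp_eq_exp_ℂ]
    rcases hs i with h | h
    · rw [h, Complex.ofReal_cos, Complex.ofReal_sin]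
      have := Complex.exp_mul_I (-(θ : ℂ))
      rw [Complex.cos_neg, Complex.sin_neg] at this
      simp only [RCLike.ofReal_one, mul_one]
      rw [← show -(θ : ℂ) * Complex.I = -(Complex.I * θ) by ring, this]
      ring
    · rw [h, Complex.ofReal_cos, Complex.ofReal_sin]
      have := Complex.exp_mul_I (θ : ℂ)
      simp only [RCLike.ofReal_neg, RCLike.ofReal_one, mul_neg, mul_one,
        neg_neg]
      rw [mul_comm, this]
      ring
  have hconj : ∀ z : ℂ, z • G = (hG.eigenvectorUnitary : Matrix ι ι ℂ) *
      (z • D) * star (hG.eigenvectorUnitary : Matrix ι ι ℂ) := fun z => by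
    conv_lhs => rw [hGD]
    rw [Matrix.mul_smul, Matrix.smul_mul]
  rw [hconj, ← hinv, Matrix.exp_conj _ _ (.of_mul_eq_one _ hU), hexp,
    Matrix.mul_add, Matrix.add_mul, Matrix.mul_smul, Matrix.smul_mul, Matrix.mul_one, hinv, hU,
    ← hconj]

end TwoByTwo

/-! ### Products of layers: backward evolution, dependence on one angle, smoothness -/

section Product

variable {m L : ℕ}

theorem prod_reverse_ofFn_succ (F : Fin (L + 1) → Op m) : (List.ofFn F).reverse.prod
    = F (Fin.last L) * (List.ofFn fun ℓ : Fin L => F ℓ.castSucc).reverse.prod := by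
  rw [List.ofFn_succ', List.concat_eq_append, List.reverse_append, List.prod_append]
  simp

/-- If each layer maps operators local to `S ℓ.succ` to operators local to `S ℓ.castSucc`, then
changing layers without effect on such operators does not change the observable. -/
theorem prod_conj_congr : ∀ {L : ℕ} (F F' : Fin L → Op m) (S : Fin (L + 1) → Finset (Fin m))
    (H : Op m), LocalTo (S (Fin.last L)) H →
    (∀ ℓ H, LocalTo (S ℓ.succ) H → LocalTo (S ℓ.castSucc) ((F ℓ).conjTranspose * H * F ℓ)) →
    (∀ ℓ H, LocalTo (S ℓ.succ) H →
      (F ℓ).conjTranspose * H * F ℓ = (F' ℓ).conjTranspose * H * F' ℓ) →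
    (List.ofFn F).reverse.prod.conjTranspose * H * (List.ofFn F).reverse.prod
      = (List.ofFn F').reverse.prod.conjTranspose * H * (List.ofFn F').reverse.prod
  | 0, F, F', S, H, _, _, _ => by simp
  | L + 1, F, F', S, H, hH, hloc, heq => by
    have hlast := heq (Fin.last L) H (by rwa [Fin.succ_last])
    have hl := hloc (Fin.last L) H (by rwa [Fin.succ_last])
    -- The last layer is the first to act on the observable; the induction runs over the remaining
    -- layers, with the conjugated observable.
    have ih := prod_conj_congr (fun ℓ : Fin L => F ℓ.castSucc) (fun ℓ : Fin L => F' ℓ.castSucc)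
      (fun ℓ => S ℓ.castSucc) _ hl (fun ℓ H' h' => hloc ℓ.castSucc H' h')
      (fun ℓ H' h' => heq ℓ.castSucc H' h')
    have e : ∀ A B : Op m, (A * B).conjTranspose * H * (A * B)
        = B.conjTranspose * (A.conjTranspose * H * A) * B := fun A B => by
      simp only [Matrix.conjTranspose_mul, Matrix.mul_assoc]
    rw [prod_reverse_ofFn_succ, prod_reverse_ofFn_succ, e, ih, hlast, ← e]

theorem prod_conjTranspose_mul_self : ∀ {L : ℕ} (F : Fin L → Op m),
    (∀ ℓ, (F ℓ).conjTranspose * F ℓ = 1) →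
    (List.ofFn F).reverse.prod.conjTranspose * (List.ofFn F).reverse.prod = 1
  | 0, F, _ => by simp
  | L + 1, F, hF => by
    rw [prod_reverse_ofFn_succ, Matrix.conjTranspose_mul, Matrix.mul_assoc,
      ← Matrix.mul_assoc _ (F (Fin.last L)), hF, Matrix.one_mul]
    exact prod_conjTranspose_mul_self _ fun ℓ => hF ℓ.castSucc

/-- The operator-valued function `F` is of the form `s ↦ cos s • M₁ + sin s • M₂`. -/
def IsCosSin {α β : Type*} (F : ℝ → Matrix α β ℂ) : Prop :=
  ∃ M₁ M₂ : Matrix α β ℂ, ∀ s, F s = (Real.cos s : ℂ) • M₁ + (Real.sin s : ℂ) • M₂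

theorem IsCosSin.const_mul {F : ℝ → Op m} (h : IsCosSin F) (M : Op m) :
    IsCosSin fun s => M * F s := by
  obtain ⟨M₁, M₂, h⟩ := h
  exact ⟨M * M₁, M * M₂, fun s => by simp [h, Matrix.mul_add]⟩

theorem IsCosSin.mul_const {F : ℝ → Op m} (h : IsCosSin F) (M : Op m) :
    IsCosSin fun s => F s * M := by
  obtain ⟨M₁, M₂, h⟩ := h
  exact ⟨M₁ * M, M₂ * M, fun s => by simp [h, Matrix.add_mul]⟩

/-- Only the factor `j` depends on `s`, and the product is linear in it. -/
theorem prod_isCosSin : ∀ {L : ℕ} (F : Fin L → ℝ → Op m) (j : Fin L),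
    IsCosSin (F j) → (∀ ℓ ≠ j, ∀ s, F ℓ s = F ℓ 0) →
    IsCosSin fun s => (List.ofFn fun ℓ => F ℓ s).reverse.prod
  | 0, _, j, _, _ => j.elim0
  | L + 1, F, j, hj, hF => by
    simp only [prod_reverse_ofFn_succ]
    induction j using Fin.lastCases with
    | last =>
      have : ∀ s, (List.ofFn fun ℓ : Fin L => F ℓ.castSucc s)
          = List.ofFn fun ℓ : Fin L => F ℓ.castSucc 0 := fun s => by
        congr 1
        ext1 ℓ
        exact hF _ (Fin.castSucc_ne_last ℓ) s
      simp only [this]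
      exact hj.mul_const _
    | cast j =>
      simp only [hF (Fin.last L) (Fin.castSucc_ne_last j).symm]
      exact (prod_isCosSin (fun ℓ : Fin L => F ℓ.castSucc) j hj
        fun ℓ hℓ s => hF _ (by simpa using hℓ) s).const_mul _

theorem tensor_update (g : Fin m → Matrix (Fin 2) (Fin 2) ℂ) (k : Fin m)
    (a b : ℂ) (M₁ M₂ : Matrix (Fin 2) (Fin 2) ℂ) :
    tensor (Function.update g k (a • M₁ + b • M₂))
      = a • tensor (Function.update g k M₁) + b • tensor (Function.update g k M₂) := by
  ext s s'
  simp only [tensor, Matrix.of_apply, Matrix.add_apply, Matrix.smul_apply, smul_eq_mul]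
  have : ∀ M, ∏ j, Function.update g k M j (s j) (s' j)
      = M (s k) (s' k) * ∏ j ∈ Finset.univ.erase k, g j (s j) (s' j) := fun M => by
    rw [← Finset.mul_prod_erase _ _ (Finset.mem_univ k), Function.update_self]
    congr 1
    exact Finset.prod_congr rfl fun j hj => by
      rw [Function.update_of_ne (Finset.ne_of_mem_erase hj)]
  simp only [this, Matrix.add_apply, Matrix.smul_apply, smul_eq_mul]
  ring

/-- Entrywise smoothness of an operator-valued function. -/
def EntrySmooth {E α β : Type*} [NormedAddCommGroup E] [NormedSpace ℝ E]
    (F : E → Matrix α β ℂ) : Prop := ∀ a b, ContDiff ℝ 2 fun v => F v a b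

theorem EntrySmooth.mul {E : Type*} [NormedAddCommGroup E] [NormedSpace ℝ E]
    {F F' : E → Op m} (h : EntrySmooth F) (h' : EntrySmooth F') :
    EntrySmooth fun v => F v * F' v := fun a b => by
  simp only [Matrix.mul_apply]
  exact ContDiff.sum fun c _ => (h a c).mul (h' c b)

theorem prod_entrySmooth {E : Type*} [NormedAddCommGroup E] [NormedSpace ℝ E] :
    ∀ {L : ℕ} (F : Fin L → E → Op m), (∀ ℓ, EntrySmooth (F ℓ)) →
    EntrySmooth fun v => (List.ofFn fun ℓ => F ℓ v).reverse.prod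
  | 0, _, _ => fun a b => by simpa using contDiff_const
  | L + 1, F, hF => by
    simp only [prod_reverse_ofFn_succ]
    exact (hF _).mul (prod_entrySmooth (fun ℓ : Fin L => F ℓ.castSucc) fun ℓ => hF _)

end Product

/-! ### Local models: boundedness, trigonometric form, light cones -/

namespace Circuit

variable {X : Type*} {m L : ℕ} (C : Circuit X m L)

theorem G_eigenvalues (ℓ : Fin L) (k : Fin m) (i : Fin 2) :
    (C.G_herm ℓ k).eigenvalues i = 1 ∨ (C.G_herm ℓ k).eigenvalues i = -1 := by
  have := (C.G_herm ℓ k).eigenvalues_mem_spectrum_real i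
  rw [C.G_spec ℓ k] at this
  simpa [or_comm] using this

theorem G_mul_self (ℓ : Fin L) (k : Fin m) : C.G ℓ k * C.G ℓ k = 1 := by
  rw [sq_eq_smul_one_of_eigenvalues (C.G_herm ℓ k) (c := 1) fun i => ?_]
  · simp
  · rcases C.G_eigenvalues ℓ k i with h | h <;> simp [h]

/-- The parameterized gate `exp (-i θ G)`, in closed form. -/
def rotation (ℓ : Fin L) (k : Fin m) (θ : ℝ) : Matrix (Fin 2) (Fin 2) ℂ :=
  (Real.cos θ : ℂ) • 1 + (Real.sin θ : ℂ) • (-Complex.I • C.G ℓ k)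

theorem paramLayer_eq (ℓ : Fin L) (Θ : Params L m) :
    C.paramLayer ℓ Θ = tensor fun k => C.rotation ℓ k (Θ (ℓ, k)) := by
  unfold paramLayer
  congr 1
  ext1 k
  rw [exp_neg_I_smul (C.G_herm ℓ k) (C.G_eigenvalues ℓ k), rotation, smul_smul]
  congr 2
  ring

theorem rotation_conjTranspose_mul_self (ℓ : Fin L) (k : Fin m) (θ : ℝ) :
    (C.rotation ℓ k θ).conjTranspose * C.rotation ℓ k θ = 1 := by
  have h := C.G_mul_self ℓ k
  have hh : (C.G ℓ k).conjTranspose = C.G ℓ k := C.G_herm ℓ k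
  have hcs : (Real.cos θ : ℂ) * Real.cos θ + Real.sin θ * Real.sin θ = 1 := by
    rw [← sq, ← sq]; exact_mod_cast Real.cos_sq_add_sin_sq θ
  simp only [rotation, Matrix.conjTranspose_add, Matrix.conjTranspose_smul, hh,
    Matrix.conjTranspose_one, Matrix.add_mul, Matrix.mul_add, Matrix.smul_mul, Matrix.mul_smul,
    Matrix.one_mul, Matrix.mul_one, h, smul_smul]
  have e1 : star (Real.cos θ : ℂ) = Real.cos θ := Complex.conj_ofReal _
  have e2 : star (Real.sin θ : ℂ) = Real.sin θ := Complex.conj_ofReal _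
  have e3 : star ((Real.sin θ : ℂ) * -Complex.I) = Real.sin θ * Complex.I := by
    rw [star_mul', e2]; simp
  rw [e1, e3]
  have hI : Complex.I * Complex.I = -1 := Complex.I_mul_I
  ext a b
  simp only [Matrix.add_apply, Matrix.smul_apply, smul_eq_mul]
  linear_combination (-(Real.sin θ : ℂ) * Real.sin θ * (1 : Matrix (Fin 2) (Fin 2) ℂ) a b) * hI
    + (1 : Matrix (Fin 2) (Fin 2) ℂ) a b * hcs

theorem fixedLayer_eq (ℓ : Fin L) (x : X) : C.fixedLayer ℓ x
    = layerOn (C.partner ℓ) (C.gate₁ ℓ x) (C.gate₂ ℓ x) Finset.univ := by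
  ext s s'
  simp [fixedLayer, layerOn, blockEntry]

theorem gate₁_conjTranspose_mul_self (ℓ : Fin L) (x : X) (k : Fin m) :
    (C.gate₁ ℓ x k).conjTranspose * C.gate₁ ℓ x k = 1 :=
  Unitary.star_mul_self_of_mem (C.gate₁_unitary ℓ x k)

theorem gate₂_conjTranspose_mul_self (ℓ : Fin L) (x : X) (k : Fin m) :
    (C.gate₂ ℓ x k).conjTranspose * C.gate₂ ℓ x k = 1 :=
  Unitary.star_mul_self_of_mem (C.gate₂_unitary ℓ x k)

theorem layer_conjTranspose_mul_self (ℓ : Fin L) (Θ : Params L m) (x : X) :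
    (C.fixedLayer ℓ x * C.paramLayer ℓ Θ).conjTranspose
      * (C.fixedLayer ℓ x * C.paramLayer ℓ Θ) = 1 := by
  have h1 : (C.fixedLayer ℓ x).conjTranspose * C.fixedLayer ℓ x = 1 := by
    rw [fixedLayer_eq]
    exact layerOn_conjTranspose_mul_self (C.partner_invol ℓ) (C.gate₁_conjTranspose_mul_self ℓ x)
      (C.gate₂_conjTranspose_mul_self ℓ x) (by simp)
  rw [Matrix.conjTranspose_mul, Matrix.mul_assoc, ← Matrix.mul_assoc _ (C.fixedLayer ℓ x), h1,
    Matrix.one_mul, paramLayer_eq]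
  exact tensor_conjTranspose_mul_self fun k => C.rotation_conjTranspose_mul_self ℓ k _

theorem unitary_conjTranspose_mul_self (Θ : Params L m) (x : X) :
    (C.unitary Θ x).conjTranspose * C.unitary Θ x = 1 :=
  prod_conjTranspose_mul_self _ fun ℓ => C.layer_conjTranspose_mul_self ℓ Θ x

theorem O_mul_self (k : Fin m) : ∃ c : ℝ, c ≤ 1 ∧ C.O k * C.O k = (c : ℂ) • 1 := by
  have htr := (C.O_herm k).trace_eq_sum_eigenvalues
  rw [C.O_trace k, Fin.sum_univ_two] at htr
  have h0 := C.O_spec k ((C.O_herm k).eigenvalues_mem_spectrum_real 0)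
  have heq : (C.O_herm k).eigenvalues 1 = -(C.O_herm k).eigenvalues 0 := by
    have : (C.O_herm k).eigenvalues 0 + (C.O_herm k).eigenvalues 1 = 0 := by
      apply Complex.ofReal_injective
      push_cast
      exact htr.symm
    linarith
  refine ⟨(C.O_herm k).eigenvalues 0 ^ 2, ?_,
    sq_eq_smul_one_of_eigenvalues (C.O_herm k) fun i => ?_⟩
  · have := h0.1; have := h0.2; nlinarith
  · fin_cases i
    · rfl
    · change (C.O_herm k).eigenvalues 1 ^ 2 = _
      rw [heq, neg_sq]

theorem localObs_eq (k : Fin m) :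
    C.localObs k = layerOn id (fun _ => C.O k) (fun _ => 1) {k} := tensor_mulSingle k _

theorem localObs_conjTranspose (k : Fin m) : (C.localObs k).conjTranspose = C.localObs k := by
  have hh : (C.O k).conjTranspose = C.O k := C.O_herm k
  rw [localObs_eq, layerOn_conjTranspose]
  simp [hh]

theorem localObs_localTo (k : Fin m) : LocalTo {k} (C.localObs k) := by
  rw [localObs_eq]
  exact (layerOn_supportedOn (by simp)).localTo

theorem localObs_mul_self (k : Fin m) :
    ∃ c : ℝ, c ≤ 1 ∧ C.localObs k * C.localObs k = (c : ℂ) • 1 := by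
  obtain ⟨c, hc, h⟩ := C.O_mul_self k
  refine ⟨c, hc, ?_⟩
  rw [localObs_eq, layerOn_mul_singleton rfl, h, ← layerOn_one (p := id) (A := {k}) (fun _ => rfl)
    (by simp)]
  ext s s'
  simp [layerOn, blockEntry, mul_assoc]

theorem localModel_eq (k : Fin m) (Θ : Params L m) (x : X) : C.localModel k Θ x
    = (star ((C.unitary Θ x).mulVec (ket0 m)) ⬝ᵥ
      ((C.localObs k).mulVec ((C.unitary Θ x).mulVec (ket0 m)))).re := by
  rw [localModel, Matrix.star_mulVec, ← Matrix.dotProduct_mulVec, Matrix.mulVec_mulVec,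
    Matrix.mulVec_mulVec]

/-- With `φ = 𝒪_k ψ` one has `‖ψ‖ = 1` and `‖φ‖² = c ≤ 1`, so the nonnegativity of `‖ψ ± φ‖²` bounds
`Re ⟨ψ, φ⟩` on both sides. -/
theorem abs_localModel_le_one (k : Fin m) (Θ : Params L m) (x : X) :
    |C.localModel k Θ x| ≤ 1 := by
  rw [localModel_eq]
  set ψ := (C.unitary Θ x).mulVec (ket0 m) with hψ
  have hnorm : star ψ ⬝ᵥ ψ = 1 := by
    rw [hψ, Matrix.star_mulVec, ← Matrix.dotProduct_mulVec, Matrix.mulVec_mulVec,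
      C.unitary_conjTranspose_mul_self, Matrix.one_mulVec]
    simp [ket0]
  obtain ⟨c, hc, hO⟩ := C.localObs_mul_self k
  set φ := (C.localObs k).mulVec ψ with hφ
  have hφφ : star φ ⬝ᵥ φ = c := by
    rw [hφ, Matrix.star_mulVec, ← Matrix.dotProduct_mulVec, Matrix.mulVec_mulVec,
      C.localObs_conjTranspose, hO, Matrix.smul_mulVec, Matrix.one_mulVec, dotProduct_smul,
      hnorm, smul_eq_mul, mul_one]
  have hφψ : (star φ ⬝ᵥ ψ).re = (star ψ ⬝ᵥ φ).re := by
    have h : star φ ⬝ᵥ ψ = star (star ψ ⬝ᵥ φ) := by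
      rw [Matrix.star_dotProduct]
    rw [h]
    exact Complex.conj_re _
  have key : ∀ v : Basis m → ℂ, 0 ≤ (star v ⬝ᵥ v).re := fun v => by
    rw [dotProduct, Complex.re_sum]
    exact Finset.sum_nonneg fun i _ => by
      simp only [Pi.star_apply, RCLike.star_def, Complex.mul_re, Complex.conj_re, Complex.conj_im]
      nlinarith [sq_nonneg (v i).re, sq_nonneg (v i).im]
  have h1 := key (ψ - φ)
  have h2 := key (ψ + φ)
  simp only [star_sub, star_add, sub_dotProduct, dotProduct_sub, add_dotProduct, dotProduct_add,
    hnorm, hφφ, Complex.sub_re, Complex.add_re, hφψ, Complex.one_re, Complex.ofReal_re] at h1 h2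
  rw [abs_le]
  constructor <;> linarith

theorem paramLayer_update_of_ne {ℓ : Fin L} {i : Fin L × Fin m} (h : ℓ ≠ i.1) (Θ : Params L m)
    (s : ℝ) : C.paramLayer ℓ (Function.update Θ i s) = C.paramLayer ℓ Θ := by
  unfold paramLayer
  congr 1
  ext1 k
  rw [Function.update_of_ne fun hk => h (congrArg Prod.fst hk)]

theorem paramLayer_update (i : Fin L × Fin m) (Θ : Params L m) (s : ℝ) :
    C.paramLayer i.1 (Function.update Θ i s)
      = tensor (Function.update (fun k => C.rotation i.1 k (Θ (i.1, k))) i.2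
          (C.rotation i.1 i.2 s)) := by
  rw [paramLayer_eq]
  congr 1
  ext1 k
  by_cases hk : k = i.2
  · subst hk; simp
  · rw [Function.update_of_ne hk, Function.update_of_ne fun h => hk (congrArg Prod.snd h)]

theorem unitary_isCosSin (i : Fin L × Fin m) (Θ : Params L m) (x : X) :
    IsCosSin fun s => C.unitary (Function.update Θ i s) x := by
  refine prod_isCosSin (fun ℓ s => C.fixedLayer ℓ x * C.paramLayer ℓ (Function.update Θ i s)) i.1
    (IsCosSin.const_mul
      ⟨tensor (Function.update (fun k => C.rotation i.1 k (Θ (i.1, k))) i.2 1),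
        tensor (Function.update (fun k => C.rotation i.1 k (Θ (i.1, k))) i.2
          (-Complex.I • C.G i.1 i.2)), fun s => ?_⟩ _) fun ℓ hℓ s => ?_
  · rw [← tensor_update, paramLayer_update]
    rfl
  · simp only [C.paramLayer_update_of_ne hℓ]

/-- The final state is `cos s • u + sin s • v`; the expectation is quadratic in it, and the
double-angle formulas rewrite `cos²`, `sin²` and `sin cos`. -/
theorem localModel_trig (k : Fin m) (i : Fin L × Fin m) (Θ : Params L m) (x : X) :
    ∃ a b c : ℝ, ∀ s, C.localModel k (Function.update Θ i s) x
      = a + b * Real.cos (2 * s) + c * Real.sin (2 * s) := by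
  obtain ⟨M₁, M₂, h⟩ := C.unitary_isCosSin i Θ x
  set u := M₁.mulVec (ket0 m)
  set v := M₂.mulVec (ket0 m)
  set q : (Basis m → ℂ) → (Basis m → ℂ) → ℝ := fun v w => (star v ⬝ᵥ
    (C.localObs k).mulVec w).re with hq
  refine ⟨(q u u + q v v) / 2, (q u u - q v v) / 2, (q u v + q v u) / 2, fun s => ?_⟩
  have e : (C.unitary (Function.update Θ i s) x).mulVec (ket0 m)
      = (Real.cos s : ℂ) • u + (Real.sin s : ℂ) • v := by
    have hs : C.unitary (Function.update Θ i s) x = _ := h s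
    rw [hs, Matrix.add_mulVec, Matrix.smul_mulVec, Matrix.smul_mulVec]
  have e1 : star (Real.cos s : ℂ) = Real.cos s := Complex.conj_ofReal _
  have e2 : star (Real.sin s : ℂ) = Real.sin s := Complex.conj_ofReal _
  rw [localModel_eq, e]
  simp only [star_add, star_smul, Matrix.mulVec_add, Matrix.mulVec_smul, add_dotProduct,
    dotProduct_add, smul_dotProduct, dotProduct_smul, e1, e2, Complex.add_re, smul_eq_mul,
    Complex.re_ofReal_mul]
  rw [Real.cos_two_mul, Real.sin_two_mul]
  change Real.cos s * (Real.cos s * q u u + Real.sin s * q v u) +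
    Real.sin s * (Real.cos s * q u v + Real.sin s * q v v) = _
  linear_combination (q v v) * Real.sin_sq_add_cos_sq s

theorem localModel_contDiff (k : Fin m) (x : X) :
    ContDiff ℝ 2 fun Θ : Params L m => C.localModel k Θ x := by
  have hp : ∀ ℓ, EntrySmooth fun Θ : Params L m => C.paramLayer ℓ Θ := fun ℓ s s' => by
    simp only [paramLayer_eq, tensor, Matrix.of_apply, rotation, Matrix.add_apply,
      Matrix.smul_apply, smul_eq_mul]
    have hθ : ∀ k, ContDiff ℝ 2 fun Θ : Params L m => Θ (ℓ, k) := fun k => contDiff_apply ℝ ℝ _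
    refine contDiff_prod fun k _ => ContDiff.add ?_ ?_
    · exact (Complex.ofRealCLM.contDiff.comp (Real.contDiff_cos.comp (hθ k))).mul contDiff_const
    · exact (Complex.ofRealCLM.contDiff.comp (Real.contDiff_sin.comp (hθ k))).mul contDiff_const
  have hU : EntrySmooth fun Θ : Params L m => C.unitary Θ x :=
    prod_entrySmooth _ fun ℓ => EntrySmooth.mul (fun _ _ => contDiff_const) (hp ℓ)
  have hUs : EntrySmooth fun Θ : Params L m => (C.unitary Θ x).conjTranspose := fun a b =>
    Complex.conjCLE.contDiff.comp (hU b a)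
  have := (hUs.mul (F' := fun _ => C.localObs k) fun _ _ => contDiff_const).mul hU
  refine Complex.reCLM.contDiff.comp ?_
  simp only [dotProduct, Matrix.mulVec]
  exact ContDiff.sum fun a _ => contDiff_const.mul
    (ContDiff.sum fun b _ => (this a b).mul contDiff_const)

/-- Pulled back through `V_ℓ` and the later layers, the observable commutes with everything
supported outside of `𝒥^ℓ_k`, so a rotation in layer `ℓ` on a qubit outside of this set cancels
against its adjoint. -/
theorem localModel_update_of_notMem {k : Fin m} {i : Fin L × Fin m} (hi : i ∉ C.pastCone k)
    (Θ : Params L m) (s : ℝ) (x : X) :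
    C.localModel k (Function.update Θ i s) x = C.localModel k Θ x := by
  -- `S ℓ.castSucc` is `𝒥^ℓ_k`; the extra index `Fin.last L` carries the support `{k}` of the
  -- observable itself.
  set S : Fin (L + 1) → Finset (Fin m) := fun ℓ =>
    Fin.reverseInduction (motive := fun _ : Fin (L + 1) => Finset (Fin m)) {k}
      (fun ℓ' S => S.biUnion (C.interacting ℓ')) ℓ with hS
  have hlast : S (Fin.last L) = {k} := by simp [hS]
  have hsucc : ∀ ℓ : Fin L, S ℓ.castSucc = (S ℓ.succ).biUnion (C.interacting ℓ) := fun ℓ => by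
    simp only [hS, Fin.reverseInduction_castSucc]
  have hsub : ∀ ℓ : Fin L, S ℓ.succ ⊆ S ℓ.castSucc := fun ℓ j hj => by
    rw [hsucc]
    exact Finset.mem_biUnion.mpr ⟨j, hj, by simp [interacting]⟩
  have hclosed : ∀ ℓ : Fin L, ∀ j ∈ S ℓ.castSucc, C.partner ℓ j ∈ S ℓ.castSucc := fun ℓ j hj => by
    rw [hsucc, Finset.mem_biUnion] at hj ⊢
    obtain ⟨a, ha, hj⟩ := hj
    refine ⟨a, ha, ?_⟩
    simp only [interacting, Finset.mem_insert, Finset.mem_singleton] at hj ⊢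
    rcases hj with rfl | rfl
    · exact Or.inr rfl
    · exact Or.inl (C.partner_invol ℓ a)
  have hi' : i.2 ∉ S i.1.castSucc := fun h =>
    hi (Finset.mem_filter.mpr ⟨Finset.mem_univ _, h⟩)
  have hV : ∀ ℓ H, LocalTo (S ℓ.succ) H → LocalTo (S ℓ.castSucc)
      ((C.fixedLayer ℓ x).conjTranspose * H * C.fixedLayer ℓ x) := fun ℓ H hH => by
    rw [fixedLayer_eq]
    exact layerOn_univ_conj_localTo (C.partner_invol ℓ) (C.gate₁_conjTranspose_mul_self ℓ x)
      (C.gate₂_conjTranspose_mul_self ℓ x) (hclosed ℓ) (hH.mono (hsub ℓ))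
  have assoc : ∀ V W H : Op m, (V * W).conjTranspose * H * (V * W)
      = W.conjTranspose * (V.conjTranspose * H * V) * W := fun V W H => by
    simp only [Matrix.conjTranspose_mul, Matrix.mul_assoc]
  have key := prod_conj_congr (fun ℓ => C.fixedLayer ℓ x * C.paramLayer ℓ (Function.update Θ i s))
    (fun ℓ => C.fixedLayer ℓ x * C.paramLayer ℓ Θ) S (C.localObs k)
    (by rw [hlast]; exact C.localObs_localTo k) (fun ℓ H hH => ?_) (fun ℓ H hH => ?_)
  · exact congrArg (fun M : Op m => (star (ket0 m) ⬝ᵥ M.mulVec (ket0 m)).re) key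
  · rw [assoc, paramLayer_eq, tensor_eq_layerOn]
    exact layerOn_univ_conj_localTo (fun _ => rfl)
      (fun j => C.rotation_conjTranspose_mul_self ℓ j _) (by simp) (by simp) (hV ℓ H hH)
  · by_cases hℓ : ℓ = i.1
    · subst hℓ
      rw [assoc, assoc, paramLayer_eq, paramLayer_eq, tensor_eq_layerOn, tensor_eq_layerOn,
        layerOn_univ_conj (fun _ => rfl) (fun j => C.rotation_conjTranspose_mul_self _ j _)
          (by simp) (by simp) (hV _ H hH),
        layerOn_univ_conj (fun _ => rfl) (fun j => C.rotation_conjTranspose_mul_self _ j _)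
          (by simp) (by simp) (hV _ H hH),
        layerOn_congr (h₁ := fun j => C.rotation i.1 j (Θ (i.1, j))) fun j hj => ?_]
      rw [Function.update_of_ne]
      exact fun h => hi' (h ▸ hj)
    · rw [C.paramLayer_update_of_ne hℓ]

end Circuit

/-! ### The parameter-shift rule -/

section ParameterShift

variable {ι : Type*} [DecidableEq ι]

/-- In each variable, `F` is a trigonometric polynomial spanned by `1`, `cos (2 s)`, `sin (2 s)`. -/
def IsTrig (F : (ι → ℝ) → ℝ) : Prop :=
  ∀ i Θ, ∃ a b c : ℝ, ∀ s, F (Function.update Θ i s)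
    = a + b * Real.cos (2 * s) + c * Real.sin (2 * s)

theorem IsTrig.const_mul_sum {κ : Type*} (s : Finset κ) (c : ℝ) {F : κ → (ι → ℝ) → ℝ}
    (hF : ∀ k, IsTrig (F k)) : IsTrig fun Θ => c * ∑ k ∈ s, F k Θ := fun i Θ => by
  choose a b d h using fun k => hF k i Θ
  refine ⟨c * ∑ k ∈ s, a k, c * ∑ k ∈ s, b k, c * ∑ k ∈ s, d k, fun t => ?_⟩
  simp only [h, Finset.sum_add_distrib, ← Finset.sum_mul]
  ring

/-- The parameter-shift rule. -/
theorem IsTrig.pderiv_eq {F : (ι → ℝ) → ℝ} (hF : IsTrig F) (i : ι) (Θ : ι → ℝ) :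
    pderiv F i Θ = F (Θ + Pi.single i (Real.pi / 4)) - F (Θ + Pi.single i (-(Real.pi / 4))) := by
  obtain ⟨a, b, c, h⟩ := hF i Θ
  have hu : ∀ d, Θ + Pi.single i d = Function.update Θ i (Θ i + d) := fun d => by
    ext j
    by_cases hj : j = i
    · subst hj; simp
    · simp [hj]
  have h2 : ∀ s : ℝ, HasDerivAt (fun s : ℝ => 2 * s) 2 s := fun s => by
    simpa using (hasDerivAt_id s).const_mul (2 : ℝ)
  have hd : HasDerivAt (fun s => F (Function.update Θ i s))
      (b * (-Real.sin (2 * Θ i) * 2) + c * (Real.cos (2 * Θ i) * 2)) (Θ i) := by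
    simp only [h]
    exact (((h2 (Θ i)).cos.const_mul b).const_add a).add ((h2 (Θ i)).sin.const_mul c)
  rw [pderiv, hd.deriv, hu, hu, h, h]
  -- At frequency 2 a shift by `π/4` is a quarter period, which turns the difference of values into
  -- the derivative.
  have e1 : 2 * (Θ i + Real.pi / 4) = 2 * Θ i + Real.pi / 2 := by ring
  have e2 : 2 * (Θ i + -(Real.pi / 4)) = 2 * Θ i - Real.pi / 2 := by ring
  rw [e1, e2, Real.cos_add_pi_div_two, Real.sin_add_pi_div_two, Real.cos_sub_pi_div_two,
    Real.sin_sub_pi_div_two]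
  ring

theorem IsTrig.continuous_pderiv {F : (ι → ℝ) → ℝ} (hF : IsTrig F) (hc : Continuous F) (i : ι) :
    Continuous (pderiv F i) := by
  rw [show pderiv F i = _ from funext (hF.pderiv_eq i)]
  fun_prop

theorem pderiv_eq_zero_of_update_eq {F : (ι → ℝ) → ℝ} {i : ι}
    (h : ∀ Θ s, F (Function.update Θ i s) = F Θ) (Θ : ι → ℝ) : pderiv F i Θ = 0 := by
  simp [pderiv, h]

end ParameterShift

/-! ### Mean value estimates in the sup norm -/

section PartialDerivatives

variable {ι : Type*} [Fintype ι] [DecidableEq ι]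

theorem hasDerivAt_update_of_differentiable {F : (ι → ℝ) → ℝ} (hF : Differentiable ℝ F)
    (Θ : ι → ℝ) (i : ι) :
    HasDerivAt (fun s => F (Function.update Θ i s)) (fderiv ℝ F Θ (Pi.single i 1)) (Θ i) := by
  have h1 := hasDerivAt_update Θ i (Θ i)
  have h2 : HasFDerivAt F (fderiv ℝ F Θ) (Function.update Θ i (Θ i)) := by
    rw [Function.update_eq_self]
    exact (hF Θ).hasFDerivAt
  exact h2.comp_hasDerivAt _ h1

theorem pderiv_eq_fderiv {F : (ι → ℝ) → ℝ} (hF : Differentiable ℝ F) (i : ι) (Θ : ι → ℝ) :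
    pderiv F i Θ = fderiv ℝ F Θ (Pi.single i 1) :=
  (hasDerivAt_update_of_differentiable hF Θ i).deriv

theorem fderiv_apply_eq_sum_pderiv {F : (ι → ℝ) → ℝ} (hF : Differentiable ℝ F) (Θ v : ι → ℝ) :
    fderiv ℝ F Θ v = ∑ i, pderiv F i Θ * v i := by
  conv_lhs => rw [pi_eq_sum_univ' v, map_sum]
  refine Finset.sum_congr rfl fun i _ => ?_
  rw [map_smul, pderiv_eq_fderiv hF, smul_eq_mul, mul_comm]

theorem exists_sub_eq_sum_pderiv {F : (ι → ℝ) → ℝ} (hF : Differentiable ℝ F) (Θ Θ' : ι → ℝ) :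
    ∃ Ξ, ‖Ξ - Θ‖ ≤ ‖Θ' - Θ‖ ∧ F Θ' - F Θ = ∑ i, pderiv F i Ξ * (Θ' i - Θ i) := by
  have hline : ∀ u : ℝ, HasDerivAt (fun u : ℝ => F (Θ + u • (Θ' - Θ)))
      (fderiv ℝ F (Θ + u • (Θ' - Θ)) (Θ' - Θ)) u := fun u => by
    have h1 : HasDerivAt (fun u : ℝ => Θ + u • (Θ' - Θ)) (Θ' - Θ) u := by
      simpa using ((hasDerivAt_id u).smul_const (Θ' - Θ)).const_add Θ
    exact (hF _).hasFDerivAt.comp_hasDerivAt u h1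
  obtain ⟨c, hc, h⟩ := exists_hasDerivAt_eq_slope (fun u : ℝ => F (Θ + u • (Θ' - Θ))) _
    one_pos (fun u _ => (hline u).continuousAt.continuousWithinAt) fun u _ => hline u
  refine ⟨Θ + c • (Θ' - Θ), ?_, ?_⟩
  · rw [add_sub_cancel_left, norm_smul, Real.norm_of_nonneg hc.1.le]
    exact mul_le_of_le_one_left (norm_nonneg _) hc.2.le
  · rw [fderiv_apply_eq_sum_pderiv hF] at h
    simpa using h.symm

/-- By the mean value theorem the remainder is a sum of increments of partial derivatives, one per
variable. The factor `1/2` of Taylor's formula is given up. -/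
theorem abs_sub_sub_sum_pderiv_le {F : (ι → ℝ) → ℝ} (hF : Differentiable ℝ F) {b : ℝ}
    (hb : ∀ i Θ Θ', |pderiv F i Θ' - pderiv F i Θ| ≤ b * ‖Θ' - Θ‖) (hb0 : 0 ≤ b)
    (Θ Θ' : ι → ℝ) :
    |F Θ' - F Θ - ∑ i, pderiv F i Θ * (Θ' i - Θ i)| ≤ Fintype.card ι * b * ‖Θ' - Θ‖ ^ 2 := by
  obtain ⟨Ξ, hΞ, h⟩ := exists_sub_eq_sum_pderiv hF Θ Θ'
  rw [h, ← Finset.sum_sub_distrib]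
  calc _ ≤ ∑ i, |pderiv F i Ξ * (Θ' i - Θ i) - pderiv F i Θ * (Θ' i - Θ i)| :=
        Finset.abs_sum_le_sum_abs _ _
    _ ≤ ∑ _i : ι, b * ‖Θ' - Θ‖ ^ 2 := Finset.sum_le_sum fun i _ => by
        rw [← sub_mul, abs_mul, sq, ← mul_assoc]
        have h1 : |Θ' i - Θ i| ≤ ‖Θ' - Θ‖ := norm_le_pi_norm (Θ' - Θ) i
        have h2 := hb i Θ Ξ
        gcongr
        exact h2.trans (by gcongr)
    _ = _ := by simp [mul_assoc]

theorem pderiv_sum {κ : Type*} (s : Finset κ) (c : ℝ) {F : κ → (ι → ℝ) → ℝ}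
    (hF : ∀ k, Differentiable ℝ (F k)) (i : ι) (Θ : ι → ℝ) :
    pderiv (fun Θ => c * ∑ k ∈ s, F k Θ) i Θ = c * ∑ k ∈ s, pderiv (F k) i Θ := by
  refine HasDerivAt.deriv (HasDerivAt.const_mul c (HasDerivAt.fun_sum fun k _ => ?_))
  rw [pderiv_eq_fderiv (hF k)]
  exact hasDerivAt_update_of_differentiable (hF k) Θ i

omit [Fintype ι] in
theorem IsTrig.abs_pderiv_le {F : (ι → ℝ) → ℝ} (hF : IsTrig F) (h1 : ∀ Θ, |F Θ| ≤ 1) (i : ι)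
    (Θ : ι → ℝ) : |pderiv F i Θ| ≤ 2 := by
  rw [hF.pderiv_eq]
  refine (abs_sub _ _).trans ?_
  linarith [h1 (Θ + Pi.single i (Real.pi / 4)), h1 (Θ + Pi.single i (-(Real.pi / 4)))]

theorem IsTrig.abs_sub_le {F : (ι → ℝ) → ℝ} (hF : IsTrig F) (h1 : ∀ Θ, |F Θ| ≤ 1)
    (hd : Differentiable ℝ F) {S : Finset ι}
    (hS : ∀ i ∉ S, ∀ Θ s, F (Function.update Θ i s) = F Θ) (Θ Θ' : ι → ℝ) :
    |F Θ' - F Θ| ≤ 2 * S.card * ‖Θ' - Θ‖ := by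
  obtain ⟨Ξ, -, h⟩ := exists_sub_eq_sum_pderiv hd Θ Θ'
  rw [h, ← Finset.sum_subset (Finset.subset_univ S) fun i _ hi => by
    rw [pderiv_eq_zero_of_update_eq (hS i hi), zero_mul]]
  calc _ ≤ ∑ i ∈ S, |pderiv F i Ξ * (Θ' i - Θ i)| := Finset.abs_sum_le_sum_abs _ _
    _ ≤ ∑ _i ∈ S, 2 * ‖Θ' - Θ‖ := Finset.sum_le_sum fun i _ => by
        rw [abs_mul]
        have h1' : |Θ' i - Θ i| ≤ ‖Θ' - Θ‖ := norm_le_pi_norm (Θ' - Θ) i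
        have h2 := hF.abs_pderiv_le h1 i Ξ
        gcongr
    _ = _ := by simp; ring

/-- The parameter-shift rule turns the increment of a derivative into two increments of `F`, so no
second derivatives are estimated. -/
theorem IsTrig.abs_pderiv_sub_le {F : (ι → ℝ) → ℝ} (hF : IsTrig F) (h1 : ∀ Θ, |F Θ| ≤ 1)
    (hd : Differentiable ℝ F) {S : Finset ι}
    (hS : ∀ i ∉ S, ∀ Θ s, F (Function.update Θ i s) = F Θ) (i : ι) (Θ Θ' : ι → ℝ) :
    |pderiv F i Θ' - pderiv F i Θ| ≤ 4 * S.card * ‖Θ' - Θ‖ := by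
  have key : ∀ d, |F (Θ' + Pi.single i d) - F (Θ + Pi.single i d)|
      ≤ 2 * S.card * ‖Θ' - Θ‖ := fun d => by
    have h := hF.abs_sub_le h1 hd hS (Θ + Pi.single i d) (Θ' + Pi.single i d)
    rwa [show Θ' + Pi.single i d - (Θ + Pi.single i d) = Θ' - Θ by abel] at h
  rw [hF.pderiv_eq, hF.pderiv_eq, sub_sub_sub_comm]
  refine (abs_sub _ _).trans ?_
  linarith [key (Real.pi / 4), key (-(Real.pi / 4))]

end PartialDerivatives

/-! ### Bounds for the model, its gradient and the empirical kernel -/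

namespace Circuit

variable {X : Type*} {m L : ℕ} (C : Circuit X m L)

theorem localModel_differentiable (k : Fin m) (x : X) :
    Differentiable ℝ fun Θ : Params L m => C.localModel k Θ x :=
  (C.localModel_contDiff k x).differentiable (by simp)

theorem localModel_isTrig (k : Fin m) (x : X) :
    IsTrig fun Θ : Params L m => C.localModel k Θ x := fun i Θ => C.localModel_trig k i Θ x

theorem model_isTrig (N : ℝ) (x : X) : IsTrig fun Θ : Params L m => C.model N Θ x :=
  IsTrig.const_mul_sum _ _ fun k => C.localModel_isTrig k x

theorem model_differentiable (N : ℝ) (x : X) :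
    Differentiable ℝ fun Θ : Params L m => C.model N Θ x := by
  have := fun k => C.localModel_differentiable k x
  unfold model
  fun_prop

theorem model_continuous (N : ℝ) (x : X) : Continuous fun Θ : Params L m => C.model N Θ x :=
  (C.model_differentiable N x).continuous

theorem pderiv_model_continuous (N : ℝ) (x : X) (i : Fin L × Fin m) :
    Continuous (pderiv (fun Θ : Params L m => C.model N Θ x) i) :=
  (C.model_isTrig N x).continuous_pderiv (C.model_continuous N x) i

theorem pderiv_model (N : ℝ) (x : X) (i : Fin L × Fin m) (Θ : Params L m) :
    pderiv (fun Θ : Params L m => C.model N Θ x) i Θ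
      = 1 / N * ∑ k ∈ C.futureCone i, pderiv (fun Θ : Params L m => C.localModel k Θ x) i Θ := by
  unfold model
  rw [pderiv_sum _ _ fun k => C.localModel_differentiable k x]
  congr 1
  symm
  refine Finset.sum_subset (Finset.subset_univ _) fun k _ hk => ?_
  exact pderiv_eq_zero_of_update_eq (fun Θ s => C.localModel_update_of_notMem
    (fun h => hk (Finset.mem_filter.mpr ⟨Finset.mem_univ _, h⟩)) Θ s x) Θ

theorem card_futureCone_le (i : Fin L × Fin m) : (C.futureCone i).card ≤ C.maxM :=
  Finset.le_sup (f := fun i => (C.futureCone i).card) (Finset.mem_univ i)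

theorem card_pastCone_le (k : Fin m) : (C.pastCone k).card ≤ C.maxN :=
  Finset.le_sup (f := fun k => (C.pastCone k).card) (Finset.mem_univ k)

/-- The bound `2 |ℳ| / N` on the partial derivatives of the model. -/
def gradBound (N : ℝ) : ℝ := 2 * C.maxM / N

/-- The Lipschitz constant `4 |ℳ| |𝒩| / N` of the partial derivatives of the model. -/
def gradLip (N : ℝ) : ℝ := 4 * C.maxM * C.maxN / N

theorem gradBound_nonneg {N : ℝ} (hN : 0 < N) : 0 ≤ C.gradBound N := by
  unfold gradBound; positivity

theorem gradLip_nonneg {N : ℝ} (hN : 0 < N) : 0 ≤ C.gradLip N := by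
  unfold gradLip; positivity

theorem abs_pderiv_model_le {N : ℝ} (hN : 0 < N) (x : X) (i : Fin L × Fin m) (Θ : Params L m) :
    |pderiv (fun Θ : Params L m => C.model N Θ x) i Θ| ≤ C.gradBound N := by
  rw [pderiv_model, abs_mul, abs_of_pos (by positivity : 0 < 1 / N)]
  have : |∑ k ∈ C.futureCone i, pderiv (fun Θ : Params L m => C.localModel k Θ x) i Θ|
      ≤ 2 * C.maxM :=
    calc _ ≤ ∑ k ∈ C.futureCone i, |pderiv (fun Θ : Params L m => C.localModel k Θ x) i Θ| :=
          Finset.abs_sum_le_sum_abs _ _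
      _ ≤ ∑ _k ∈ C.futureCone i, 2 := Finset.sum_le_sum fun k _ =>
          (C.localModel_isTrig k x).abs_pderiv_le (fun Θ => C.abs_localModel_le_one k Θ x) i Θ
      _ = 2 * (C.futureCone i).card := by simp; ring
      _ ≤ _ := by gcongr; exact C.card_futureCone_le i
  calc _ ≤ 1 / N * (2 * C.maxM) := by gcongr
    _ = _ := by rw [gradBound]; ring

theorem abs_pderiv_model_sub_le {N : ℝ} (hN : 0 < N) (x : X) (i : Fin L × Fin m)
    (Θ Θ' : Params L m) :
    |pderiv (fun Θ : Params L m => C.model N Θ x) i Θ'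
      - pderiv (fun Θ : Params L m => C.model N Θ x) i Θ| ≤ C.gradLip N * ‖Θ' - Θ‖ := by
  rw [pderiv_model, pderiv_model, ← mul_sub, ← Finset.sum_sub_distrib, abs_mul,
    abs_of_pos (by positivity : 0 < 1 / N)]
  have : |∑ k ∈ C.futureCone i, (pderiv (fun Θ : Params L m => C.localModel k Θ x) i Θ'
      - pderiv (fun Θ : Params L m => C.localModel k Θ x) i Θ)|
      ≤ C.maxM * (4 * C.maxN * ‖Θ' - Θ‖) :=
    calc _ ≤ ∑ k ∈ C.futureCone i, |pderiv (fun Θ : Params L m => C.localModel k Θ x) i Θ'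
          - pderiv (fun Θ : Params L m => C.localModel k Θ x) i Θ| :=
          Finset.abs_sum_le_sum_abs _ _
      _ ≤ ∑ _k ∈ C.futureCone i, 4 * C.maxN * ‖Θ' - Θ‖ := Finset.sum_le_sum fun k _ => by
          refine ((C.localModel_isTrig k x).abs_pderiv_sub_le
            (fun Θ => C.abs_localModel_le_one k Θ x) (C.localModel_differentiable k x)
            (S := C.pastCone k)
            (fun i hi Θ s => C.localModel_update_of_notMem hi Θ s x) i Θ Θ').trans ?_
          gcongr
          exact C.card_pastCone_le k
      _ = (C.futureCone i).card * (4 * C.maxN * ‖Θ' - Θ‖) := by simp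
      _ ≤ _ := by gcongr; exact C.card_futureCone_le i
  calc _ ≤ 1 / N * (C.maxM * (4 * C.maxN * ‖Θ' - Θ‖)) := by gcongr
    _ = _ := by rw [gradLip]; ring

theorem abs_model_sub_linModel_le {N : ℝ} (hN : 0 < N) (x : X) (Θ Θ' : Params L m) :
    |C.model N Θ' x - C.linModel N Θ Θ' x| ≤ L * m * C.gradLip N * ‖Θ' - Θ‖ ^ 2 := by
  have := abs_sub_sub_sum_pderiv_le (C.model_differentiable N x)
    (C.abs_pderiv_model_sub_le hN x) (C.gradLip_nonneg hN) Θ Θ'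
  rw [linModel, ← sub_sub]
  simpa using this

theorem empNTK_comm (N NK : ℝ) (Θ : Params L m) (x x' : X) :
    C.empNTK N NK Θ x x' = C.empNTK N NK Θ x' x := by
  simp only [empNTK, mul_comm]

theorem abs_empNTK_sub_le {N NK : ℝ} (hN : 0 < N) (hNK : 0 < NK) (x x' : X)
    (Θ Θ' : Params L m) : |C.empNTK N NK Θ' x x' - C.empNTK N NK Θ x x'|
      ≤ 2 * (L * m) * C.gradBound N * C.gradLip N / NK * ‖Θ' - Θ‖ := by
  rw [empNTK, empNTK, ← mul_sub, ← Finset.sum_sub_distrib, abs_mul,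
    abs_of_pos (by positivity : 0 < 1 / NK)]
  have ha := C.gradBound_nonneg hN
  have hb := C.gradLip_nonneg hN
  set p := fun i => pderiv (fun Θ : Params L m => C.model N Θ x) i
  set q := fun i => pderiv (fun Θ : Params L m => C.model N Θ x') i
  have : |∑ i, (p i Θ' * q i Θ' - p i Θ * q i Θ)|
      ≤ (L * m) * (2 * C.gradBound N * (C.gradLip N * ‖Θ' - Θ‖)) :=
    calc _ ≤ ∑ i, |p i Θ' * q i Θ' - p i Θ * q i Θ| := Finset.abs_sum_le_sum_abs _ _
      _ ≤ ∑ _i : Fin L × Fin m, 2 * C.gradBound N * (C.gradLip N * ‖Θ' - Θ‖) :=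
          Finset.sum_le_sum fun i _ => by
          have e : p i Θ' * q i Θ' - p i Θ * q i Θ
              = (p i Θ' - p i Θ) * q i Θ' + p i Θ * (q i Θ' - q i Θ) := by ring
          rw [e]
          refine (abs_add_le _ _).trans ?_
          rw [abs_mul, abs_mul]
          have h1 := C.abs_pderiv_model_sub_le hN x i Θ Θ'
          have h2 := C.abs_pderiv_model_sub_le hN x' i Θ Θ'
          have h3 := C.abs_pderiv_model_le hN x i Θ
          have h4 := C.abs_pderiv_model_le hN x' i Θ'
          calc _ ≤ (C.gradLip N * ‖Θ' - Θ‖) * C.gradBound N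
                + C.gradBound N * (C.gradLip N * ‖Θ' - Θ‖) := by gcongr
            _ = _ := by ring
      _ = _ := by simp
  calc _ ≤ 1 / NK * ((L * m) * (2 * C.gradBound N * (C.gradLip N * ‖Θ' - Θ‖))) := by gcongr
    _ = _ := by ring

theorem abs_empNTK_le {N NK : ℝ} (hN : 0 < N) (hNK : 0 < NK) (x x' : X) (Θ : Params L m) :
    |C.empNTK N NK Θ x x'| ≤ L * m * C.gradBound N ^ 2 / NK := by
  rw [empNTK, abs_mul, abs_of_pos (by positivity : 0 < 1 / NK)]
  have ha := C.gradBound_nonneg hN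
  have : |∑ i, pderiv (fun Θ : Params L m => C.model N Θ x) i Θ
      * pderiv (fun Θ : Params L m => C.model N Θ x') i Θ| ≤ L * m * C.gradBound N ^ 2 := by
    refine (Finset.abs_sum_le_sum_abs _ _).trans ?_
    calc _ ≤ ∑ _i : Fin L × Fin m, C.gradBound N ^ 2 := Finset.sum_le_sum fun i _ => by
          rw [abs_mul, sq]
          have h3 := C.abs_pderiv_model_le hN x i Θ
          have h4 := C.abs_pderiv_model_le hN x' i Θ
          gcongr
      _ = _ := by simp
  calc _ ≤ 1 / NK * (L * m * C.gradBound N ^ 2) := by gcongr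
    _ = _ := by ring

theorem empNTK_continuous (N NK : ℝ) (x x' : X) :
    Continuous fun Θ : Params L m => C.empNTK N NK Θ x x' := by
  have h := fun x i => C.pderiv_model_continuous N x i
  unfold empNTK
  fun_prop

theorem abs_model_le (N : ℝ) (x : X) (Θ : Params L m) : |C.model N Θ x| ≤ |1 / N| * m := by
  rw [model, abs_mul]
  gcongr
  refine (Finset.abs_sum_le_sum_abs _ _).trans ?_
  calc _ ≤ ∑ _k : Fin m, (1 : ℝ) := Finset.sum_le_sum fun k _ => C.abs_localModel_le_one k Θ x
    _ = _ := by simp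

end Circuit

/-! ### The Efron–Stein inequality -/

section EfronStein

variable {α : Type*} [MeasurableSpace α] {μ : Measure α} [IsProbabilityMeasure μ]

omit [IsProbabilityMeasure μ] in
theorem integrable_of_abs_le [IsFiniteMeasure μ] {g : α → ℝ} (hg : Measurable g) {B : ℝ}
    (hB : ∀ x, |g x| ≤ B) : Integrable g μ :=
  .of_bound hg.aestronglyMeasurable B (.of_forall hB)

theorem abs_integral_le_of_abs_le {g : α → ℝ} {B : ℝ} (hB : ∀ x, |g x| ≤ B) :
    |∫ x, g x ∂μ| ≤ B := by
  simpa using norm_integral_le_of_norm_le_const (μ := μ) (f := g) (.of_forall hB)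

theorem sq_abs_le {a B : ℝ} (h : |a| ≤ B) : |a ^ 2| ≤ B ^ 2 := by
  rw [abs_pow]
  exact pow_le_pow_left₀ (abs_nonneg a) h 2

theorem sq_sub_abs_le {a b B : ℝ} (h : |a| ≤ B) (h' : |b| ≤ B) : |(a - b) ^ 2| ≤ (2 * B) ^ 2 :=
  sq_abs_le ((abs_sub a b).trans (by linarith))

theorem integral_quadratic {g : α → ℝ} (hg : Measurable g) {B : ℝ} (hB : ∀ x, |g x| ≤ B)
    (a b c : ℝ) : ∫ x, (a * g x ^ 2 + b * g x + c) ∂μ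
      = a * ∫ x, g x ^ 2 ∂μ + b * ∫ x, g x ∂μ + c := by
  have h1 := (integrable_of_abs_le (μ := μ) hg hB).const_mul b
  have h2 := (integrable_of_abs_le (μ := μ) (hg.pow_const 2) fun x => sq_abs_le (hB x)).const_mul a
  rw [integral_add (f := fun x => a * g x ^ 2 + b * g x) (h2.add h1) (integrable_const _),
    integral_add h2 h1, integral_const_mul, integral_const_mul, integral_const, probReal_univ,
    one_smul]

theorem sq_integral_le {g : α → ℝ} (hg : Measurable g) {B : ℝ} (hB : ∀ x, |g x| ≤ B) :
    (∫ x, g x ∂μ) ^ 2 ≤ ∫ x, g x ^ 2 ∂μ := by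
  have h := integral_quadratic (μ := μ) hg hB 1 (-2 * ∫ x, g x ∂μ) ((∫ x, g x ∂μ) ^ 2)
  have h0 : 0 ≤ ∫ x, (1 * g x ^ 2 + -2 * (∫ x, g x ∂μ) * g x + (∫ x, g x ∂μ) ^ 2) ∂μ :=
    integral_nonneg fun x => by
      have := sq_nonneg (g x - ∫ x, g x ∂μ)
      simp only [Pi.zero_apply]
      linarith
  linarith

theorem integral_half_sq_sub {g : α → ℝ} (hg : Measurable g) {B : ℝ} (hB : ∀ x, |g x| ≤ B) :
    ∫ x, ∫ y, 1 / 2 * (g x - g y) ^ 2 ∂μ ∂μ = ∫ x, g x ^ 2 ∂μ - (∫ x, g x ∂μ) ^ 2 := by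
  have inner : ∀ x, ∫ y, 1 / 2 * (g x - g y) ^ 2 ∂μ
      = 1 / 2 * g x ^ 2 + -(∫ y, g y ∂μ) * g x + 1 / 2 * ∫ y, g y ^ 2 ∂μ := fun x => by
    have : ∀ y, 1 / 2 * (g x - g y) ^ 2 = 1 / 2 * g y ^ 2 + -g x * g y + 1 / 2 * g x ^ 2 :=
      fun y => by ring
    simp only [this]
    rw [integral_quadratic hg hB]
    ring
  simp only [inner]
  rw [integral_quadratic hg hB]
  ring

variable {μ : Measure ℝ} [IsProbabilityMeasure μ]

theorem integral_pi_succ {n : ℕ} {G : (Fin (n + 1) → ℝ) → ℝ} (hG : Measurable G) {B : ℝ}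
    (hB : ∀ x, |G x| ≤ B) : ∫ x, G x ∂(Measure.pi fun _ => μ)
      = ∫ a, ∫ v, G (Fin.cons a v) ∂(Measure.pi fun _ => μ) ∂μ := by
  have h := (measurePreserving_piFinSuccAbove (fun _ : Fin (n + 1) => μ) 0).symm
  rw [← h.integral_comp']
  have hm : ∀ q : ℝ × (Fin n → ℝ), (MeasurableEquiv.piFinSuccAbove (fun _ => ℝ) 0).symm q
      = (Fin.cons q.1 q.2 : Fin (n + 1) → ℝ) := fun q => by
    simp [MeasurableEquiv.piFinSuccAbove, Fin.insertNthEquiv]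
  rw [integral_prod]
  · simp only [hm]
  · exact integrable_of_abs_le (hG.comp (MeasurableEquiv.measurable _)) fun _ => hB _

theorem measurable_cons {n : ℕ} :
    Measurable fun q : ℝ × (Fin n → ℝ) => (Fin.cons q.1 q.2 : Fin (n + 1) → ℝ) := by
  refine measurable_pi_lambda _ fun i => ?_
  refine Fin.cases ?_ (fun j => ?_) i
  · simpa using measurable_fst
  · simpa [Function.comp_def] using (measurable_pi_apply j).comp measurable_snd

theorem measurable_integral_sq_sub_update {ι : Type*} [Fintype ι] [DecidableEq ι]
    {F : (ι → ℝ) → ℝ} (hF : Measurable F) (i : ι) :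
    Measurable fun Θ => ∫ s, 1 / 2 * (F Θ - F (Function.update Θ i s)) ^ 2 ∂μ := by
  refine StronglyMeasurable.measurable (StronglyMeasurable.integral_prod_right ?_)
  refine Measurable.stronglyMeasurable ?_
  exact (((hF.comp measurable_fst).sub (hF.comp measurable_update')).pow_const 2).const_mul _

theorem abs_half_sq_sub_le {a b B : ℝ} (h : |a| ≤ B) (h' : |b| ≤ B) :
    |1 / 2 * (a - b) ^ 2| ≤ 2 * B ^ 2 := by
  have := sq_sub_abs_le h h'
  rw [abs_mul, abs_of_pos (by norm_num : (0 : ℝ) < 1 / 2)]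
  nlinarith

/-- Induction on the number of variables. Let `h a` be the mean with the first variable fixed to
`a`. The induction hypothesis bounds the second moment for fixed `a` by `h a ^ 2` plus the terms of
the other variables. After averaging over `a`, the variance of `h` remains; it is half the mean
square of `h a - h b` for independent `a`, `b`, at most the term of the first variable. -/
theorem efronStein_fin : ∀ {n : ℕ} {F : (Fin n → ℝ) → ℝ} (_ : Measurable F) {B : ℝ}
    (_ : ∀ x, |F x| ≤ B), ∫ Θ, F Θ ^ 2 ∂(Measure.pi fun _ => μ)
      ≤ (∫ Θ, F Θ ∂(Measure.pi fun _ => μ)) ^ 2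
        + ∑ i, ∫ Θ, ∫ s, 1 / 2 * (F Θ - F (Function.update Θ i s)) ^ 2 ∂μ ∂(Measure.pi fun _ => μ)
  | 0, F, hF, B, hB => by
    have : ∀ Θ, F Θ = F Fin.elim0 := fun Θ => congrArg F (Subsingleton.elim _ _)
    simp [this]
  | n + 1, F, hF, B, hB => by
    set π : Measure (Fin n → ℝ) := Measure.pi fun _ => μ with hπ
    have hFc : Measurable fun q : ℝ × (Fin n → ℝ) => F (Fin.cons q.1 q.2) :=
      hF.comp measurable_cons
    have hFa : ∀ a, Measurable fun v : Fin n → ℝ => F (Fin.cons a v) := fun a =>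
      hFc.comp measurable_prodMk_left
    set h : ℝ → ℝ := fun a => ∫ v, F (Fin.cons a v) ∂π with hh
    have hhm : Measurable h :=
      (StronglyMeasurable.integral_prod_right hFc.stronglyMeasurable).measurable
    have hhB : ∀ a, |h a| ≤ B := fun a => abs_integral_le_of_abs_le fun v => hB _
    have hDm := fun j : Fin n => measurable_integral_sq_sub_update (μ := μ) hF j.succ
    have hDB : ∀ (j : Fin n) Θ, |∫ s, 1 / 2 * (F Θ - F (Function.update Θ j.succ s)) ^ 2 ∂μ|
        ≤ 2 * B ^ 2 := fun j Θ => abs_integral_le_of_abs_le fun s =>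
          abs_half_sq_sub_le (hB _) (hB _)
    have hD : ∀ j : Fin n,
        ∫ Θ, ∫ s, 1 / 2 * (F Θ - F (Function.update Θ j.succ s)) ^ 2 ∂μ ∂(Measure.pi fun _ => μ)
        = ∫ a, ∫ v, ∫ s, 1 / 2 * (F (Fin.cons a v) - F (Fin.cons a (Function.update v j s))) ^ 2
          ∂μ ∂π ∂μ := fun j => by
      rw [integral_pi_succ (hDm j) (hDB j)]
      simp only [Fin.cons_update, hπ]
    have hIm : ∀ j : Fin n, Measurable fun a => ∫ v, ∫ s, 1 / 2 * (F (Fin.cons a v)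
        - F (Fin.cons a (Function.update v j s))) ^ 2 ∂μ ∂π := fun j => by
      refine (StronglyMeasurable.integral_prod_right (f := fun a v => ∫ s, 1 / 2 * (F (Fin.cons a v)
        - F (Fin.cons a (Function.update v j s))) ^ 2 ∂μ) ?_).measurable
      have := (hDm j).comp measurable_cons
      simp only [Function.comp_def, ← Fin.cons_update] at this
      exact this.stronglyMeasurable
    have hIB : ∀ (j : Fin n) a, |∫ v, ∫ s, 1 / 2 * (F (Fin.cons a v)
        - F (Fin.cons a (Function.update v j s))) ^ 2 ∂μ ∂π| ≤ 2 * B ^ 2 := fun j a =>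
      abs_integral_le_of_abs_le fun v => abs_integral_le_of_abs_le fun s =>
        abs_half_sq_sub_le (hB _) (hB _)
    -- Fubini moves the average over the other variables inside, and there the square of a mean is
    -- at most the mean of the square.
    have h0 : ∫ a, ∫ b, 1 / 2 * (h a - h b) ^ 2 ∂μ ∂μ
        ≤ ∫ Θ, ∫ s, 1 / 2 * (F Θ - F (Function.update Θ 0 s)) ^ 2 ∂μ
          ∂(Measure.pi fun _ => μ) := by
      rw [integral_pi_succ (measurable_integral_sq_sub_update hF 0)
        fun Θ => abs_integral_le_of_abs_le fun s => abs_half_sq_sub_le (hB _) (hB _)]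
      simp only [Fin.update_cons_zero]
      have hm3 : Measurable fun q : (ℝ × ℝ) × (Fin n → ℝ) =>
          1 / 2 * (F (Fin.cons q.1.1 q.2) - F (Fin.cons q.1.2 q.2)) ^ 2 :=
        (((hFc.comp ((measurable_fst.comp measurable_fst).prodMk measurable_snd)).sub
          (hFc.comp ((measurable_snd.comp measurable_fst).prodMk measurable_snd))).pow_const
            2).const_mul _
      have hswap : ∀ a, ∫ v, ∫ s, 1 / 2 * (F (Fin.cons a v) - F (Fin.cons s v)) ^ 2 ∂μ ∂π
          = ∫ s, ∫ v, 1 / 2 * (F (Fin.cons a v) - F (Fin.cons s v)) ^ 2 ∂π ∂μ := fun a => by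
        refine integral_integral_swap (integrable_of_abs_le (B := 2 * B ^ 2) ?_ fun q =>
          abs_half_sq_sub_le (hB _) (hB _))
        exact hm3.comp (((measurable_const (a := a)).prodMk measurable_snd).prodMk measurable_fst)
      have hm2 : Measurable fun q : ℝ × ℝ =>
          ∫ v, 1 / 2 * (F (Fin.cons q.1 v) - F (Fin.cons q.2 v)) ^ 2 ∂π :=
        (StronglyMeasurable.integral_prod_right (f := fun (q : ℝ × ℝ) (v : Fin n → ℝ) =>
          1 / 2 * (F (Fin.cons q.1 v) - F (Fin.cons q.2 v)) ^ 2)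
          hm3.stronglyMeasurable).measurable
      have hb2 : ∀ a b, |∫ v, 1 / 2 * (F (Fin.cons a v) - F (Fin.cons b v)) ^ 2 ∂π|
          ≤ 2 * B ^ 2 := fun a b =>
        abs_integral_le_of_abs_le fun v => abs_half_sq_sub_le (hB _) (hB _)
      have hhm2 : Measurable fun q : ℝ × ℝ => 1 / 2 * (h q.1 - h q.2) ^ 2 := by fun_prop
      simp only [← hπ, hswap]
      refine integral_mono
        (integrable_of_abs_le (B := 2 * B ^ 2)
          (StronglyMeasurable.integral_prod_right hhm2.stronglyMeasurable).measurable
          fun a => abs_integral_le_of_abs_le fun b => abs_half_sq_sub_le (hhB _) (hhB _))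
        (integrable_of_abs_le (B := 2 * B ^ 2)
          (StronglyMeasurable.integral_prod_right hm2.stronglyMeasurable).measurable
          fun a => abs_integral_le_of_abs_le fun b => hb2 a b) fun a => ?_
      refine integral_mono
        (integrable_of_abs_le (hhm2.comp measurable_prodMk_left)
          fun b => abs_half_sq_sub_le (hhB a) (hhB b))
        (integrable_of_abs_le (hm2.comp measurable_prodMk_left) fun b => hb2 a b) fun b => ?_
      have hi := fun a => integrable_of_abs_le (μ := π) (hFa a) fun v => hB _
      change 1 / 2 * (h a - h b) ^ 2 ≤ ∫ v, 1 / 2 * (F (Fin.cons a v) - F (Fin.cons b v)) ^ 2 ∂π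
      rw [integral_const_mul, hh, ← integral_sub (hi a) (hi b)]
      gcongr
      exact sq_integral_le ((hFa a).sub (hFa b)) (B := 2 * B) fun v =>
        (abs_sub _ _).trans (by linarith [hB (Fin.cons a v), hB (Fin.cons b v)])
    rw [integral_pi_succ (hF.pow_const 2) fun x => sq_abs_le (hB x), integral_pi_succ hF hB,
      Fin.sum_univ_succ]
    have hvar := integral_half_sq_sub (μ := μ) hhm hhB
    have hih : ∀ a, ∫ v, F (Fin.cons a v) ^ 2 ∂π ≤ h a ^ 2 + ∑ j, ∫ v, ∫ s, 1 / 2 *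
        (F (Fin.cons a v) - F (Fin.cons a (Function.update v j s))) ^ 2 ∂μ ∂π := fun a =>
      efronStein_fin (hFa a) fun v => hB _
    have hint2 := integrable_of_abs_le (μ := μ) (hhm.pow_const 2) fun a => sq_abs_le (hhB a)
    have hintj := fun j => integrable_of_abs_le (μ := μ) (hIm j) (hIB j)
    have hmono : ∫ a, ∫ v, F (Fin.cons a v) ^ 2 ∂π ∂μ ≤ ∫ a, (h a ^ 2 + ∑ j, ∫ v, ∫ s, 1 / 2 *
        (F (Fin.cons a v) - F (Fin.cons a (Function.update v j s))) ^ 2 ∂μ ∂π) ∂μ := by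
      refine integral_mono (integrable_of_abs_le (B := B ^ 2) ?_ fun a =>
        abs_integral_le_of_abs_le fun v => sq_abs_le (hB _))
        (hint2.add (integrable_finsetSum _ fun j _ => hintj j)) hih
      exact (StronglyMeasurable.integral_prod_right
        (f := fun a (v : Fin n → ℝ) => F (Fin.cons a v) ^ 2)
        (hFc.pow_const 2).stronglyMeasurable).measurable
    rw [integral_add hint2 (integrable_finsetSum _ fun j _ => hintj j),
      integral_finsetSum _ fun j _ => hintj j] at hmono
    simp only [hD]
    linarith

/-- The **Efron–Stein inequality** for bounded functions of independent variables. -/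
theorem efronStein {ι : Type*} [Fintype ι] [DecidableEq ι] {F : (ι → ℝ) → ℝ}
    (hF : Measurable F) {B : ℝ} (hB : ∀ x, |F x| ≤ B) :
    ∫ Θ, F Θ ^ 2 ∂(Measure.pi fun _ => μ)
      ≤ (∫ Θ, F Θ ∂(Measure.pi fun _ => μ)) ^ 2
        + ∑ i, ∫ Θ, ∫ s, 1 / 2 * (F Θ - F (Function.update Θ i s)) ^ 2 ∂μ
          ∂(Measure.pi fun _ => μ) := by
  set e := Fintype.equivFin ι
  have hp := measurePreserving_piCongrLeft (fun _ : ι => μ) e.symm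
  set φ := MeasurableEquiv.piCongrLeft (fun _ : ι => ℝ) e.symm
  have hφ : ∀ v i, φ v i = v (e i) := fun v i => by
    have := MeasurableEquiv.piCongrLeft_apply_apply (β := fun _ : ι => ℝ) e.symm v (e i)
    simpa using this
  have hup : ∀ v i s, Function.update (φ v) i s = φ (Function.update v (e i) s) := fun v i s => by
    ext j
    rw [hφ]
    by_cases hj : j = i
    · subst hj; simp
    · rw [Function.update_of_ne hj, Function.update_of_ne (by simpa using hj), hφ]
  rw [← hp.integral_comp', ← hp.integral_comp']
  have hs : ∀ i, ∫ Θ, ∫ s, 1 / 2 * (F Θ - F (Function.update Θ i s)) ^ 2 ∂μ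
      ∂(Measure.pi fun _ => μ) = ∫ v, ∫ s, 1 / 2 * (F (φ v)
        - F (φ (Function.update v (e i) s))) ^ 2 ∂μ ∂(Measure.pi fun _ => μ) := fun i => by
    rw [← hp.integral_comp']
    simp only [← hup]
  simp only [hs]
  rw [e.sum_comp fun j => ∫ v, ∫ s, 1 / 2 * (F (φ v)
        - F (φ (Function.update v j s))) ^ 2 ∂μ ∂(Measure.pi fun _ => μ)]
  exact efronStein_fin (F := fun v => F (φ v)) (hF.comp φ.measurable) fun v => hB _

end EfronStein

/-! ### Resampling one coordinate -/

section Resampling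

variable {ι : Type*} [Fintype ι] [DecidableEq ι] {μ : Measure ℝ} [IsProbabilityMeasure μ]

theorem measurePreserving_update (i : ι) :
    MeasurePreserving (fun q : (ι → ℝ) × ℝ => Function.update q.1 i q.2)
      ((Measure.pi fun _ => μ).prod μ) (Measure.pi fun _ => μ) := by
  refine ⟨measurable_update', (Measure.pi_eq fun s hs => ?_).symm⟩
  rw [Measure.map_apply measurable_update' (MeasurableSet.univ_pi hs)]
  have : (fun q : (ι → ℝ) × ℝ => Function.update q.1 i q.2) ⁻¹' (Set.univ.pi s)
      = (Set.univ.pi (Function.update s i Set.univ)) ×ˢ s i := by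
    ext q
    simp only [Set.mem_preimage, Set.mem_pi, Set.mem_univ, true_implies, Set.mem_prod]
    constructor
    · refine fun h => ⟨fun j => ?_, by simpa using h i⟩
      by_cases hj : j = i
      · subst hj; simp
      · simpa [hj] using h j
    · rintro ⟨h1, h2⟩ j
      by_cases hj : j = i
      · subst hj; simpa using h2
      · simpa [hj] using h1 j
  rw [this, Measure.prod_prod, Measure.pi_pi, ← Finset.mul_prod_erase _ _ (Finset.mem_univ i),
    ← Finset.mul_prod_erase _ (fun j => μ (s j)) (Finset.mem_univ i), Function.update_self,
    measure_univ, one_mul, mul_comm]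
  congr 1
  exact Finset.prod_congr rfl fun j hj => by
    rw [Function.update_of_ne (Finset.ne_of_mem_erase hj)]

/-- Lets an average over one angle alone be inserted under the integral, so that one-variable
identities apply coordinate by coordinate. -/
theorem integral_resample {H : (ι → ℝ) → ℝ} (hH : Measurable H) {B : ℝ} (hB : ∀ Θ, |H Θ| ≤ B)
    (i : ι) : ∫ Θ, H Θ ∂(Measure.pi fun _ => μ)
      = ∫ Θ, ∫ u, H (Function.update Θ i u) ∂μ ∂(Measure.pi fun _ => μ) := by
  rw [← (measurePreserving_update i).map_eq, integral_map measurable_update'.aemeasurable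
    hH.aestronglyMeasurable, integral_prod, (measurePreserving_update i).map_eq]
  exact integrable_of_abs_le (hH.comp measurable_update') fun _ => hB _

end Resampling

/-! ### Uniform angles: the Poincaré inequality and bounded differences -/

section Uniform

/-- The uniform distribution on `[0, π]`. -/
abbrev uniformAngle : Measure ℝ := ProbabilityTheory.cond volume (Set.Icc 0 Real.pi)

instance : IsProbabilityMeasure uniformAngle :=
  cond_isProbabilityMeasure_of_finite (by simp [Real.pi_pos]) (by simp)

instance (ι : Type*) [Fintype ι] : IsProbabilityMeasure (uniformInit ι) := by
  unfold uniformInit; infer_instance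

theorem integral_uniformAngle (g : ℝ → ℝ) :
    ∫ s, g s ∂uniformAngle = Real.pi⁻¹ * ∫ s in (0 : ℝ)..Real.pi, g s := by
  rw [uniformAngle, ProbabilityTheory.cond, integral_smul_measure,
    intervalIntegral.integral_of_le Real.pi_pos.le, integral_Icc_eq_integral_Ioc]
  simp [Real.pi_pos.le]

/-- On `[0, π]` the frequencies 2 and 4 run through whole periods. Frequency 4 is included because
squares of the trigonometric polynomials produce it. -/
theorem integral_trig (a b c d e : ℝ) : ∫ s, (a + b * Real.cos (2 * s) + c * Real.sin (2 * s)
    + d * Real.cos (4 * s) + e * Real.sin (4 * s)) ∂uniformAngle = a := by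
  have hd : ∀ s ∈ Set.uIcc 0 Real.pi, HasDerivAt (fun s => a * s + b * (Real.sin (2 * s) / 2)
      - c * (Real.cos (2 * s) / 2) + d * (Real.sin (4 * s) / 4) - e * (Real.cos (4 * s) / 4))
      (a + b * Real.cos (2 * s) + c * Real.sin (2 * s)
        + d * Real.cos (4 * s) + e * Real.sin (4 * s)) s := fun s _ => by
    have h2 : HasDerivAt (fun s : ℝ => 2 * s) 2 s := by
      simpa using (hasDerivAt_id s).const_mul (2 : ℝ)
    have h4 : HasDerivAt (fun s : ℝ => 4 * s) 4 s := by
      simpa using (hasDerivAt_id s).const_mul (4 : ℝ)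
    have h := (((((hasDerivAt_id s).const_mul a).add ((h2.sin.div_const 2).const_mul b)).sub
      ((h2.cos.div_const 2).const_mul c)).add ((h4.sin.div_const 4).const_mul d)).sub
      ((h4.cos.div_const 4).const_mul e)
    refine h.congr_deriv ?_
    ring
  rw [integral_uniformAngle, intervalIntegral.integral_eq_sub_of_hasDerivAt hd
    (Continuous.intervalIntegrable (by fun_prop) _ _)]
  have s2 : Real.sin (2 * Real.pi) = 0 := Real.sin_two_pi
  have c2 : Real.cos (2 * Real.pi) = 1 := Real.cos_two_pi
  have s4 : Real.sin (4 * Real.pi) = 0 := by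
    have := Real.sin_nat_mul_pi 4; exact_mod_cast this
  have c4 : Real.cos (4 * Real.pi) = 1 := by
    have := Real.cos_nat_mul_two_pi 2
    rw [← this]; congr 1; push_cast; ring
  simp only [s2, c2, s4, c4, mul_zero, Real.sin_zero, Real.cos_zero]
  field_simp [Real.pi_ne_zero]
  ring

/-- In one variable, the variance of a trigonometric polynomial spanned by `1`, `cos (2 s)` and
`sin (2 s)` is a quarter of the mean square of its derivative. -/
theorem variance_trig (a b c : ℝ) {g g' : ℝ → ℝ}
    (hg : ∀ s, g s = a + b * Real.cos (2 * s) + c * Real.sin (2 * s))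
    (hg' : ∀ s, g' s = -(2 * b) * Real.sin (2 * s) + 2 * c * Real.cos (2 * s)) :
    ∫ s, g s ^ 2 ∂uniformAngle - (∫ s, g s ∂uniformAngle) ^ 2
      = 1 / 4 * ∫ s, g' s ^ 2 ∂uniformAngle := by
  have e : ∀ s : ℝ, 4 * s = 2 * (2 * s) := fun s => by ring
  have h1 : ∫ s, g s ∂uniformAngle = a := by
    rw [← integral_trig a b c 0 0]
    simp [hg]
  have h2 : ∫ s, g s ^ 2 ∂uniformAngle = a ^ 2 + (b ^ 2 + c ^ 2) / 2 := by
    rw [← integral_trig (a ^ 2 + (b ^ 2 + c ^ 2) / 2) (2 * a * b) (2 * a * c)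
      ((b ^ 2 - c ^ 2) / 2) (b * c)]
    congr 1
    ext s
    rw [hg, e, Real.cos_two_mul (2 * s), Real.sin_two_mul (2 * s)]
    linear_combination c ^ 2 * Real.sin_sq_add_cos_sq (2 * s)
  have h3 : ∫ s, g' s ^ 2 ∂uniformAngle = 2 * (b ^ 2 + c ^ 2) := by
    rw [← integral_trig (2 * (b ^ 2 + c ^ 2)) 0 0 (2 * (c ^ 2 - b ^ 2)) (-(4 * b * c))]
    congr 1
    ext s
    rw [hg', e, Real.cos_two_mul (2 * s), Real.sin_two_mul (2 * s)]
    linear_combination 4 * b ^ 2 * Real.sin_sq_add_cos_sq (2 * s)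
  rw [h1, h2, h3]
  ring

theorem IsTrig.integral_half_sq_sub {ι : Type*} [DecidableEq ι] {F : (ι → ℝ) → ℝ}
    (hF : IsTrig F) {B : ℝ} (hB : ∀ Θ, |F Θ| ≤ B) (i : ι) (Θ : ι → ℝ) :
    ∫ u, ∫ s, 1 / 2 * (F (Function.update Θ i u) - F (Function.update Θ i s)) ^ 2
      ∂uniformAngle ∂uniformAngle
      = 1 / 4 * ∫ u, pderiv F i (Function.update Θ i u) ^ 2 ∂uniformAngle := by
  obtain ⟨a, b, c, h⟩ := hF i Θ
  rw [QNN.integral_half_sq_sub (g := fun u => F (Function.update Θ i u)) (B := B)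
    (by simp only [h]; fun_prop) fun _ => hB _]
  refine variance_trig a b c h fun u => ?_
  rw [pderiv]
  simp only [Function.update_idem, Function.update_self, h]
  have h2 : HasDerivAt (fun s : ℝ => 2 * s) 2 u := by
    simpa using (hasDerivAt_id u).const_mul (2 : ℝ)
  rw [(((h2.cos.const_mul b).const_add a).fun_add (h2.sin.const_mul c)).deriv]
  ring

/-- The **Poincaré inequality** for trigonometric polynomials of degree two in each angle. -/
theorem IsTrig.poincare {ι : Type*} [Fintype ι] [DecidableEq ι] {F : (ι → ℝ) → ℝ}
    (hF : IsTrig F) (hc : Continuous F) {B : ℝ} (hB : ∀ Θ, |F Θ| ≤ B) :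
    ∫ Θ, F Θ ^ 2 ∂uniformInit ι ≤ (∫ Θ, F Θ ∂uniformInit ι) ^ 2
      + 1 / 4 * ∑ i, ∫ Θ, pderiv F i Θ ^ 2 ∂uniformInit ι := by
  refine (efronStein (μ := uniformAngle) hc.measurable hB).trans (le_of_eq ?_)
  rw [Finset.mul_sum]
  congr 1
  refine Finset.sum_congr rfl fun i _ => ?_
  have hpB : ∀ Θ, |pderiv F i Θ| ≤ 2 * B := fun Θ => by
    rw [hF.pderiv_eq]
    exact (abs_sub _ _).trans (by
      linarith [hB (Θ + Pi.single i (Real.pi / 4)), hB (Θ + Pi.single i (-(Real.pi / 4)))])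
  -- After resampling the angle `i` on both sides, the Efron–Stein term becomes a variance in that
  -- angle alone, to which `variance_trig` applies.
  rw [uniformInit, integral_resample (measurable_integral_sq_sub_update hc.measurable i)
      (fun Θ => abs_integral_le_of_abs_le fun s => abs_half_sq_sub_le (hB _) (hB _)) i,
    integral_resample ((hF.continuous_pderiv hc i).measurable.pow_const 2)
      (fun Θ => sq_abs_le (hpB Θ)) i, ← integral_const_mul]
  congr 1
  ext Θ
  simp only [Function.update_idem]
  exact hF.integral_half_sq_sub hB i Θ

/-- A consequence of the Efron–Stein inequality for functions with bounded differences. -/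
theorem integral_sq_sub_le_of_bounded_differences {ι : Type*} [Fintype ι] [DecidableEq ι]
    {F : (ι → ℝ) → ℝ} (hF : Measurable F) {B c : ℝ} (hB : ∀ Θ, |F Θ| ≤ B)
    (hc : ∀ Θ i s, |F Θ - F (Function.update Θ i s)| ≤ c) :
    ∫ Θ, (F Θ - ∫ Θ', F Θ' ∂uniformInit ι) ^ 2 ∂uniformInit ι ≤ Fintype.card ι * (c ^ 2 / 2) := by
  have hes := efronStein (μ := uniformAngle) hF hB
  have hD : ∀ i, ∫ Θ, ∫ s, 1 / 2 * (F Θ - F (Function.update Θ i s)) ^ 2 ∂uniformAngle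
      ∂(Measure.pi fun _ : ι => uniformAngle) ≤ c ^ 2 / 2 := fun i =>
    (le_abs_self _).trans (abs_integral_le_of_abs_le fun Θ => abs_integral_le_of_abs_le fun s => by
      have := sq_abs_le (hc Θ i s)
      rw [abs_mul, abs_of_pos (by norm_num : (0 : ℝ) < 1 / 2)]
      linarith)
  have hsum := Finset.sum_le_sum fun i (_ : i ∈ Finset.univ) => hD i
  rw [Finset.sum_const, nsmul_eq_mul, Finset.card_univ] at hsum
  have hq := integral_quadratic (μ := uniformInit ι) hF hB 1 (-2 * ∫ Θ, F Θ ∂uniformInit ι)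
    ((∫ Θ, F Θ ∂uniformInit ι) ^ 2)
  have : ∫ Θ, (F Θ - ∫ Θ', F Θ' ∂uniformInit ι) ^ 2 ∂uniformInit ι
      = ∫ Θ, F Θ ^ 2 ∂uniformInit ι - (∫ Θ, F Θ ∂uniformInit ι) ^ 2 := by
    rw [show ∀ A C : ℝ, A - C ^ 2 = 1 * A + -2 * C * C + C ^ 2 by intros; ring, ← hq]
    congr 1
    ext Θ
    ring
  rw [this]
  unfold uniformInit
  linarith

end Uniform

theorem measureReal_abs_ge_le {α : Type*} [MeasurableSpace α] {μ : Measure α}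
    [IsProbabilityMeasure μ] {g : α → ℝ} (hg : Measurable g) {B : ℝ} (hB : ∀ x, |g x| ≤ B) {ε : ℝ}
    (hε : 0 < ε) : μ.real {x | ε ≤ |g x|} ≤ (∫ x, g x ^ 2 ∂μ) / ε ^ 2 := by
  have h := mul_meas_ge_le_integral_of_nonneg (μ := μ) (f := fun x => g x ^ 2)
    (.of_forall fun x => sq_nonneg _)
    (integrable_of_abs_le (hg.pow_const 2) fun x => sq_abs_le (hB x)) (ε ^ 2)
  rw [le_div_iff₀ (by positivity), mul_comm]
  have hs : {x | ε ≤ |g x|} = {x | ε ^ 2 ≤ g x ^ 2} := by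
    ext x
    simp only [Set.mem_ofPred_eq]
    rw [← sq_abs (g x)]
    exact (sq_le_sq₀ hε.le (abs_nonneg _)).symm
  rwa [hs]

/-! ### Concentration of the kernel and constraints on the normalizations -/

namespace Circuit

variable {X : Type*} {m L : ℕ} (C : Circuit X m L)

theorem pderiv_localModel_update_of_notMem {k : Fin m} {i : Fin L × Fin m}
    (hi : i ∉ C.pastCone k) (j : Fin L × Fin m) (Θ : Params L m) (s : ℝ) (x : X) :
    pderiv (fun Θ : Params L m => C.localModel k Θ x) j (Function.update Θ i s)
      = pderiv (fun Θ : Params L m => C.localModel k Θ x) j Θ := by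
  have h : ∀ d, Function.update Θ i s + Pi.single j d
      = Function.update (Θ + Pi.single j d) i (s + (Pi.single j d : Params L m) i) := fun d => by
    ext a
    by_cases ha : a = i
    · subst ha; simp
    · simp [ha]
  rw [(C.localModel_isTrig k x).pderiv_eq, (C.localModel_isTrig k x).pderiv_eq, h, h,
    C.localModel_update_of_notMem hi, C.localModel_update_of_notMem hi]

theorem mem_futureCone {i : Fin L × Fin m} {k : Fin m} :
    k ∈ C.futureCone i ↔ i ∈ C.pastCone k := by
  simp [futureCone]

/-- Light cones make the sum over all parameters no larger than `gradLip`: the angle `i` affects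
only the `k` in its future cone, each such `f_k` has at most `|𝒩|` nonzero partial derivatives, and
each of these changes by at most 4. The bound counts the pairs `(j, k)`. -/
theorem sum_abs_pderiv_model_sub_update_le {N : ℝ} (hN : 0 < N) (x : X) (i : Fin L × Fin m)
    (Θ : Params L m) (s : ℝ) :
    ∑ j, |pderiv (fun Θ : Params L m => C.model N Θ x) j Θ
      - pderiv (fun Θ : Params L m => C.model N Θ x) j (Function.update Θ i s)|
      ≤ C.gradLip N := by
  set p := fun k => pderiv (fun Θ : Params L m => C.localModel k Θ x)
  have h1 : ∀ j, |pderiv (fun Θ : Params L m => C.model N Θ x) j Θ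
      - pderiv (fun Θ : Params L m => C.model N Θ x) j (Function.update Θ i s)|
      ≤ 1 / N * ∑ k ∈ C.futureCone i, if k ∈ C.futureCone j then 4 else 0 := fun j => by
    rw [pderiv_model, pderiv_model, ← mul_sub, ← Finset.sum_sub_distrib, abs_mul,
      abs_of_pos (by positivity : 0 < 1 / N)]
    gcongr
    refine (Finset.abs_sum_le_sum_abs _ _).trans ?_
    rw [← Finset.sum_filter]
    have : ∀ k ∈ C.futureCone j, |p k j Θ - p k j (Function.update Θ i s)|
        ≤ if k ∈ C.futureCone i then 4 else 0 := fun k _ => by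
      split_ifs with hk
      · refine (abs_sub _ _).trans ?_
        have hb := fun Θ => (C.localModel_isTrig k x).abs_pderiv_le
          (fun Θ => C.abs_localModel_le_one k Θ x) j Θ
        linarith [hb Θ, hb (Function.update Θ i s)]
      · rw [mem_futureCone] at hk
        simp only [p, C.pderiv_localModel_update_of_notMem hk j Θ s x, sub_self, abs_zero, le_refl]
    refine (Finset.sum_le_sum this).trans (le_of_eq ?_)
    rw [← Finset.sum_filter]
    refine Finset.sum_congr ?_ fun _ _ => rfl
    ext k
    simp [and_comm]
  have h2 : ∀ k, ∑ j, (if k ∈ C.futureCone j then (4 : ℝ) else 0) ≤ 4 * C.maxN := fun k => by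
    have : ∑ j, (if k ∈ C.futureCone j then (4 : ℝ) else 0) = 4 * (C.pastCone k).card := by
      simp only [mem_futureCone]
      rw [← Finset.sum_filter, Finset.sum_const, nsmul_eq_mul, mul_comm]
      simp
    rw [this]
    gcongr
    exact C.card_pastCone_le k
  calc _ ≤ ∑ j, 1 / N * ∑ k ∈ C.futureCone i, (if k ∈ C.futureCone j then (4 : ℝ) else 0) :=
        Finset.sum_le_sum fun j _ => h1 j
    _ = 1 / N * ∑ k ∈ C.futureCone i, ∑ j, (if k ∈ C.futureCone j then (4 : ℝ) else 0) := by
        rw [← Finset.mul_sum, Finset.sum_comm]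
    _ ≤ 1 / N * ∑ _k ∈ C.futureCone i, (4 * C.maxN : ℝ) := by
        gcongr with k _
        exact h2 k
    _ = 1 / N * ((C.futureCone i).card * (4 * C.maxN)) := by simp
    _ ≤ 1 / N * (C.maxM * (4 * C.maxN)) := by
        gcongr
        exact C.card_futureCone_le i
    _ = _ := by rw [gradLip]; ring

theorem abs_empNTK_sub_update_le {N NK : ℝ} (hN : 0 < N) (hNK : 0 < NK) (x x' : X)
    (Θ : Params L m) (i : Fin L × Fin m) (s : ℝ) :
    |C.empNTK N NK Θ x x' - C.empNTK N NK (Function.update Θ i s) x x'|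
      ≤ 2 * (C.gradBound N * C.gradLip N / NK) := by
  rw [empNTK, empNTK, ← mul_sub, ← Finset.sum_sub_distrib, abs_mul,
    abs_of_pos (by positivity : 0 < 1 / NK)]
  have ha := C.gradBound_nonneg hN
  set Θ' := Function.update Θ i s with hΘ'
  set p := fun i => pderiv (fun Θ : Params L m => C.model N Θ x) i
  set q := fun i => pderiv (fun Θ : Params L m => C.model N Θ x') i
  have hp := C.sum_abs_pderiv_model_sub_update_le hN x i Θ s
  have hq := C.sum_abs_pderiv_model_sub_update_le hN x' i Θ s
  have : |∑ j, (p j Θ * q j Θ - p j Θ' * q j Θ')| ≤ 2 * (C.gradBound N * C.gradLip N) :=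
    calc _ ≤ ∑ j, |p j Θ * q j Θ - p j Θ' * q j Θ'| := Finset.abs_sum_le_sum_abs _ _
      _ ≤ ∑ j, (C.gradBound N * |p j Θ - p j Θ'| + C.gradBound N * |q j Θ - q j Θ'|) :=
          Finset.sum_le_sum fun j _ => by
          have e : p j Θ * q j Θ - p j Θ' * q j Θ'
              = q j Θ * (p j Θ - p j Θ') + p j Θ' * (q j Θ - q j Θ') := by ring
          rw [e]
          refine (abs_add_le _ _).trans ?_
          rw [abs_mul, abs_mul]
          have h3 := C.abs_pderiv_model_le hN x j Θ'
          have h4 := C.abs_pderiv_model_le hN x' j Θ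
          gcongr
      _ = C.gradBound N * ∑ j, |p j Θ - p j Θ'| + C.gradBound N * ∑ j, |q j Θ - q j Θ'| := by
          rw [Finset.sum_add_distrib, Finset.mul_sum, Finset.mul_sum]
      _ ≤ C.gradBound N * C.gradLip N + C.gradBound N * C.gradLip N := by gcongr
      _ = _ := by ring
  calc _ ≤ 1 / NK * (2 * (C.gradBound N * C.gradLip N)) := by gcongr
    _ = _ := by ring

/-- Concentration of the empirical neural tangent kernel at initialization. -/
theorem measureReal_abs_empNTK_sub_ntk_ge_le {N NK : ℝ} (hN : 0 < N) (hNK : 0 < NK) (x x' : X)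
    {ε : ℝ} (hε : 0 < ε) :
    (uniformInit (Fin L × Fin m)).real {Θ | ε ≤ |C.empNTK N NK Θ x x' - C.ntk N NK x x'|}
      ≤ 2 * (L * m * (C.gradBound N * C.gradLip N / NK) ^ 2) / ε ^ 2 := by
  have hm := (C.empNTK_continuous N NK x x').measurable
  have hB := C.abs_empNTK_le hN hNK x x'
  refine (measureReal_abs_ge_le (hm.sub_const _) (fun Θ => (abs_sub _ _).trans
    (add_le_add (hB Θ) (abs_integral_le_of_abs_le hB))) hε).trans ?_
  gcongr
  refine (integral_sq_sub_le_of_bounded_differences hm hB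
    (C.abs_empNTK_sub_update_le hN hNK x x')).trans (le_of_eq ?_)
  simp only [Fintype.card_prod, Fintype.card_fin, Nat.cast_mul]
  ring

theorem integral_model_eq_zero (N : ℝ) (x : X)
    (h : ∀ k, ∫ Θ, C.localModel k Θ x ∂(uniformInit (Fin L × Fin m)) = 0) :
    ∫ Θ, C.model N Θ x ∂(uniformInit (Fin L × Fin m)) = 0 := by
  unfold model
  rw [integral_const_mul, integral_finsetSum _ fun k _ =>
    integrable_of_abs_le (C.localModel_contDiff k x).continuous.measurable
      fun Θ => C.abs_localModel_le_one k Θ x]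
  simp [h]

/-- The Poincaré inequality for the mean-zero model, whose gradient term is a diagonal entry of the
kernel. As the covariance has a positive limit and the kernel converges, it keeps `NK` away from
zero; with `ntk_le` it bounds `N` from above. -/
theorem four_mul_cov_le {N NK : ℝ} (hN : 0 < N) (hNK : 0 < NK) (x : X)
    (h : ∀ k, ∫ Θ, C.localModel k Θ x ∂(uniformInit (Fin L × Fin m)) = 0) :
    4 * C.cov N x x ≤ NK * C.ntk N NK x x := by
  have hp := (C.model_isTrig N x).poincare (C.model_continuous N x) (C.abs_model_le N x)
  rw [C.integral_model_eq_zero N x h] at hp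
  have hntk : NK * C.ntk N NK x x
      = ∑ i, ∫ Θ, pderiv (fun Θ : Params L m => C.model N Θ x) i Θ ^ 2
        ∂(uniformInit (Fin L × Fin m)) := by
    unfold ntk empNTK
    rw [integral_const_mul, ← mul_assoc, mul_one_div_cancel hNK.ne', one_mul,
      integral_finsetSum _ fun i _ => ?_]
    · simp only [sq]
    · simp only [← sq]
      exact integrable_of_abs_le ((C.pderiv_model_continuous N x i).measurable.pow_const 2)
        fun Θ => sq_abs_le (C.abs_pderiv_model_le hN x i Θ)
  rw [hntk]
  unfold cov
  simp only [← sq]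
  linarith

theorem ntk_le {N NK : ℝ} (hN : 0 < N) (hNK : 0 < NK) (x : X) :
    NK * C.ntk N NK x x ≤ L * m * C.gradBound N ^ 2 := by
  have h := (le_abs_self _).trans
    (abs_integral_le_of_abs_le (μ := uniformInit (Fin L × Fin m)) (C.abs_empNTK_le hN hNK x x))
  rw [le_div_iff₀ hNK, mul_comm] at h
  exact h

theorem ntk_comm (N NK : ℝ) (x x' : X) : C.ntk N NK x x' = C.ntk N NK x' x := by
  simp only [ntk, C.empNTK_comm N NK _ x x']

end Circuit

/-! ### Contraction by a symmetric matrix, with perturbations -/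

section EuclideanNorm

variable {n : ℕ}

/-- The Euclidean norm of a real vector. -/
def l2norm (r : Fin n → ℝ) : ℝ := ‖WithLp.toLp 2 r‖

theorem l2norm_nonneg (r : Fin n → ℝ) : 0 ≤ l2norm r := norm_nonneg _

theorem l2norm_sq (r : Fin n → ℝ) : l2norm r ^ 2 = ∑ j, r j ^ 2 := by
  simp [l2norm, EuclideanSpace.norm_sq_eq]

theorem l2norm_add_le (r s : Fin n → ℝ) : l2norm (r + s) ≤ l2norm r + l2norm s :=
  norm_add_le (WithLp.toLp 2 r) (WithLp.toLp 2 s)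

theorem l2norm_le_sqrt_mul {r : Fin n → ℝ} {c : ℝ} (hc : 0 ≤ c) (h : ∀ j, |r j| ≤ c) :
    l2norm r ≤ √n * c := by
  refine abs_le_of_sq_le_sq' ?_ (by positivity) |>.2
  rw [l2norm_sq, mul_pow, Real.sq_sqrt (by positivity)]
  calc ∑ j, r j ^ 2 ≤ ∑ _j : Fin n, c ^ 2 := Finset.sum_le_sum fun j _ => by
        rw [← sq_abs]
        exact pow_le_pow_left₀ (abs_nonneg _) (h j) 2
    _ = _ := by simp

theorem sum_abs_le_sqrt_mul_l2norm (r : Fin n → ℝ) : ∑ j, |r j| ≤ √n * l2norm r := by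
  have := l2norm_nonneg r
  refine abs_le_of_sq_le_sq' ?_ (by positivity) |>.2
  rw [mul_pow, Real.sq_sqrt (by positivity), l2norm_sq]
  simpa using sq_sum_le_card_mul_sum_sq (s := Finset.univ) (f := fun j => |r j|)

/-- A gradient step with a symmetric kernel matrix is a contraction. -/
theorem l2norm_sub_smul_mulVec_le {K : Matrix (Fin n) (Fin n) ℝ} (hK : K.IsHermitian)
    {lo hi c : ℝ} (hspec : ∀ μ ∈ spectrum ℝ K, lo ≤ μ ∧ μ ≤ hi) (hc : 0 ≤ c)
    (hlo : c * lo ≤ 1) (hhi : c * (lo + hi) ≤ 2) (r : Fin n → ℝ) :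
    l2norm (r - c • K.mulVec r) ≤ (1 - c * lo) * l2norm r := by
  have hr := l2norm_nonneg r
  refine abs_le_of_sq_le_sq' ?_ (mul_nonneg (by linarith) hr) |>.2
  rw [mul_pow, l2norm, l2norm, ← hK.eigenvectorBasis.sum_sq_norm_inner_right,
    ← hK.eigenvectorBasis.sum_sq_norm_inner_right, Finset.mul_sum]
  refine Finset.sum_le_sum fun i _ => ?_
  set v := hK.eigenvectorBasis i
  set μ := hK.eigenvalues i with hμ
  have hv : ∀ w : Fin n → ℝ, inner ℝ v (WithLp.toLp 2 w) = v.ofLp ⬝ᵥ w := fun w => by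
    simp [PiLp.inner_apply, dotProduct, mul_comm]
  have hKv : v.ofLp ⬝ᵥ K.mulVec r = μ * (v.ofLp ⬝ᵥ r) := by
    have hT : K.transpose = K := by
      have := hK; rwa [Matrix.IsHermitian, Matrix.conjTranspose_eq_transpose_of_trivial] at this
    rw [Matrix.dotProduct_mulVec, ← Matrix.mulVec_transpose, hT, hK.mulVec_eigenvectorBasis,
      smul_dotProduct, smul_eq_mul]
  have h := hspec μ (hK.eigenvalues_mem_spectrum_real i)
  rw [hv, hv, dotProduct_sub, dotProduct_smul, hKv, Real.norm_eq_abs, Real.norm_eq_abs, sq_abs,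
    sq_abs, smul_eq_mul, show v.ofLp ⬝ᵥ r - c * (μ * v.ofLp ⬝ᵥ r)
      = (1 - c * μ) * v.ofLp ⬝ᵥ r by ring, mul_pow]
  gcongr ?_ * _
  -- The condition on `lo + hi` gives `1 - c μ ≥ -(1 - c lo)` even for `μ = hi`, where the step may
  -- overshoot.
  refine sq_le_sq' ?_ ?_
  · nlinarith [mul_le_mul_of_nonneg_left h.2 hc]
  · nlinarith [mul_le_mul_of_nonneg_left h.1 hc]

/-- An entrywise kernel error `ε` costs `n * ε`: one factor `√n` is Cauchy–Schwarz in each row, the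
other the passage from the sup norm to the Euclidean norm. -/
theorem l2norm_perturbed_step_le {K Khat : Matrix (Fin n) (Fin n) ℝ} (hK : K.IsHermitian)
    {lo hi c ε τ : ℝ} (hspec : ∀ μ ∈ spectrum ℝ K, lo ≤ μ ∧ μ ≤ hi) (hc : 0 ≤ c)
    (hlo : c * lo ≤ 1) (hhi : c * (lo + hi) ≤ 2) (hε : 0 ≤ ε) (hτ : 0 ≤ τ)
    (hKhat : ∀ j j', |Khat j j' - K j j'| ≤ ε) {r r' : Fin n → ℝ}
    (hr' : ∀ j, |r' j - (r j - c * ∑ j', Khat j j' * r j')| ≤ τ) :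
    l2norm r' ≤ (1 - c * lo + c * (n * ε)) * l2norm r + √n * τ := by
  have hr := l2norm_nonneg r
  set u : Fin n → ℝ := r' - (r - c • K.mulVec r) with hu
  have hb : ∀ j, |u j| ≤ c * (ε * (√n * l2norm r)) + τ := fun j => by
    have e : u j = (r' j - (r j - c * ∑ j', Khat j j' * r j'))
        - c * ∑ j', (Khat j j' - K j j') * r j' := by
      simp only [hu, Pi.sub_apply, Pi.smul_apply, Matrix.mulVec, dotProduct, smul_eq_mul, sub_mul,
        Finset.sum_sub_distrib]
      ring
    have hs : |∑ j', (Khat j j' - K j j') * r j'| ≤ ε * (√n * l2norm r) :=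
      calc _ ≤ ∑ j', |(Khat j j' - K j j') * r j'| := Finset.abs_sum_le_sum_abs _ _
        _ ≤ ∑ j', ε * |r j'| := Finset.sum_le_sum fun j' _ => by
            rw [abs_mul]
            gcongr
            exact hKhat j j'
        _ = ε * ∑ j', |r j'| := by rw [Finset.mul_sum]
        _ ≤ _ := by gcongr; exact sum_abs_le_sqrt_mul_l2norm r
    rw [e]
    refine (abs_sub _ _).trans ?_
    rw [abs_mul, abs_of_nonneg hc, add_comm]
    gcongr
    exact hr' j
  have h1 := l2norm_le_sqrt_mul (by positivity) hb
  have h2 := l2norm_sub_smul_mulVec_le hK hspec hc hlo hhi r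
  have h3 := l2norm_add_le (r - c • K.mulVec r) u
  rw [hu, add_sub_cancel] at h3
  have hn : √(n : ℝ) * √n = n := Real.mul_self_sqrt (by positivity)
  calc l2norm r' ≤ (1 - c * lo) * l2norm r + √n * (c * (ε * (√n * l2norm r)) + τ) := by linarith
    _ = (1 - c * lo) * l2norm r + c * ((√n * √n) * ε) * l2norm r + √n * τ := by ring
    _ = _ := by rw [hn]; ring

end EuclideanNorm

/-! ### Descent of the residuals -/

namespace Circuit

variable {X : Type*} {m L : ℕ} (C : Circuit X m L) {n : ℕ}

/-- The residuals on the training set. -/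
def residual (N : ℝ) (x : Fin n → X) (y : Fin n → ℝ) (Θ : Params L m) : Fin n → ℝ :=
  fun j => C.model N Θ (x j) - y j

theorem loss_eq (N : ℝ) (x : Fin n → X) (y : Fin n → ℝ) (Θ : Params L m) :
    C.loss N x y Θ = l2norm (C.residual N x y Θ) ^ 2 / (2 * n) := by
  rw [loss, l2norm_sq, ← Finset.mul_sum]
  simp only [residual]
  ring

theorem pderiv_loss (N : ℝ) (x : Fin n → X) (y : Fin n → ℝ) (i : Fin L × Fin m)
    (Θ : Params L m) : pderiv (C.loss N x y) i Θ = 1 / n * ∑ j, C.residual N x y Θ j *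
      pderiv (fun Θ : Params L m => C.model N Θ (x j)) i Θ := by
  refine HasDerivAt.deriv (HasDerivAt.const_mul _ (HasDerivAt.fun_sum fun j _ => ?_))
  have h := hasDerivAt_update_of_differentiable (C.model_differentiable N (x j)) Θ i
  rw [← pderiv_eq_fderiv (C.model_differentiable N (x j))] at h
  have h2 := ((h.sub_const (y j)).fun_pow 2).const_mul (1 / 2)
  refine h2.congr_deriv ?_
  simp only [Function.update_eq_self, residual]
  ring

theorem abs_pderiv_loss_le {N : ℝ} (hN : 0 < N) (hn : 0 < n) (x : Fin n → X) (y : Fin n → ℝ)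
    (i : Fin L × Fin m) (Θ : Params L m) :
    |pderiv (C.loss N x y) i Θ| ≤ C.gradBound N / √n * l2norm (C.residual N x y Θ) := by
  have ha := C.gradBound_nonneg hN
  have hn' : (0 : ℝ) < n := by exact_mod_cast hn
  rw [pderiv_loss, abs_mul, abs_of_pos (by positivity : (0 : ℝ) < 1 / n)]
  have : |∑ j, C.residual N x y Θ j * pderiv (fun Θ : Params L m => C.model N Θ (x j)) i Θ|
      ≤ √n * l2norm (C.residual N x y Θ) * C.gradBound N :=
    calc _ ≤ ∑ j, |C.residual N x y Θ j
          * pderiv (fun Θ : Params L m => C.model N Θ (x j)) i Θ| :=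
          Finset.abs_sum_le_sum_abs _ _
      _ ≤ ∑ j, |C.residual N x y Θ j| * C.gradBound N := Finset.sum_le_sum fun j _ => by
          rw [abs_mul]
          gcongr
          exact C.abs_pderiv_model_le hN _ _ _
      _ = (∑ j, |C.residual N x y Θ j|) * C.gradBound N := by rw [Finset.sum_mul]
      _ ≤ _ := by gcongr; exact sum_abs_le_sqrt_mul_l2norm _
  have hs : √(n : ℝ) * √n = n := Real.mul_self_sqrt hn'.le
  have hsp : 0 < √(n : ℝ) := Real.sqrt_pos.mpr hn'
  calc _ ≤ 1 / n * (√n * l2norm (C.residual N x y Θ) * C.gradBound N) := by gcongr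
    _ = 1 / (√n * √n) * (√n * l2norm (C.residual N x y Θ) * C.gradBound N) := by rw [hs]
    _ = _ := by field_simp

/-- One step of stochastic gradient descent with small noise: displacement of the parameters and
decrease of the residuals. -/
theorem descent_step {N NK : ℝ} (hN : 0 < N) (hNK : 0 < NK) (hn : 0 < n) (x : Fin n → X)
    (y : Fin n → ℝ) {K : Matrix (Fin n) (Fin n) ℝ} (hK : K.IsHermitian) {lo hi η₀ A D ε : ℝ}
    (hspec : ∀ μ ∈ spectrum ℝ K, lo ≤ μ ∧ μ ≤ hi) (hη : 0 < η₀)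
    (hlo : η₀ * lo ≤ 1) (hhi : η₀ * (lo + hi) ≤ 2) (hε : 0 ≤ ε) (hA : 0 ≤ A)
    (hD : D = n / NK * η₀ * (C.gradBound N / √n + A)) {Θ Θ' ξ : Params L m}
    (hnoise : ∀ i, |ξ i - pderiv (C.loss N x y) i Θ| ≤ A * l2norm (C.residual N x y Θ))
    (hstep : Θ' = Θ - (n / NK * η₀) • ξ)
    (hker : ∀ j j', |C.empNTK N NK Θ (x j) (x j') - K j j'| ≤ ε) :
    ‖Θ' - Θ‖ ≤ D * l2norm (C.residual N x y Θ) ∧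
    l2norm (C.residual N x y Θ') ≤ (1 - η₀ * lo + η₀ * (n * ε)
      + √n * (n / NK * η₀ * (L * m) * C.gradBound N * A
        + L * m * C.gradLip N * D ^ 2 * l2norm (C.residual N x y Θ)))
      * l2norm (C.residual N x y Θ) := by
  set ρ := l2norm (C.residual N x y Θ) with hρ
  set r := C.residual N x y Θ with hr
  have hρ0 : 0 ≤ ρ := l2norm_nonneg _
  have ha := C.gradBound_nonneg hN
  have hb := C.gradLip_nonneg hN
  have hn' : (0 : ℝ) < n := by exact_mod_cast hn
  have hη' : 0 < n / NK * η₀ := by positivity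
  have hD0 : 0 ≤ D := by rw [hD]; positivity
  set g : Fin n → Fin L × Fin m → ℝ := fun j i =>
    pderiv (fun Θ : Params L m => C.model N Θ (x j)) i Θ with hg
  have hdisp : ‖Θ' - Θ‖ ≤ D * ρ := by
    rw [hstep, sub_sub_cancel_left, norm_neg, norm_smul, Real.norm_of_nonneg hη'.le, hD,
      mul_assoc _ _ ρ]
    refine mul_le_mul_of_nonneg_left ?_ hη'.le
    refine (pi_norm_le_iff_of_nonneg (x := ξ) (by positivity)).mpr fun i => ?_
    have h1 := hnoise i
    have h2 := C.abs_pderiv_loss_le hN hn x y i Θ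
    rw [Real.norm_eq_abs]
    calc |ξ i| ≤ |ξ i - pderiv (C.loss N x y) i Θ| + |pderiv (C.loss N x y) i Θ| := by
          simpa using abs_add_le (ξ i - pderiv (C.loss N x y) i Θ) (pderiv (C.loss N x y) i Θ)
      _ ≤ _ := by linarith
  refine ⟨hdisp, ?_⟩
  set τ := (n / NK * η₀ * (L * m) * C.gradBound N * A + L * m * C.gradLip N * D ^ 2 * ρ) * ρ
    with hτ
  have hres : ∀ j, |C.residual N x y Θ' j - (r j - η₀ * ∑ j', (Matrix.of fun j j' =>
      C.empNTK N NK Θ (x j) (x j')) j j' * r j')| ≤ τ := fun j => by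
    have hquad := C.abs_model_sub_linModel_le hN (x j) Θ Θ'
    -- The step size cancels the normalizations of loss and kernel, so the exact gradient
    -- contributes `-η₀` times the empirical kernel applied to the residuals; what remains is the
    -- gradient noise.
    have hlin : ∑ i, g j i * (Θ' i - Θ i) = -(η₀ * ∑ j', C.empNTK N NK Θ (x j) (x j') * r j')
        - n / NK * η₀ * ∑ i, g j i * (ξ i - pderiv (C.loss N x y) i Θ) := by
      have e1 : ∑ i, g j i * (Θ' i - Θ i) = -(n / NK * η₀) * ∑ i, g j i * ξ i := by
        rw [Finset.mul_sum]
        refine Finset.sum_congr rfl fun i _ => ?_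
        rw [hstep]
        simp only [Pi.sub_apply, Pi.smul_apply, smul_eq_mul]
        ring
      have e2 : ∑ j', C.empNTK N NK Θ (x j) (x j') * r j'
          = n / NK * ∑ i, g j i * pderiv (C.loss N x y) i Θ := by
        simp only [pderiv_loss, empNTK]
        have : ∀ i, g j i * (1 / n * ∑ j', C.residual N x y Θ j' * g j' i)
            = 1 / n * ∑ j', g j i * g j' i * r j' := fun i => by
          rw [Finset.mul_sum, Finset.mul_sum, Finset.mul_sum]
          refine Finset.sum_congr rfl fun j' _ => ?_
          rw [hr]
          ring
        simp only [hg] at this ⊢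
        simp only [this]
        rw [← Finset.mul_sum, Finset.sum_comm, ← mul_assoc,
          show (n : ℝ) / NK * (1 / n) = 1 / NK by field_simp, Finset.mul_sum]
        refine Finset.sum_congr rfl fun j' _ => ?_
        rw [← Finset.sum_mul, mul_assoc]
      rw [e1, e2]
      simp only [mul_sub, Finset.sum_sub_distrib]
      ring
    have hnz : |∑ i, g j i * (ξ i - pderiv (C.loss N x y) i Θ)|
        ≤ L * m * (C.gradBound N * (A * ρ)) :=
      calc _ ≤ ∑ i, |g j i * (ξ i - pderiv (C.loss N x y) i Θ)| := Finset.abs_sum_le_sum_abs _ _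
        _ ≤ ∑ _i : Fin L × Fin m, C.gradBound N * (A * ρ) := Finset.sum_le_sum fun i _ => by
            rw [abs_mul]
            have h1 := hnoise i
            have h2 := C.abs_pderiv_model_le hN (x j) i Θ
            gcongr
        _ = _ := by simp
    have e : C.residual N x y Θ' j - (r j - η₀ * ∑ j', (Matrix.of fun j j' =>
        C.empNTK N NK Θ (x j) (x j')) j j' * r j')
        = (C.model N Θ' (x j) - C.linModel N Θ Θ' (x j))
          - n / NK * η₀ * ∑ i, g j i * (ξ i - pderiv (C.loss N x y) i Θ) := by
      have : C.linModel N Θ Θ' (x j) = C.model N Θ (x j) + ∑ i, g j i * (Θ' i - Θ i) := rfl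
      rw [this, hlin]
      simp only [hr, residual, Matrix.of_apply]
      ring
    rw [e]
    refine (abs_sub _ _).trans ?_
    rw [abs_mul, abs_of_pos hη']
    calc _ ≤ L * m * C.gradLip N * (D * ρ) ^ 2
          + n / NK * η₀ * (L * m * (C.gradBound N * (A * ρ))) := by
          gcongr
          exact hquad.trans (by gcongr)
      _ = τ := by rw [hτ]; ring
  have h := l2norm_perturbed_step_le hK hspec hη.le hlo hhi hε (by positivity) (τ := τ)
    (Khat := Matrix.of fun j j' => C.empNTK N NK Θ (x j) (x j')) hker hres
  refine h.trans (le_of_eq ?_)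
  rw [hτ]
  ring

/-- A run of gradient descent with small noise, started where the residuals are bounded by `R` and
the empirical kernel is close to its limit, converges at a linear rate. -/
theorem descent {N NK : ℝ} (hN : 0 < N) (hNK : 0 < NK) (hn : 0 < n) (x : Fin n → X)
    (y : Fin n → ℝ) {K : Matrix (Fin n) (Fin n) ℝ} (hK : K.IsHermitian) {lo hi η₀ A D R : ℝ}
    (hspec : ∀ μ ∈ spectrum ℝ K, lo ≤ μ ∧ μ ≤ hi) (hη : 0 < η₀) (hlo0 : 0 < lo)
    (hlo : η₀ * lo ≤ 1) (hhi : η₀ * (lo + hi) ≤ 2) (hA : 0 ≤ A) (hR : 0 ≤ R)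
    (hD : D = n / NK * η₀ * (C.gradBound N / √n + A))
    (hsmall₁ : √n * (n / NK * η₀ * (L * m) * C.gradBound N * A) ≤ η₀ * lo / 8)
    (hsmall₂ : √n * (L * m * C.gradLip N * D ^ 2 * R) ≤ η₀ * lo / 8)
    (hsmall₃ : 2 * (L * m) * C.gradBound N * C.gradLip N / NK * (3 / (η₀ * lo) * (D * R))
      ≤ lo / (16 * n))
    {T : ℕ} {θ ξ : ℕ → Params L m}
    (hnoise : ∀ t < T, ∀ i,
      |ξ t i - pderiv (C.loss N x y) i (θ t)| ≤ A * l2norm (C.residual N x y (θ t)))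
    (hstep : ∀ t < T, θ (t + 1) = θ t - (n / NK * η₀) • ξ t)
    (hker : ∀ j j', |C.empNTK N NK (θ 0) (x j) (x j') - K j j'| ≤ lo / (16 * n))
    (hinit : l2norm (C.residual N x y (θ 0)) ≤ R) :
    ∀ t ≤ T, l2norm (C.residual N x y (θ t)) ≤ R * (1 - η₀ * lo / 3) ^ t ∧
      ‖θ t - θ 0‖ ≤ 3 / (η₀ * lo) * (D * R) := by
  set q := 1 - η₀ * lo / 3 with hq
  have hel : 0 < η₀ * lo := by positivity
  have hq0 : 0 ≤ q := by rw [hq]; linarith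
  have hq1 : q ≤ 1 := by rw [hq]; linarith
  have ha := C.gradBound_nonneg hN
  have hb := C.gradLip_nonneg hN
  have hn' : (0 : ℝ) < n := by exact_mod_cast hn
  have hD0 : 0 ≤ D := by rw [hD]; positivity
  -- The geometric series sums to at most `1/(1 - q) = 3/(η₀ lo)`.
  have hgeom : ∀ t : ℕ, D * R * ∑ s ∈ Finset.range t, q ^ s ≤ 3 / (η₀ * lo) * (D * R) := fun t => by
    have h := geom_sum_mul_neg q t
    have h1 : (∑ s ∈ Finset.range t, q ^ s) * (η₀ * lo) ≤ 3 := by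
      have : 1 - q = η₀ * lo / 3 := by rw [hq]; ring
      rw [this] at h
      have := pow_nonneg hq0 t
      linarith
    rw [← le_div_iff₀ hel] at h1
    rw [mul_comm]
    gcongr
  -- Both bounds go through the induction together: closeness of the parameters gives the kernel
  -- bound that the contraction needs, and the contraction gives the next increment of the
  -- displacement.
  have main : ∀ t ≤ T, l2norm (C.residual N x y (θ t)) ≤ R * q ^ t ∧
      ‖θ t - θ 0‖ ≤ D * R * ∑ s ∈ Finset.range t, q ^ s := fun t => by
    induction t with
    | zero => intro _; simpa using hinit
    | succ t ih =>
      intro ht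
      obtain ⟨ih1, ih2⟩ := ih (by omega)
      have hρ0 := l2norm_nonneg (C.residual N x y (θ t))
      have hqt : q ^ t ≤ 1 := pow_le_one₀ hq0 hq1
      have hρR : l2norm (C.residual N x y (θ t)) ≤ R :=
        ih1.trans (mul_le_of_le_one_right hR hqt)
      have hdist := ih2.trans (hgeom t)
      have hker' : ∀ j j', |C.empNTK N NK (θ t) (x j) (x j') - K j j'| ≤ lo / (8 * n) :=
          fun j j' => by
        have h1 := (C.abs_empNTK_sub_le hN hNK (x j) (x j') (θ 0) (θ t)).trans
          ((mul_le_mul_of_nonneg_left hdist (by positivity)).trans hsmall₃)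
        have h2 := hker j j'
        have h3 := abs_add_le (C.empNTK N NK (θ t) (x j) (x j')
          - C.empNTK N NK (θ 0) (x j) (x j')) (C.empNTK N NK (θ 0) (x j) (x j') - K j j')
        rw [sub_add_sub_cancel] at h3
        have h4 : lo / (8 * n) = lo / (16 * n) + lo / (16 * n) := by ring
        linarith
      obtain ⟨hs1, hs2⟩ := C.descent_step hN hNK hn x y hK hspec hη hlo hhi (by positivity) hA hD
        (hnoise t (by omega)) (hstep t (by omega)) hker'
      -- Kernel error, noise and curvature cost `η₀ lo / 8` each; the remaining gain of five eighths
      -- of `η₀ lo` exceeds the third that is claimed.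
      have hfac : 1 - η₀ * lo + η₀ * (n * (lo / (8 * n)))
          + √n * (n / NK * η₀ * (L * m) * C.gradBound N * A
            + L * m * C.gradLip N * D ^ 2 * l2norm (C.residual N x y (θ t))) ≤ q := by
        have h5 : √n * (L * m * C.gradLip N * D ^ 2 * l2norm (C.residual N x y (θ t)))
            ≤ η₀ * lo / 8 := le_trans (by gcongr) hsmall₂
        have h6 : η₀ * (n * (lo / (8 * n))) = η₀ * lo / 8 := by field_simp
        rw [mul_add, h6, hq]
        linarith
      refine ⟨?_, ?_⟩
      · calc _ ≤ q * l2norm (C.residual N x y (θ t)) := hs2.trans (by gcongr)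
          _ ≤ q * (R * q ^ t) := by gcongr
          _ = _ := by ring
      · rw [Finset.sum_range_succ, mul_add]
        have h7 := norm_add_le (θ t - θ 0) (θ (t + 1) - θ t)
        rw [show θ t - θ 0 + (θ (t + 1) - θ t) = θ (t + 1) - θ 0 by abel] at h7
        have h8 : D * l2norm (C.residual N x y (θ t)) ≤ D * (R * q ^ t) := by gcongr
        have h9 : D * R * q ^ t = D * (R * q ^ t) := by ring
        linarith
  exact fun t ht => ⟨(main t ht).1, (main t ht).2.trans (hgeom t)⟩

end Circuit

/-! ### Gradient noise -/

section Chebyshev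

/-- Chebyshev with a strict inequality, so that `a = 0` is allowed: where the residuals vanish the
variance does too, and the estimate is almost surely exact. -/
theorem measure_lt_abs_sub_integral_le {α : Type*} [MeasurableSpace α] {μ : Measure α}
    [IsProbabilityMeasure μ] {Y : α → ℝ} (hY : Measurable Y) {a κ : ℝ} (ha : 0 ≤ a)
    (h : evariance Y μ ≤ ENNReal.ofReal (κ * a ^ 2)) :
    μ {v | a < |Y v - ∫ v, Y v ∂μ|} ≤ ENNReal.ofReal κ := by
  rcases ha.eq_or_lt with rfl | ha
  · have h0 : evariance Y μ = 0 := by simpa using h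
    rw [evariance_eq_zero_iff hY.aemeasurable] at h0
    refine le_of_eq_of_le ?_ zero_le
    rw [measure_eq_zero_iff_ae_notMem]
    filter_upwards [h0] with v hv
    simp [hv]
  · have hc := meas_ge_le_evariance_div_sq (μ := μ) hY.aestronglyMeasurable (c := a.toNNReal)
      (by simpa using ha)
    have hcoe : ((a.toNNReal : NNReal) : ENNReal) = ENNReal.ofReal a := rfl
    rw [hcoe, Real.coe_toNNReal a ha.le] at hc
    refine (measure_mono fun v hv => ?_).trans (hc.trans ?_)
    · rw [Set.mem_ofPred_eq] at hv ⊢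
      exact hv.le
    · refine ENNReal.div_le_of_le_mul (h.trans (le_of_eq ?_))
      rw [mul_comm κ, ENNReal.ofReal_mul (by positivity), ENNReal.ofReal_pow ha.le, mul_comm]

theorem sum_one_div_add_one_sq_le (T : ℕ) :
    ∑ t ∈ Finset.range T, 1 / ((t : ℝ) + 1) ^ 2 ≤ Real.pi ^ 2 / 6 := by
  have h := hasSum_zeta_two
  have h' : HasSum (fun t : ℕ => 1 / ((t : ℝ) + 1) ^ 2) (Real.pi ^ 2 / 6) := by
    have := (hasSum_nat_add_iff' 1).mpr h
    simpa using this
  exact sum_le_hasSum _ (fun t _ => by positivity) h'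

variable {ι : Type*} [Fintype ι] [DecidableEq ι] {g : GradEstimator ι} {ℓ : (ι → ℝ) → ℝ} {T : ℕ}
  {Ω : Type*} [MeasurableSpace Ω] {P : Measure Ω} [IsProbabilityMeasure P] {η : ℝ}
  {Θ ξ : ℕ → Ω → ι → ℝ} {κ : ℕ → ℝ} {a : (ι → ℝ) → ℝ}

/-- The joint law of the history with the current point and of the estimate is a composition product
with the kernel `g.law t`; Chebyshev holds for every history and is integrated. -/
theorem measure_noise_le (hunb : g.Unbiased ℓ T)
    (hvar : g.VarianceLE (fun t Θ => κ t * a Θ ^ 2) T) (ha0 : ∀ Θ, 0 ≤ a Θ) (ha : Measurable a)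
    (hℓ : ∀ i, Measurable (pderiv ℓ i)) (hrun : IsSGDRun P g η T Θ ξ) {t : ℕ} (ht : t < T) :
    P {ω | ∃ i, a (Θ t ω) < |ξ t ω i - pderiv ℓ i (Θ t ω)|}
      ≤ Fintype.card ι * ENNReal.ofReal (κ t) := by
  have := g.isMarkov t
  have hX := (hrun.estimate t ht).aemeasurable_fst
  have : IsProbabilityMeasure (P.map fun ω => ((fun k : Fin t => (Θ k ω, ξ k ω)), Θ t ω)) :=
    Measure.isProbabilityMeasure_map hX
  set S : Set (((Fin t → (ι → ℝ) × (ι → ℝ)) × (ι → ℝ)) × (ι → ℝ)) :=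
    {q | ∃ i, a q.1.2 < |q.2 i - pderiv ℓ i q.1.2|} with hS
  have hSm : MeasurableSet S := by
    have : S = ⋃ i, {q | a q.1.2 < |q.2 i - pderiv ℓ i q.1.2|} := by
      ext q; simp [hS]
    rw [this]
    refine MeasurableSet.iUnion fun i => measurableSet_lt (by fun_prop) ?_
    have h1 : Measurable fun q : ((Fin t → (ι → ℝ) × (ι → ℝ)) × (ι → ℝ)) × (ι → ℝ) => q.2 i := by
      fun_prop
    have h2 : Measurable fun q : ((Fin t → (ι → ℝ) × (ι → ℝ)) × (ι → ℝ)) × (ι → ℝ) =>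
        pderiv ℓ i q.1.2 := (hℓ i).comp (by fun_prop)
    exact (h1.sub h2).abs
  have h := HasLaw.measure_eq (hrun.estimate t ht) (p := fun q => q ∈ S) hSm
  refine (le_of_eq h).trans ?_
  have hS' : {q | q ∈ S} = S := rfl
  rw [hS', Measure.compProd_apply hSm]
  have hpt : ∀ q, (g.law t) q (Prod.mk q ⁻¹' S) ≤ Fintype.card ι * ENNReal.ofReal (κ t) := by
    rintro ⟨h, Θ'⟩
    have hsub : Prod.mk (h, Θ') ⁻¹' S
        ⊆ ⋃ i, {v | a Θ' < |v i - ∫ v, v i ∂(g.law t (h, Θ'))|} := fun v hv => by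
      obtain ⟨i, hi⟩ := hv
      refine Set.mem_iUnion.mpr ⟨i, ?_⟩
      rw [Set.mem_ofPred_eq, (hunb t ht.le h Θ' i).2]
      exact hi
    refine (measure_mono hsub).trans ((measure_iUnion_fintype_le _ _).trans ?_)
    refine (Finset.sum_le_sum fun i _ => measure_lt_abs_sub_integral_le (measurable_pi_apply i)
      (ha0 Θ') (hvar t ht.le h Θ' i)).trans (le_of_eq ?_)
    simp
  refine (lintegral_mono hpt).trans ?_
  simp

theorem measureReal_noise_le {δ : ℝ} (hδ : 0 ≤ δ) (hunb : g.Unbiased ℓ T)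
    (hκ : ∀ t, Fintype.card ι * κ t ≤ δ / (t + 1) ^ 2)
    (hvar : g.VarianceLE (fun t Θ => κ t * a Θ ^ 2) T) (ha0 : ∀ Θ, 0 ≤ a Θ) (ha : Measurable a)
    (hℓ : ∀ i, Measurable (pderiv ℓ i)) (hrun : IsSGDRun P g η T Θ ξ) :
    P.real {ω | ∃ t < T, ∃ i, a (Θ t ω) < |ξ t ω i - pderiv ℓ i (Θ t ω)|}
      ≤ δ * (Real.pi ^ 2 / 6) := by
  have hset : {ω | ∃ t < T, ∃ i, a (Θ t ω) < |ξ t ω i - pderiv ℓ i (Θ t ω)|}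
      = ⋃ t ∈ Finset.range T, {ω | ∃ i, a (Θ t ω) < |ξ t ω i - pderiv ℓ i (Θ t ω)|} := by
    ext ω; simp
  rw [hset]
  refine (measureReal_biUnion_finset_le _ _).trans ?_
  calc _ ≤ ∑ t ∈ Finset.range T, δ * (1 / ((t : ℝ) + 1) ^ 2) :=
        Finset.sum_le_sum fun t ht => by
        have h := measure_noise_le hunb hvar ha0 ha hℓ hrun (Finset.mem_range.mp ht)
        refine ENNReal.toReal_le_of_le_ofReal (by positivity) (h.trans ?_)
        rw [← ENNReal.ofReal_natCast, ← ENNReal.ofReal_mul (by positivity)]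
        exact ENNReal.ofReal_le_ofReal ((hκ t).trans (le_of_eq (by ring)))
    _ = δ * ∑ t ∈ Finset.range T, 1 / ((t : ℝ) + 1) ^ 2 := by rw [Finset.mul_sum]
    _ ≤ _ := by gcongr; exact sum_one_div_add_one_sq_le T

end Chebyshev

/-! ### High-probability training at fixed size -/

namespace Circuit

variable {X : Type*} {m L : ℕ} (C : Circuit X m L) {n : ℕ}

theorem residual_continuous (N : ℝ) (x : Fin n → X) (y : Fin n → ℝ) :
    Continuous fun Θ : Params L m => l2norm (C.residual N x y Θ) := by
  have := fun j => C.model_continuous N (x j)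
  unfold l2norm residual
  refine continuous_norm.comp ((PiLp.continuous_toLp 2 _).comp ?_)
  exact continuous_pi fun j => (this j).sub continuous_const

theorem pderiv_loss_continuous (N : ℝ) (x : Fin n → X) (y : Fin n → ℝ) (i : Fin L × Fin m) :
    Continuous (pderiv (C.loss N x y) i) := by
  have h1 := fun j => C.model_continuous N (x j)
  have h2 := fun j => C.pderiv_model_continuous N (x j) i
  rw [show pderiv (C.loss N x y) i = _ from funext (C.pderiv_loss N x y i)]
  unfold residual
  fun_prop

/-- At initialization the residuals are bounded in mean square. -/
theorem measureReal_residual_ge_le {N : ℝ} (x : Fin n → X) (y : Fin n → ℝ)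
    (h0 : ∀ k x, ∫ Θ, C.localModel k Θ x ∂(uniformInit (Fin L × Fin m)) = 0) {V R : ℝ}
    (hV : ∀ j, C.cov N (x j) (x j) + y j ^ 2 ≤ V) (hR : 0 < R) :
    (uniformInit (Fin L × Fin m)).real {Θ | R < l2norm (C.residual N x y Θ)} ≤ n * V / R ^ 2 := by
  have hc := C.residual_continuous N x y
  set B := |1 / N| * (m : ℝ) with hB
  have hbd : ∀ Θ, |l2norm (C.residual N x y Θ)| ≤ √n * (B + ∑ j, |y j|) := fun Θ => by
    rw [abs_of_nonneg (l2norm_nonneg _)]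
    refine l2norm_le_sqrt_mul (by positivity) fun j => (abs_sub _ _).trans ?_
    exact add_le_add (C.abs_model_le N (x j) Θ)
      (Finset.single_le_sum (f := fun j => |y j|) (fun j _ => abs_nonneg _) (Finset.mem_univ j))
  have h := measureReal_abs_ge_le (μ := uniformInit (Fin L × Fin m)) hc.measurable hbd hR
  have hint : ∫ Θ, l2norm (C.residual N x y Θ) ^ 2 ∂(uniformInit (Fin L × Fin m)) ≤ n * V := by
    have e : ∀ j, ∫ Θ, C.residual N x y Θ j ^ 2 ∂(uniformInit (Fin L × Fin m))
        = C.cov N (x j) (x j) + y j ^ 2 := fun j => by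
      have hq := integral_quadratic (μ := uniformInit (Fin L × Fin m))
        (C.model_continuous N (x j)).measurable (C.abs_model_le N (x j)) 1 (-2 * y j) (y j ^ 2)
      rw [C.integral_model_eq_zero N (x j) fun k => h0 k (x j)] at hq
      have : ∀ Θ, C.residual N x y Θ j ^ 2
          = 1 * C.model N Θ (x j) ^ 2 + -2 * y j * C.model N Θ (x j) + y j ^ 2 := fun Θ => by
        rw [residual]; ring
      simp only [this, hq, cov, ← sq]
      ring
    simp only [l2norm_sq]
    rw [integral_finsetSum _ fun j _ => ?_]
    · simp only [e]
      exact (Finset.sum_le_sum fun j _ => hV j).trans (by simp)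
    · refine integrable_of_abs_le (B := (B + |y j|) ^ 2)
        ((((C.model_continuous N (x j)).sub continuous_const).pow 2).measurable) fun Θ =>
        sq_abs_le ((abs_sub _ _).trans ?_)
      exact add_le_add (C.abs_model_le N (x j) Θ) le_rfl
  refine (measureReal_mono fun Θ hΘ => ?_).trans (h.trans (by gcongr))
  rw [Set.mem_ofPred_eq] at hΘ ⊢
  exact hΘ.le.trans (le_abs_self _)

/-- Linear convergence of stochastic gradient descent with high probability, for a circuit of
fixed size. -/
theorem training {N NK : ℝ} (hN : 0 < N) (hNK : 0 < NK) (hn : 0 < n) (x : Fin n → X)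
    (y : Fin n → ℝ) {K : Matrix (Fin n) (Fin n) ℝ} (hK : K.IsHermitian)
    {lo hi η₀ A D R V δ : ℝ} (hδ : 0 < δ)
    (h0 : ∀ k x, ∫ Θ, C.localModel k Θ x ∂(uniformInit (Fin L × Fin m)) = 0)
    (hV : ∀ j, C.cov N (x j) (x j) + y j ^ 2 ≤ V) (hVR : 3 * (n * V) ≤ δ * R ^ 2)
    (hspec : ∀ μ ∈ spectrum ℝ K, lo ≤ μ ∧ μ ≤ hi) (hη : 0 < η₀) (hlo0 : 0 < lo)
    (hlo : η₀ * lo ≤ 1) (hhi : η₀ * (lo + hi) ≤ 2) (hA : 0 ≤ A) (hR : 0 < R)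
    (hD : D = n / NK * η₀ * (C.gradBound N / √n + A))
    (hsmall₁ : √n * (n / NK * η₀ * (L * m) * C.gradBound N * A) ≤ η₀ * lo / 8)
    (hsmall₂ : √n * (L * m * C.gradLip N * D ^ 2 * R) ≤ η₀ * lo / 8)
    (hsmall₃ : 2 * (L * m) * C.gradBound N * C.gradLip N / NK * (3 / (η₀ * lo) * (D * R))
      ≤ lo / (16 * n))
    (hntk : ∀ j j', |C.ntk N NK (x j) (x j') - K j j'| ≤ lo / (32 * n))
    (hconc : n ^ 2 * (2 * (L * m * (C.gradBound N * C.gradLip N / NK) ^ 2) / (lo / (32 * n)) ^ 2)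
      ≤ δ / 3)
    {T : ℕ} {g : GradEstimator (Fin L × Fin m)} (hunb : g.Unbiased (C.loss N x y) T) {κ : ℕ → ℝ}
    (hvar : g.VarianceLE (fun t Θ => κ t * (A * l2norm (C.residual N x y Θ)) ^ 2) T)
    (hκ : ∀ t, L * m * κ t ≤ δ / (6 * Real.pi ^ 2) / (t + 1) ^ 2)
    {Ω : Type*} [MeasurableSpace Ω] {P : Measure Ω} [IsProbabilityMeasure P]
    {Θ ξ : ℕ → Ω → Params L m} (hrun : IsSGDRun P g (n / NK * η₀) T Θ ξ) :
    1 - δ ≤ P.real {ω | ∀ t ≤ T,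
      l2norm (C.residual N x y (Θ t ω)) ≤ R * (1 - η₀ * lo / 3) ^ t ∧
      ‖Θ t ω - Θ 0 ω‖ ≤ 3 / (η₀ * lo) * (D * R)} := by
  set G := {ω | ∀ t ≤ T, l2norm (C.residual N x y (Θ t ω)) ≤ R * (1 - η₀ * lo / 3) ^ t ∧
      ‖Θ t ω - Θ 0 ω‖ ≤ 3 / (η₀ * lo) * (D * R)} with hG
  set B₀ := {ω | R < l2norm (C.residual N x y (Θ 0 ω))} with hB₀
  set B₁ := {ω | ∃ p : Fin n × Fin n, lo / (32 * n)
    ≤ |C.empNTK N NK (Θ 0 ω) (x p.1) (x p.2) - C.ntk N NK (x p.1) (x p.2)|} with hB₁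
  set B₂ := {ω | ∃ t < T, ∃ i, A * l2norm (C.residual N x y (Θ t ω))
    < |ξ t ω i - pderiv (C.loss N x y) i (Θ t ω)|} with hB₂
  set B₃ := {ω | ¬ ∀ t < T, Θ (t + 1) ω = Θ t ω - (n / NK * η₀) • ξ t ω} with hB₃
  have hn' : (0 : ℝ) < n := by exact_mod_cast hn
  -- Off the bad events `B₀`, …, `B₃` the sample path satisfies the hypotheses of `descent`; `B₃` is
  -- null.
  have hcover : Set.univ ⊆ G ∪ (B₀ ∪ (B₁ ∪ (B₂ ∪ B₃))) := fun ω _ => by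
    by_contra hcon
    simp only [Set.mem_union, not_or] at hcon
    obtain ⟨hg, h0', h1, h2, h3⟩ := hcon
    simp only [hB₀, hB₁, hB₂, hB₃, Set.mem_ofPred_eq, not_lt, not_exists, not_and, not_not,
      not_le] at h0' h1 h2 h3
    refine hg (C.descent hN hNK hn x y hK hspec hη hlo0 hlo hhi hA hR.le hD hsmall₁ hsmall₂ hsmall₃
      (θ := fun t => Θ t ω) (ξ := fun t => ξ t ω) h2 h3 (fun j j' => ?_) h0')
    have h4 := abs_add_le (C.empNTK N NK (Θ 0 ω) (x j) (x j') - C.ntk N NK (x j) (x j'))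
      (C.ntk N NK (x j) (x j') - K j j')
    rw [sub_add_sub_cancel] at h4
    have h5 : lo / (16 * n) = lo / (32 * n) + lo / (32 * n) := by ring
    linarith [h1 (j, j'), hntk j j']
  have e₀ : P.real B₀ ≤ δ / 3 := by
    have hm : MeasurableSet {Θ : Params L m | R < l2norm (C.residual N x y Θ)} :=
      measurableSet_lt measurable_const (C.residual_continuous N x y).measurable
    have h := hrun.init.measure_eq (p := fun Θ => R < l2norm (C.residual N x y Θ)) hm
    rw [measureReal_def, hB₀, h, ← measureReal_def]
    refine (C.measureReal_residual_ge_le x y h0 hV hR).trans ?_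
    rw [div_le_div_iff₀ (by positivity) (by norm_num)]
    linarith
  have e₁ : P.real B₁ ≤ δ / 3 := by
    have hset : B₁ = ⋃ p ∈ (Finset.univ : Finset (Fin n × Fin n)), {ω | lo / (32 * n)
        ≤ |C.empNTK N NK (Θ 0 ω) (x p.1) (x p.2) - C.ntk N NK (x p.1) (x p.2)|} := by
      ext ω; simp [hB₁]
    rw [hset]
    refine (measureReal_biUnion_finset_le _ _).trans (le_trans ?_ hconc)
    have hp : ∀ p : Fin n × Fin n, P.real {ω | lo / (32 * n)
        ≤ |C.empNTK N NK (Θ 0 ω) (x p.1) (x p.2) - C.ntk N NK (x p.1) (x p.2)|}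
        ≤ 2 * (L * m * (C.gradBound N * C.gradLip N / NK) ^ 2) / (lo / (32 * n)) ^ 2 := fun p => by
      have hm : MeasurableSet {Θ : Params L m | lo / (32 * n)
          ≤ |C.empNTK N NK Θ (x p.1) (x p.2) - C.ntk N NK (x p.1) (x p.2)|} :=
        measurableSet_le measurable_const
          (((C.empNTK_continuous N NK _ _).sub continuous_const).abs).measurable
      have h := hrun.init.measure_eq (p := fun Θ => lo / (32 * n)
          ≤ |C.empNTK N NK Θ (x p.1) (x p.2) - C.ntk N NK (x p.1) (x p.2)|) hm
      rw [measureReal_def, h, ← measureReal_def]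
      exact C.measureReal_abs_empNTK_sub_ntk_ge_le hN hNK _ _ (by positivity)
    refine (Finset.sum_le_sum fun p _ => hp p).trans (le_of_eq ?_)
    simp [sq]
  have e₂ : P.real B₂ ≤ δ / 3 := by
    have h := measureReal_noise_le (δ := δ / (6 * Real.pi ^ 2)) (by positivity) hunb
      (fun t => by simpa using hκ t) hvar (fun Θ => mul_nonneg hA (l2norm_nonneg _))
      ((C.residual_continuous N x y).measurable.const_mul A)
      (fun i => (C.pderiv_loss_continuous N x y i).measurable) hrun
    refine h.trans ?_
    have hpi := Real.pi_pos
    -- The sum of `1/(t+1)²` is at most `π²/6`, so the noise uses only `δ/36` of its share.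
    have : δ / (6 * Real.pi ^ 2) * (Real.pi ^ 2 / 6) = δ / 36 := by field_simp; norm_num
    rw [this]
    linarith
  have e₃ : P.real B₃ = 0 := by
    rw [measureReal_def, hB₃]
    have : ∀ᵐ ω ∂P, ∀ t < T, Θ (t + 1) ω = Θ t ω - (n / NK * η₀) • ξ t ω := by
      rw [ae_all_iff]
      intro t
      by_cases ht : t < T
      · filter_upwards [hrun.step t ht] with ω hω _ using hω
      · exact .of_forall fun ω h => absurd h ht
    rw [ae_iff] at this
    rw [this, ENNReal.toReal_zero]
  have htot := measureReal_mono (μ := P) hcover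
  rw [probReal_univ] at htot
  have u1 := measureReal_union_le (μ := P) G (B₀ ∪ (B₁ ∪ (B₂ ∪ B₃)))
  have u2 := measureReal_union_le (μ := P) B₀ (B₁ ∪ (B₂ ∪ B₃))
  have u3 := measureReal_union_le (μ := P) B₁ (B₂ ∪ B₃)
  have u4 := measureReal_union_le (μ := P) B₂ B₃
  linarith

end Circuit

/-! ### Error terms as the number of qubits grows -/

section Asymptotics

/-- In the regime `P M⁴ K² / N³ → 0` with `N² = O(P M²)` and `NK` bounded away from zero, all error
terms of the training dynamics vanish. -/
theorem tendsto_error_terms {P M K N NK : ℕ → ℝ} {c B : ℝ} (hc : 0 < c) (hB : 0 < B)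
    (hN : ∀ m, 0 < N m) (hpos : ∀ᶠ m in atTop, 1 ≤ P m ∧ 1 ≤ M m ∧ 1 ≤ K m)
    (hNK : ∀ᶠ m in atTop, c ≤ NK m) (hNP : ∀ᶠ m in atTop, N m ^ 2 ≤ B * P m * M m ^ 2)
    (h : Tendsto (fun m => P m * M m ^ 4 * K m ^ 2 / N m ^ 3) atTop (𝓝 0)) :
    Tendsto (fun m => M m / (NK m * N m)) atTop (𝓝 0) ∧
    Tendsto (fun m => N m / (M m * P m)) atTop (𝓝 0) ∧
    Tendsto (fun m => P m * (4 * M m * K m / N m) * (M m / (NK m * N m)) ^ 2) atTop (𝓝 0) ∧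
    Tendsto (fun m => P m * (4 * M m * K m / N m) * (N m / (M m * P m)) ^ 2) atTop (𝓝 0) ∧
    Tendsto (fun m => P m * (2 * M m / N m) * (4 * M m * K m / N m) / NK m
      * (M m / (NK m * N m))) atTop (𝓝 0) ∧
    Tendsto (fun m => P m * (2 * M m / N m) * (4 * M m * K m / N m) / NK m
      * (N m / (M m * P m))) atTop (𝓝 0) ∧
    Tendsto (fun m => P m * ((2 * M m / N m) * (4 * M m * K m / N m) / NK m) ^ 2) atTop (𝓝 0) := by
  -- Every error term is dominated by a constant times `H`, by a constant times `H²`, or by a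
  -- constant times `√H`.
  set H := fun m => P m * M m ^ 4 * K m ^ 2 / N m ^ 3 with hH
  have key : ∀ᶠ m in atTop, 1 ≤ P m ∧ 1 ≤ M m ∧ 1 ≤ K m ∧ c ≤ NK m ∧ 0 ≤ H m ∧
      M m * K m / N m ≤ B * H m ∧ N m / (M m * P m) ≤ B * (M m / N m) ∧
      (K m * N m / (M m * P m)) ^ 2 ≤ B ^ 2 * (B + 1) * H m := by
    filter_upwards [hpos, hNK, hNP] with m hp hnk hnp
    obtain ⟨hP, hM, hK⟩ := hp
    have hn := hN m
    have hP0 : 0 < P m := by linarith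
    have hM0 : 0 < M m := by linarith
    have hK0 : 0 < K m := by linarith
    have hMK : 1 ≤ M m * K m := one_le_mul_of_one_le_of_one_le hM hK
    refine ⟨hP, hM, hK, hnk, by positivity, ?_, ?_, ?_⟩
    · have h1 : M m * K m / N m ≤ (M m * K m) ^ 2 / N m := by
        gcongr
        nlinarith
      refine h1.trans ?_
      simp only [hH]
      rw [← mul_div_assoc, div_le_div_iff₀ hn (by positivity)]
      calc (M m * K m) ^ 2 * N m ^ 3 = N m ^ 2 * ((M m * K m) ^ 2 * N m) := by ring
        _ ≤ B * P m * M m ^ 2 * ((M m * K m) ^ 2 * N m) := by gcongr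
        _ = _ := by ring
    · rw [← mul_div_assoc, div_le_div_iff₀ (by positivity) hn]
      calc N m * N m = N m ^ 2 := by ring
        _ ≤ _ := hnp
        _ = _ := by ring
    · have hlin : N m ≤ (B + 1) * P m * M m := by
        refine abs_le_of_sq_le_sq' (hnp.trans ?_) (by positivity) |>.2
        calc B * P m * M m ^ 2 ≤ B * P m * M m ^ 2 * P m := le_mul_of_one_le_right (by positivity) hP
          _ ≤ (B + 1) ^ 2 * P m ^ 2 * M m ^ 2 := by
            have : 0 ≤ P m ^ 2 * M m ^ 2 := by positivity
            nlinarith [mul_nonneg (by positivity : 0 ≤ B ^ 2 + B + 1) this]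
          _ = _ := by ring
      -- This power makes `(K N / (M P))²` comparable with `H`, whose denominator is `N³`: two
      -- factors `N²` use the bound on `N²`, the last one the weaker linear bound.
      have h5 : N m ^ 5 ≤ B ^ 2 * (B + 1) * P m ^ 3 * M m ^ 5 :=
        calc N m ^ 5 = (N m ^ 2) ^ 2 * N m := by ring
          _ ≤ (B * P m * M m ^ 2) ^ 2 * ((B + 1) * P m * M m) := by gcongr
          _ = _ := by ring
      simp only [hH]
      rw [div_pow, ← mul_div_assoc, div_le_div_iff₀ (by positivity) (by positivity)]
      calc (K m * N m) ^ 2 * N m ^ 3 = K m ^ 2 * N m ^ 5 := by ring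
        _ ≤ K m ^ 2 * (B ^ 2 * (B + 1) * P m ^ 3 * M m ^ 5) := by gcongr
        _ ≤ K m ^ 2 * (B ^ 2 * (B + 1) * P m ^ 3 * M m ^ 5) * M m :=
          le_mul_of_one_le_right (by positivity) hM
        _ = _ := by ring
  have hlim : ∀ k : ℝ, Tendsto (fun m => k * H m) atTop (𝓝 0) := fun k => by
    simpa using h.const_mul k
  have hMN : ∀ᶠ m in atTop, M m / N m ≤ B * H m := by
    filter_upwards [key] with m ⟨hP, hM, hK, hnk, hh, h1, h2, h3⟩
    have hn := hN m
    refine le_trans ?_ h1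
    gcongr
    exact le_mul_of_one_le_right (by linarith) hK
  refine ⟨?_, ?_, ?_, ?_, ?_, ?_, ?_⟩
  · refine squeeze_zero' (g := fun m => B / c * H m) ?_ ?_ (hlim _)
    · filter_upwards [key] with m ⟨hP, hM, hK, hnk, hh, h1, h2, h3⟩
      have hn := hN m
      have hnk0 : 0 < NK m := by linarith
      positivity
    · filter_upwards [key, hMN] with m ⟨hP, hM, hK, hnk, hh, h1, h2, h3⟩ h4
      have hn := hN m
      have hnk0 : 0 < NK m := by linarith
      calc M m / (NK m * N m) = M m / N m / NK m := by field_simp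
        _ ≤ B * H m / c := by gcongr
        _ = _ := by ring
  · refine squeeze_zero' (g := fun m => B * B * H m) ?_ ?_ (hlim _)
    · filter_upwards [key] with m ⟨hP, hM, hK, hnk, hh, h1, h2, h3⟩
      have hn := hN m
      positivity
    · filter_upwards [key, hMN] with m ⟨hP, hM, hK, hnk, hh, h1, h2, h3⟩ h4
      rw [mul_assoc]
      exact h2.trans (by gcongr)
  · refine squeeze_zero' (g := fun m => 4 / c ^ 2 * H m) ?_ ?_ (hlim _)
    · filter_upwards [key] with m ⟨hP, hM, hK, hnk, hh, h1, h2, h3⟩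
      have hn := hN m
      positivity
    · filter_upwards [key] with m ⟨hP, hM, hK, hnk, hh, h1, h2, h3⟩
      have hn := hN m
      have hnk0 : 0 < NK m := by linarith
      have hMK : 1 ≤ M m * K m := one_le_mul_of_one_le_of_one_le hM hK
      calc P m * (4 * M m * K m / N m) * (M m / (NK m * N m)) ^ 2
          = 4 / NK m ^ 2 * (P m * M m ^ 3 * K m * 1 / N m ^ 3) := by field_simp
        _ ≤ 4 / c ^ 2 * (P m * M m ^ 3 * K m * (M m * K m) / N m ^ 3) := by gcongr
        _ = _ := by simp only [hH]; ring
  · refine squeeze_zero' (g := fun m => 4 * √(B ^ 2 * (B + 1) * H m)) ?_ ?_ ?_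
    · filter_upwards [key] with m ⟨hP, hM, hK, hnk, hh, h1, h2, h3⟩
      have hn := hN m
      positivity
    · filter_upwards [key] with m ⟨hP, hM, hK, hnk, hh, h1, h2, h3⟩
      have hn := hN m
      calc P m * (4 * M m * K m / N m) * (N m / (M m * P m)) ^ 2
          = 4 * (K m * N m / (M m * P m)) := by field_simp
        _ ≤ _ := by gcongr; exact Real.le_sqrt_of_sq_le h3
    · have := (hlim (B ^ 2 * (B + 1))).sqrt.const_mul 4
      simpa using this
  · refine squeeze_zero' (g := fun m => 8 / c ^ 2 * H m) ?_ ?_ (hlim _)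
    · filter_upwards [key] with m ⟨hP, hM, hK, hnk, hh, h1, h2, h3⟩
      have hn := hN m
      have hnk0 : 0 < NK m := by linarith
      positivity
    · filter_upwards [key] with m ⟨hP, hM, hK, hnk, hh, h1, h2, h3⟩
      have hn := hN m
      have hnk0 : 0 < NK m := by linarith
      have hMK : 1 ≤ M m * K m := one_le_mul_of_one_le_of_one_le hM hK
      calc P m * (2 * M m / N m) * (4 * M m * K m / N m) / NK m * (M m / (NK m * N m))
          = 8 / NK m ^ 2 * (P m * M m ^ 3 * K m * 1 / N m ^ 3) := by field_simp; norm_num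
        _ ≤ 8 / c ^ 2 * (P m * M m ^ 3 * K m * (M m * K m) / N m ^ 3) := by gcongr
        _ = _ := by simp only [hH]; ring
  · refine squeeze_zero' (g := fun m => 8 * B / c * H m) ?_ ?_ (hlim _)
    · filter_upwards [key] with m ⟨hP, hM, hK, hnk, hh, h1, h2, h3⟩
      have hn := hN m
      have hnk0 : 0 < NK m := by linarith
      positivity
    · filter_upwards [key] with m ⟨hP, hM, hK, hnk, hh, h1, h2, h3⟩
      have hn := hN m
      have hnk0 : 0 < NK m := by linarith
      calc P m * (2 * M m / N m) * (4 * M m * K m / N m) / NK m * (N m / (M m * P m))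
          = 8 * (M m * K m / N m) / NK m := by field_simp; norm_num
        _ ≤ 8 * (B * H m) / c := by gcongr
        _ = _ := by ring
  · refine squeeze_zero' (g := fun m => 64 / c ^ 2 * H m * (B * H m)) ?_ ?_ ?_
    · filter_upwards [key] with m ⟨hP, hM, hK, hnk, hh, h1, h2, h3⟩
      have hn := hN m
      positivity
    · filter_upwards [key, hMN] with m ⟨hP, hM, hK, hnk, hh, h1, h2, h3⟩ h4
      have hn := hN m
      have hnk0 : 0 < NK m := by linarith
      have h5 : 1 / N m ≤ B * H m := le_trans (by gcongr) h4
      calc P m * ((2 * M m / N m) * (4 * M m * K m / N m) / NK m) ^ 2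
          = 64 / NK m ^ 2 * H m * (1 / N m) := by simp only [hH]; field_simp; norm_num
        _ ≤ _ := by gcongr
    · simpa using (hlim (64 / c ^ 2)).mul (hlim B)

end Asymptotics

theorem Circuit.one_le_maxN {X : Type*} {m L : ℕ} (C : Circuit X m L) (h : 1 ≤ C.maxM) :
    1 ≤ C.maxN := by
  obtain ⟨i, -, hi⟩ := (Finset.lt_sup_iff (f := fun i => (C.futureCone i).card)).mp h
  obtain ⟨k, hk⟩ := Finset.card_pos.mp hi
  exact (Finset.card_pos.mpr ⟨i, C.mem_futureCone.mp hk⟩).trans_le (C.card_pastCone_le k)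

/-- The last factor inside the parentheses is the noise level used in the proof of `theorem6p5`. The
result is at most `η l / 8` once `η l ≤ 1` and `w ≥ 4/3`. -/
lemma noise_term_eq {s w n p M N NK η l : ℝ} (hss : s * s = n) (hs : 0 < s) (hw : 0 < w)
    (hp : 0 < p) (hM : 0 < M) (hN : 0 < N) (hNK : 0 < NK) :
    s * (n / NK * η * p * (2 * M / N) * (η * l ^ 2 / n * (NK * N / M) / (12 * p * (w * s))))
      = η * l * (η * l) / (6 * w) := by
  subst hss
  field_simp
  ring

/-- Origin of the constant 864: with `w = √2`, the noise level contributes `12² · 2 = 288`, the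
failure rate `6π²`, and the `1/2` in the loss accounts for `6 · 288 / 2`. -/
lemma variance_bound_eq {s w n p M N NK η l δ t ρ : ℝ} (hss : s * s = n) (hs : 0 < s)
    (hww : w * w = 2) (hp : 0 < p) (hM : 0 < M) (ht : 0 < t) :
    1 / (864 * Real.pi ^ 2) * η ^ 2 * (l ^ 4 / n ^ 2) * (NK ^ 2 * N ^ 2 / (M ^ 2 * p ^ 3))
        * (δ / t ^ 2) * (ρ ^ 2 / (2 * n))
      = δ / (6 * Real.pi ^ 2) / t ^ 2 / p
        * (η * l ^ 2 / n * (NK * N / M) / (12 * p * (w * s)) * ρ) ^ 2 := by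
  have hn : 0 < n := hss ▸ mul_pos hs hs
  have e : (12 * p * (w * s)) ^ 2 = 288 * p ^ 2 * n := by
    calc (12 * p * (w * s)) ^ 2 = 144 * p ^ 2 * (w * w) * (s * s) := by ring
      _ = _ := by rw [hww, hss]; ring
  have hpi := Real.pi_pos
  rw [mul_pow _ ρ, div_pow _ (12 * p * (w * s)), e]
  field_simp
  ring

/-- The factors `1 / M` and `1` mark the slack: the first is at most 1 and the second at most `M`,
which yields the powers of `|ℳ|` in the theorem. -/
lemma linearization_error_eq {n p M K N NK η l R ℒ : ℝ} (hp : 0 < p) (hM : 0 < M)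
    (hN : 0 < N) (hNK : 0 < NK) (hl : 0 < l) :
    p * (4 * M * K / N) *
        (R ^ 2 * ℒ * (2 * (6 * n / l * (M / (NK * N))) ^ 2 + 2 * (η * l * (N / (M * p))) ^ 2))
      = 2 * (2 * R) ^ 2 * η ^ 2 * l ^ 2 * ℒ * (K * N / p * (1 / M))
        + 2 * (12 * R) ^ 2 / l ^ 2 * n ^ 2 * ℒ * (p * M ^ 3 * 1 * K / (NK ^ 2 * N ^ 3)) := by
  field_simp
  ring

end QNN

end

/-! ### The theorem: choice of constants and assembly -/

set_option maxHeartbeats 1000000 in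
open QNN in
theorem theorem6p5
    -- failure probability, bound on the labels, bound on the limiting variances at the inputs
    (δ By BK : ℝ) (hδ : 0 < δ) :
    ∃ R₀ R₁ R₂ : ℝ, 0 < R₀ ∧ 0 < R₁ ∧ 0 < R₂ ∧
    ∀ (d : ℕ) (𝒳 : Set (EuclideanSpace ℝ (Fin d)))
      -- a sequence of circuits, and the normalization constants
      (L : ℕ → ℕ) (C : (m : ℕ) → Circuit 𝒳 m (L m))
      (N NK : ℕ → ℝ) (_ : ∀ m, 0 < N m) (_ : ∀ m, 0 < NK m)
      -- mean zero and limiting covariance at initialization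
      (𝒦 : 𝒳 → 𝒳 → ℝ) (_ : ∀ x, 0 < 𝒦 x x)
      (_ : ∀ m k x,
        ∫ Θ, (C m).localModel k Θ x ∂(uniformInit (Fin (L m) × Fin m)) = 0)
      (_ : TendstoUniformly (fun m (p : 𝒳 × 𝒳) => (C m).cov (N m) p.1 p.2)
        (fun p => 𝒦 p.1 p.2) atTop)
      -- the limit of the analytic neural tangent kernel
      (Kbar : 𝒳 → 𝒳 → ℝ)
      (_ : TendstoUniformly (fun m (p : 𝒳 × 𝒳) => (C m).ntk (N m) (NK m) p.1 p.2)
        (fun p => Kbar p.1 p.2) atTop)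
      -- the training set
      (n : ℕ) (x : Fin n → 𝒳) (y : Fin n → ℝ)
      (_ : ∀ j, |y j| ≤ By) (_ : ∀ j, 𝒦 (x j) (x j) ≤ BK)
      -- the extreme eigenvalues of the limiting kernel matrix on the training set
      (lmin lmax : ℝ)
      (_ : IsLeast (spectrum ℝ (Matrix.of fun j j' => Kbar (x j) (x j'))) lmin)
      (_ : IsGreatest (spectrum ℝ (Matrix.of fun j j' => Kbar (x j) (x j'))) lmax)
      (_ : 0 < lmin)
      -- growth of the light cones
      (_ : Tendsto (fun m : ℕ => (L m : ℝ) * m * ((C m).maxM : ℝ) ^ 4 * ((C m).maxN : ℝ) ^ 2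
        / N m ^ 3) atTop (𝓝 0))
      -- the rescaled learning rate
      (η₀ : ℝ) (_ : 0 < η₀) (_ : η₀ < 2 / (lmin + lmax)),
      -- the bound on the displacement of the parameters vanishes
      Tendsto (fun m : ℕ =>
        R₁ * η₀ * lmin * √(Real.log (2 * n)) * (N m / (((C m).maxM : ℝ) * (L m * m)))
          + R₂ / lmin * n * √(Real.log (2 * n)) * (((C m).maxM : ℝ) / (NK m * N m)))
        atTop (𝓝 0) ∧
      ∃ mbar : ℕ, ∀ m ≥ mbar, ∀ (T : ℕ)
        (g : GradEstimator (Fin (L m) × Fin m))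
        (_ : g.Unbiased ((C m).loss (N m) x y) T)
        (_ : g.VarianceLE (fun t Θ =>
          1 / (864 * Real.pi ^ 2) * η₀ ^ 2 * (lmin ^ 4 / n ^ 2)
            * (NK m ^ 2 * N m ^ 2 / (((C m).maxM : ℝ) ^ 2 * ((L m * m : ℕ) : ℝ) ^ 3))
            * (δ / ((t : ℝ) + 1) ^ 2) * (C m).loss (N m) x y Θ) T)
        (Ω : Type*) [MeasurableSpace Ω] (P : Measure Ω) [IsProbabilityMeasure P]
        (Θ ξ : ℕ → Ω → Params (L m) m)
        (_ : IsSGDRun P g (n / NK m * η₀) T Θ ξ),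
        1 - δ ≤ P.real {ω | ∀ t ≤ T,
          (C m).loss (N m) x y (Θ t ω)
            ≤ R₀ ^ 2 / 2 * Real.log (2 * n) * (1 - η₀ * lmin / 3) ^ (2 * t) ∧
          ‖Θ t ω - Θ 0 ω‖
            ≤ R₁ * η₀ * lmin * √(Real.log (2 * n)) * (N m / (((C m).maxM : ℝ) * (L m * m)))
              + R₂ / lmin * n * √(Real.log (2 * n)) * (((C m).maxM : ℝ) / (NK m * N m)) ∧
          ∀ x' : 𝒳, |(C m).model (N m) (Θ t ω) x' - (C m).linModel (N m) (Θ 0 ω) (Θ t ω) x'|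
            ≤ 2 * R₁ ^ 2 * η₀ ^ 2 * lmin ^ 2 * Real.log (2 * n)
                * (((C m).maxN : ℝ) * N m / (L m * m))
              + 2 * R₂ ^ 2 / lmin ^ 2 * n ^ 2 * Real.log (2 * n)
                * (L m * m * ((C m).maxM : ℝ) ^ 4 * ((C m).maxN : ℝ)
                  / (NK m ^ 2 * N m ^ 3))} := by
  -- A bound for the mean square of a single residual once the covariance is within 1 of its limit.
  set V : ℝ := max BK 0 + 1 + By ^ 2 with hVdef
  have hVpos : 0 < V := by positivity
  have hlog2 : 0 < Real.log 2 := Real.log_pos (by norm_num)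
  -- Chosen so that Markov's inequality leaves probability `δ/3`; only `log (2n) ≥ log 2` is used of
  -- the logarithm.
  set R₀ : ℝ := √(3 * V / (δ * Real.log 2)) with hR₀
  have hR₀pos : 0 < R₀ := Real.sqrt_pos.mpr (by positivity)
  have hR₀sq : R₀ ^ 2 = 3 * V / (δ * Real.log 2) := Real.sq_sqrt (by positivity)
  -- The displacement is bounded with half of these last two constants; the other half absorbs the
  -- factor 4 in `gradLip`, and `(a + b)² ≤ 2a² + 2b²` accounts for the 2 in the third bound.
  refine ⟨R₀, 2 * R₀, 12 * R₀, hR₀pos, by positivity, by positivity, ?_⟩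
  intro d 𝒳 L C N NK hN hNK 𝒦 h𝒦 h0 hcov Kbar hntk n x y hy hBK lmin lmax hlmin hlmax hlpos hgrow
    η₀ hη hη2
  -- A matrix of size zero has empty spectrum, hence no least eigenvalue.
  have hn : 0 < n := by
    rcases Nat.eq_zero_or_pos n with rfl | h
    · have := hlmin.1
      simp [spectrum.of_subsingleton] at this
    · exact h
  have hn' : (0 : ℝ) < n := by exact_mod_cast hn
  have hn1 : (1 : ℝ) ≤ n := by exact_mod_cast hn
  set K : Matrix (Fin n) (Fin n) ℝ := Matrix.of fun j j' => Kbar (x j) (x j') with hKdef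
  have hcov' : ∀ p, Tendsto (fun m => (C m).cov (N m) p p) atTop (𝓝 (𝒦 p p)) := fun p =>
    hcov.tendsto_at (p, p)
  have hntk' : ∀ p p', Tendsto (fun m => (C m).ntk (N m) (NK m) p p') atTop (𝓝 (Kbar p p')) :=
    fun p p' => hntk.tendsto_at (p, p')
  -- Symmetry of the limit is inherited from the kernels at finite `m`.
  have hsymm : K.IsHermitian := by
    ext j j'
    refine tendsto_nhds_unique (hntk' (x j') (x j)) ((hntk' (x j) (x j')).congr fun m => ?_)
    exact (C m).ntk_comm _ _ _ _
  have hspec : ∀ μ ∈ spectrum ℝ K, lmin ≤ μ ∧ μ ≤ lmax := fun μ hμ =>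
    ⟨hlmin.2 hμ, hlmax.2 hμ⟩
  have hle : lmin ≤ lmax := hlmin.2 hlmax.1
  have hhi : η₀ * (lmin + lmax) ≤ 2 := by
    rw [lt_div_iff₀ (by linarith)] at hη2
    exact hη2.le
  have hel : 0 < η₀ * lmin := by positivity
  have hlo : η₀ * lmin ≤ 1 := by nlinarith [mul_le_mul_of_nonneg_left hle hη.le]
  have hcard := (⟨0, hn⟩ : Fin n)
  set p₀ := x hcard with hp₀
  have hk₀ := h𝒦 p₀
  have hcovlow : ∀ᶠ m in atTop, 𝒦 p₀ p₀ / 2 < (C m).cov (N m) p₀ p₀ :=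
    (hcov' p₀).eventually (lt_mem_nhds (by linarith))
  have hntkup : ∀ᶠ m in atTop, (C m).ntk (N m) (NK m) p₀ p₀ < |Kbar p₀ p₀| + 1 :=
    (hntk' p₀ p₀).eventually (gt_mem_nhds (by linarith [le_abs_self (Kbar p₀ p₀)]))
  set c := 2 * 𝒦 p₀ p₀ / (|Kbar p₀ p₀| + 1) with hc
  have hcpos : 0 < c := by positivity
  have hNKlow : ∀ᶠ m in atTop, c ≤ NK m := by
    filter_upwards [hcovlow, hntkup] with m h1 h2
    have h3 := (C m).four_mul_cov_le (hN m) (hNK m) p₀ fun k => h0 m k p₀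
    have h4 := mul_le_mul_of_nonneg_left h2.le (hNK m).le
    rw [hc, div_le_iff₀ (by positivity)]
    linarith
  have hNup : ∀ᶠ m in atTop,
      N m ^ 2 ≤ 2 / 𝒦 p₀ p₀ * (L m * m) * ((C m).maxM : ℝ) ^ 2 := by
    filter_upwards [hcovlow] with m h1
    have h3 := (C m).four_mul_cov_le (hN m) (hNK m) p₀ fun k => h0 m k p₀
    have h4 := (C m).ntk_le (hN m) (hNK m) p₀
    have h5 : 2 * 𝒦 p₀ p₀ ≤ L m * m * (2 * (C m).maxM / N m) ^ 2 := by
      rw [Circuit.gradBound] at h4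
      linarith
    rw [div_pow, ← mul_div_assoc, le_div_iff₀ (by have := hN m; positivity)] at h5
    rw [div_mul_eq_mul_div, div_mul_eq_mul_div, le_div_iff₀ hk₀]
    linarith
  -- Positivity of `N²` in `hNup` excludes an empty parameter set and empty light cones.
  have hpos : ∀ᶠ m : ℕ in atTop, (1 : ℝ) ≤ L m * m ∧ (1 : ℝ) ≤ (C m).maxM ∧
      (1 : ℝ) ≤ (C m).maxN := by
    filter_upwards [hNup] with m h1
    have h2 : 0 < 2 / 𝒦 p₀ p₀ * ((L m * m : ℕ) : ℝ) * ((C m).maxM : ℝ) ^ 2 := by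
      have := hN m
      push_cast
      exact lt_of_lt_of_le (by positivity) h1
    have hP : 0 < L m * m := Nat.pos_of_ne_zero fun h => by simp [h] at h2
    have hM : 1 ≤ (C m).maxM := Nat.pos_of_ne_zero fun h => by simp [h] at h2
    exact ⟨by exact_mod_cast hP, by exact_mod_cast hM, by exact_mod_cast (C m).one_le_maxN hM⟩
  obtain ⟨tu, tv, tbu, tbv, tabu, tabv, tconc⟩ := tendsto_error_terms
    (P := fun m => (L m : ℝ) * m) (M := fun m => ((C m).maxM : ℝ))
    (K := fun m => ((C m).maxN : ℝ)) hcpos (by positivity : 0 < 2 / 𝒦 p₀ p₀) hN hpos hNKlow hNup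
    hgrow
  set u : ℕ → ℝ := fun m => ((C m).maxM : ℝ) / (NK m * N m) with hu
  set v : ℕ → ℝ := fun m => N m / (((C m).maxM : ℝ) * (L m * m)) with hv
  set ℒ := Real.log (2 * n) with hℒ
  have hℒ2 : Real.log 2 ≤ ℒ := Real.log_le_log (by norm_num) (by linarith)
  have hℒ0 : 0 < ℒ := hlog2.trans_le hℒ2
  refine ⟨by simpa using (tv.const_mul _).add (tu.const_mul _), ?_⟩
  set s := √(n : ℝ) with hs
  have hs0 : 0 < s := Real.sqrt_pos.mpr hn'
  have hss : s * s = n := Real.mul_self_sqrt hn'.le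
  set w := √(2 : ℝ) with hw
  have hw0 : 0 < w := Real.sqrt_pos.mpr (by norm_num)
  have hww : w * w = 2 := Real.mul_self_sqrt (by norm_num)
  have hw1 : 4 / 3 ≤ w := Real.le_sqrt_of_sq_le (by norm_num)
  set R : ℝ := R₀ * (s * √ℒ) with hR
  have hRpos : 0 < R := by positivity
  have hRsq : R ^ 2 = R₀ ^ 2 * (n * ℒ) := by
    rw [hR, mul_pow, mul_pow, Real.sq_sqrt hℒ0.le, sq s, hss]
  -- noise level and step size, relative to the norm of the residuals
  set A : ℕ → ℝ := fun m => η₀ * lmin ^ 2 / n * (NK m * N m / (C m).maxM)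
    / (12 * (L m * m) * (w * s)) with hA
  set D : ℕ → ℝ := fun m => n / NK m * η₀ * ((C m).gradBound (N m) / s + A m) with hD
  -- `u` and `v` are the two scales in the displacement bound: `u` stems from the gradient, `v` from
  -- the noise.
  have hDuv : ∀ᶠ m in atTop, D m = 2 * s * η₀ * u m + η₀ ^ 2 * lmin ^ 2 / (12 * (w * s)) * v m := by
    filter_upwards [hpos] with m ⟨hP, hM, _⟩
    have hP0 : (0 : ℝ) < L m * m := by linarith
    have hM0 : (0 : ℝ) < (C m).maxM := by linarith
    have h1 := hN m
    have h2 := hNK m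
    simp only [hD, hA, hu, hv, Circuit.gradBound, ← hss]
    field_simp
  have hbD : Tendsto (fun m => L m * m * (C m).gradLip (N m) * D m ^ 2) atTop (𝓝 0) := by
    refine squeeze_zero' (g := fun m => 2 * (2 * s * η₀) ^ 2 *
        (L m * m * (4 * ((C m).maxM : ℝ) * (C m).maxN / N m) * u m ^ 2)
      + 2 * (η₀ ^ 2 * lmin ^ 2 / (12 * (w * s))) ^ 2 *
        (L m * m * (4 * ((C m).maxM : ℝ) * (C m).maxN / N m) * v m ^ 2)) ?_ ?_ ?_
    · exact .of_forall fun m => by have := (C m).gradLip_nonneg (hN m); positivity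
    · filter_upwards [hDuv] with m h
      rw [h]
      have hb := (C m).gradLip_nonneg (hN m)
      have e : ∀ a b : ℝ, (a + b) ^ 2 ≤ 2 * a ^ 2 + 2 * b ^ 2 := fun a b => by
        nlinarith [sq_nonneg (a - b)]
      refine (mul_le_mul_of_nonneg_left (e _ _) (by positivity)).trans (le_of_eq ?_)
      rw [Circuit.gradLip]
      ring
    · simpa using (tbu.const_mul _).add (tbv.const_mul _)
  have hkD : Tendsto (fun m => 2 * (L m * m) * (C m).gradBound (N m) * (C m).gradLip (N m) / NK m
      * (3 / (η₀ * lmin) * (D m * R))) atTop (𝓝 0) := by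
    have h1 := (tabu.const_mul (2 * (3 / (η₀ * lmin)) * R * (2 * s * η₀))).add
      (tabv.const_mul (2 * (3 / (η₀ * lmin)) * R * (η₀ ^ 2 * lmin ^ 2 / (12 * (w * s)))))
    rw [mul_zero, mul_zero, add_zero] at h1
    refine h1.congr' ?_
    filter_upwards [hDuv] with m h
    rw [h, Circuit.gradBound, Circuit.gradLip]
    ring
  have hsm₂ : ∀ᶠ m in atTop, s * (L m * m * (C m).gradLip (N m) * D m ^ 2 * R)
      ≤ η₀ * lmin / 8 := by
    have h1 := (hbD.mul_const R).const_mul s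
    rw [zero_mul, mul_zero] at h1
    exact h1.eventually (ge_mem_nhds (by positivity))
  have hsm₃ : ∀ᶠ m in atTop, 2 * (L m * m) * (C m).gradBound (N m) * (C m).gradLip (N m) / NK m
      * (3 / (η₀ * lmin) * (D m * R)) ≤ lmin / (16 * n) :=
    hkD.eventually (ge_mem_nhds (by positivity))
  have hconc : ∀ᶠ m in atTop, (n : ℝ) ^ 2 * (2 * (L m * m * ((C m).gradBound (N m) *
      (C m).gradLip (N m) / NK m) ^ 2) / (lmin / (32 * n)) ^ 2) ≤ δ / 3 := by
    have h1 := ((tconc.const_mul 2).div_const ((lmin / (32 * n)) ^ 2)).const_mul ((n : ℝ) ^ 2)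
    rw [mul_zero, zero_div, mul_zero] at h1
    exact h1.eventually (ge_mem_nhds (by positivity))
  have hntkc : ∀ᶠ m in atTop, ∀ j j', |(C m).ntk (N m) (NK m) (x j) (x j') - K j j'|
      ≤ lmin / (32 * n) := by
    rw [eventually_all]
    intro j
    rw [eventually_all]
    intro j'
    have h1 := ((hntk' (x j) (x j')).sub_const (K j j')).abs
    rw [show Kbar (x j) (x j') = K j j' from rfl, sub_self, abs_zero] at h1
    exact h1.eventually (ge_mem_nhds (by positivity))
  have hcovc : ∀ᶠ m in atTop, ∀ j, (C m).cov (N m) (x j) (x j) + y j ^ 2 ≤ V := by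
    rw [eventually_all]
    intro j
    have h1 : ∀ᶠ m in atTop, (C m).cov (N m) (x j) (x j) < BK + 1 :=
      (hcov' (x j)).eventually (gt_mem_nhds (by linarith [hBK j]))
    filter_upwards [h1] with m h2
    have h3 : y j ^ 2 ≤ By ^ 2 := by
      rw [← sq_abs (y j)]
      exact pow_le_pow_left₀ (abs_nonneg _) (hy j) 2
    have := le_max_left BK 0
    rw [hVdef]
    linarith
  -- All conditions concern the circuit, the kernel and the data only, so `mbar` depends neither on
  -- `T` nor on the estimator.
  obtain ⟨mbar, hmbar⟩ := eventually_atTop.mp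
    (hpos.and (hDuv.and (hsm₂.and (hsm₃.and (hconc.and (hntkc.and hcovc))))))
  refine ⟨mbar, fun m hm T g hunb hvar Ω _ P _ Θ ξ hrun => ?_⟩
  obtain ⟨⟨hP, hM, hNn⟩, hDm, hs₂, hs₃, hcm, hnm, hcovm⟩ := hmbar m hm
  have hP0 : (0 : ℝ) < L m * m := by linarith
  have hM0 : (0 : ℝ) < (C m).maxM := by linarith
  have hNm := hN m
  have hNKm := hNK m
  have hAm : 0 ≤ A m := by simp only [hA]; positivity
  have hu0 : 0 ≤ u m := by simp only [hu]; positivity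
  have hv0 : 0 ≤ v m := by simp only [hv]; positivity
  have hVR : 3 * (n * V) ≤ δ * R ^ 2 := by
    rw [hRsq, hR₀sq]
    have : δ * (3 * V / (δ * Real.log 2) * (n * ℒ)) = 3 * (n * V) * (ℒ / Real.log 2) := by
      field_simp
    rw [this]
    exact le_mul_of_one_le_right (by positivity) ((one_le_div hlog2).mpr hℒ2)
  have hs₁ : s * (n / NK m * η₀ * (L m * m) * (C m).gradBound (N m) * A m) ≤ η₀ * lmin / 8 := by
    have e : s * (n / NK m * η₀ * (L m * m) * (C m).gradBound (N m) * A m)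
        = (η₀ * lmin) * (η₀ * lmin) / (6 * w) :=
      noise_term_eq hss hs0 hw0 hP0 hM0 hNm hNKm
    rw [e, div_le_div_iff₀ (by positivity) (by norm_num)]
    have h1 : η₀ * lmin * (η₀ * lmin) ≤ η₀ * lmin := mul_le_of_le_one_left hel.le hlo
    have h2 : η₀ * lmin * (4 / 3) ≤ η₀ * lmin * w := mul_le_mul_of_nonneg_left hw1 hel.le
    linarith
  -- Failure probability per component and time; the division by `L m * m` pays for the union over
  -- components.
  set κ : ℕ → ℝ := fun t => δ / (6 * Real.pi ^ 2) / (t + 1) ^ 2 / (L m * m) with hκ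
  have hvar' : g.VarianceLE (fun t Θ => κ t *
      (A m * l2norm ((C m).residual (N m) x y Θ)) ^ 2) T := by
    refine fun t ht h Θ i => (hvar t ht h Θ i).trans (le_of_eq ?_)
    congr 1
    have ht1 : (0 : ℝ) < (t : ℝ) + 1 := by positivity
    beta_reduce
    rw [(C m).loss_eq, Nat.cast_mul]
    exact variance_bound_eq hss hs0 hww hP0 hM0 ht1
  have hmain := (C m).training (hN m) (hNK m) hn x y hsymm hδ (h0 m) hcovm hVR hspec hη hlpos hlo hhi
    hAm hRpos rfl hs₁ hs₂ hs₃ hnm hcm hunb hvar' (fun t => by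
      simp only [hκ]
      rw [mul_div_cancel₀ _ hP0.ne']) hrun
  refine hmain.trans (measureReal_mono fun ω hω t ht => ?_)
  obtain ⟨hρ, hdist⟩ := hω t ht
  have hq0 : 0 ≤ 1 - η₀ * lmin / 3 := by linarith
  have hdist' : ‖Θ t ω - Θ 0 ω‖ ≤ R₀ * √ℒ * (6 * n / lmin * u m + η₀ * lmin * v m) := by
    refine hdist.trans ?_
    change 3 / (η₀ * lmin) * (D m * R) ≤ _
    have e : 3 / (η₀ * lmin) * (D m * R)
        = R₀ * √ℒ * (6 * (s * s) / lmin * u m + η₀ * lmin * v m * (1 / (4 * w))) := by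
      rw [hDm, hR]
      field_simp
      ring
    rw [e, hss]
    refine mul_le_mul_of_nonneg_left (add_le_add le_rfl
      (mul_le_of_le_one_right (by positivity) ?_)) (by positivity)
    rw [div_le_one (by positivity)]
    linarith
  refine ⟨?_, ?_, fun x' => ?_⟩
  · rw [(C m).loss_eq, div_le_iff₀ (by positivity)]
    calc l2norm ((C m).residual (N m) x y (Θ t ω)) ^ 2 ≤ (R * (1 - η₀ * lmin / 3) ^ t) ^ 2 := by
          have := l2norm_nonneg ((C m).residual (N m) x y (Θ t ω))
          gcongr
      _ = _ := by
          rw [mul_pow, hRsq, ← pow_mul, mul_comm t 2]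
          ring
  · refine hdist'.trans ?_
    change _ ≤ 2 * R₀ * η₀ * lmin * √ℒ * v m + 12 * R₀ / lmin * n * √ℒ * u m
    have h1 : 0 ≤ R₀ * √ℒ * (6 * n / lmin * u m + η₀ * lmin * v m) := by positivity
    have h2 : 2 * R₀ * η₀ * lmin * √ℒ * v m + 12 * R₀ / lmin * n * √ℒ * u m
        = 2 * (R₀ * √ℒ * (6 * n / lmin * u m + η₀ * lmin * v m)) := by ring
    linarith
  · have hb := (C m).gradLip_nonneg hNm
    refine ((C m).abs_model_sub_linModel_le hNm x' (Θ 0 ω) (Θ t ω)).trans ?_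
    have hsq : ‖Θ t ω - Θ 0 ω‖ ^ 2
        ≤ R₀ ^ 2 * ℒ * (2 * (6 * n / lmin * u m) ^ 2 + 2 * (η₀ * lmin * v m) ^ 2) := by
      calc ‖Θ t ω - Θ 0 ω‖ ^ 2
          ≤ (R₀ * √ℒ * (6 * n / lmin * u m + η₀ * lmin * v m)) ^ 2 := by gcongr
        _ = R₀ ^ 2 * ℒ * (6 * n / lmin * u m + η₀ * lmin * v m) ^ 2 := by
            rw [mul_pow, mul_pow, Real.sq_sqrt hℒ0.le]
        _ ≤ _ := by
            gcongr
            nlinarith [sq_nonneg (6 * n / lmin * u m - η₀ * lmin * v m)]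
    refine (mul_le_mul_of_nonneg_left hsq (by positivity)).trans ?_
    have e : L m * m * (C m).gradLip (N m) *
        (R₀ ^ 2 * ℒ * (2 * (6 * n / lmin * u m) ^ 2 + 2 * (η₀ * lmin * v m) ^ 2))
        = 2 * (2 * R₀) ^ 2 * η₀ ^ 2 * lmin ^ 2 * ℒ
            * (((C m).maxN : ℝ) * N m / (L m * m) * (1 / (C m).maxM))
          + 2 * (12 * R₀) ^ 2 / lmin ^ 2 * n ^ 2 * ℒ
            * (L m * m * ((C m).maxM : ℝ) ^ 3 * 1 * ((C m).maxN : ℝ) / (NK m ^ 2 * N m ^ 3)) :=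
      linearization_error_eq hP0 hM0 hNm hNKm hlpos
    rw [e]
    have hM4 : ((C m).maxM : ℝ) ^ 4 = ((C m).maxM : ℝ) ^ 3 * (C m).maxM := by ring
    rw [hM4, ← mul_assoc (L m * m : ℝ)]
    gcongr
    refine mul_le_of_le_one_right (by positivity) ?_
    rw [div_le_one hM0]
    exact hM
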